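/- Let $k$ be a field of characteristic zero and let $V=V_0\oplus V_1$ be a $\mathbb Z_2$-graded Lie algebra over $k$ with even bracket $l=[\cdot,\cdot]$, i.e. $[a,b]=-(-1)^{ab}[b,a]$ and $[a,[b,c]]=[[a,b],c]+(-1)^{ab}[b,[a,c]]$. Let $C(V)=\prod_{n\ge 1}\mathrm{Hom}(\bigwedge^nV,V)$ (graded exterior powers) and let $d$ be the Lie algebra coboundary operator: for $\varphi\in \mathrm{Hom}(\bigwedge^nV,V)$, $$d\varphi(v_1,\dots,v_{n+1})=\sum_{\sigma\in \mathrm{Sh}(2,n-1)}(-1)^\sigma\epsilon(\sigma;v)\,\varphi([v_{\sigma(1)},v_{\sigma(2)}],v_{\sigma(3)},\dots,v_{\sigma(n+1)})-(-1)^{n-1}\sum_{\sigma\in \mathrm{Sh}(n,1)}(-1)^\sigma\epsilon(\sigma;v)\,[\varphi(v_{\sigma(1)},\dots,v_{\sigma(n)}),v_{\sigma(n+1)}],$$ where $\mathrm{Sh}$ denotes unshuffles and $\epsilon(\sigma;v)$ is the Koszul sign. Let $C(V)_q$ consist of the $\varphi=(\varphi_n)$ with $|\varphi_n|=q+n-1$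 in $\mathbb Z_2$; then $d$ maps $C(V)_{q}$ to $C(V)_{q+1}$ and $d^2=0$; put $H(V)_q=\ker (d|_{C(V)_q})/d(C(V)_{q+1})$, so that $H(V)=H(V)_0\oplus H(V)_1=\prod_{n\ge1}H^n(V)$ is the Lie algebra cohomology of $V$ with adjoint coefficients (there are no cochains of degree $0$). Let $W=\Pi V$ be the parity reversion and $\bigodot W=\bigoplus_{n\ge1}\bigodot^nW$ the graded symmetric coalgebra. For $\delta$ a coderivation of $\bigodot W$ inducing $\delta_n:\bigodot^nW\to W$, let $\varphi_n=\eta_1^{-1}\circ\delta_n\circ\eta_n$, where $\eta_n(v_1\wedge\dots\wedge v_n)=(-1)^{(n-1)v_1+\dots+v_{n-1}}\pi v_1\odot\dots\odot\pi v_n$. An $L_\infty$ structure on $V$ is an odd coderivation $D$ of $\bigodot W$ with $D^2=0$. Then: (0) $\delta\mapsto(\varphi_n)$ is a bijection from the coderivations of parity $q$ onto $C(V)_q$, and there is exactly one $L_\infty$ structure $D$ on $V$ with structure maps $l_2=l$ and $l_n=0$ for $n\ne2$. (1) Under this bijection, the $L_\infty$ coboundary operator $\delta\mapsto[\delta,D]=\delta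 D-(-1)^{\delta}D\delta$ coincides up to a sign with $d$; with the conventions above the two operators are equal. (2) $H(V)$ classifies the infinitesimal deformations of the Lie algebra into an $L_\infty$ algebra: let $t$ be a parameter of parity $p\in\mathbb Z_2$ with $t^2=0$, graded commuting with $\bigodot W$. An infinitesimal deformation is an odd $k[t]$-linear codifferential $D_t$ of $\bigodot W\otimes k[t]$ with $D_t\equiv D$ modulo $t$. Two of them are equivalent if an even $k[t]$-linear coalgebra automorphism of $\bigodot W\otimes k[t]$ that is the identity modulo $t$ takes one to the other; this is an equivalence relation. Writing $D_t=D+t\delta$ on $\bigodot W$ and letting $\varphi$ be the cochain of $\delta$, the assignment $D_t\mapsto\varphi$ is a bijection from the infinitesimal deformations onto the cocycles in $C(V)_{p+1}$, and it induces a bijection between equivalence classes of infinitesimal deformations with parameter of parity $p$ and $H(V)_{p+1}$. -/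

import Mathlib

open scoped TensorProduct DirectSum

noncomputable section

namespace SuperLie

/-! ### Super vector spaces: modules with a grading by the integers modulo 2 -/

section Graded

variable {k M : Type*} [Field k] [AddCommGroup M] [Module k M]
variable (𝒱 : ZMod 2 → Submodule k M) [DirectSum.Decomposition 𝒱]

/-- The projection onto the homogeneous component of parity `i`. -/
def proj (i : ZMod 2) : M →ₗ[k] M :=
  (𝒱 i).subtype ∘ₗ DirectSum.component k (ZMod 2) (fun j => 𝒱 j) i ∘ₗ
    (DirectSum.decomposeLinearEquiv 𝒱).toLinearMap

/-- The map `v ↦ (-1)^{q|v|} v` (for homogeneous `v`): the sign that appears when a map or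
a parameter of parity `q` moves past `v`. -/
def koszul (q : ZMod 2) : M →ₗ[k] M :=
  ∑ i : ZMod 2, (-1 : ℤˣ) ^ (i * q) • proj 𝒱 i

/-- The parity reversion `Π V`: the same space with the parity of elements reversed. -/
def parityRev (i : ZMod 2) : Submodule k M := 𝒱 (i + 1)

theorem proj_of_mem {i j : ZMod 2} {x : M} (hx : x ∈ 𝒱 i) :
    proj 𝒱 j x = if j = i then x else 0 := by
  have : proj 𝒱 j x = (DirectSum.decompose 𝒱 x j : M) := rfl
  rw [this]
  split_ifs with h
  · subst h; exact DirectSum.decompose_of_mem_same 𝒱 hx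
  · exact DirectSum.decompose_of_mem_ne 𝒱 hx (Ne.symm h)

theorem koszul_of_mem {i : ZMod 2} (q : ZMod 2) {x : M} (hx : x ∈ 𝒱 i) :
    koszul 𝒱 q x = (-1 : ℤˣ) ^ (i * q) • x := by
  simp only [koszul, LinearMap.sum_apply, LinearMap.smul_apply, proj_of_mem 𝒱 hx]
  rw [Finset.sum_eq_single i]
  · simp
  · intro b _ hb; simp [hb]
  · simp

instance parityRevDecomposition : DirectSum.Decomposition (parityRev 𝒱) :=
  DirectSum.IsInternal.chooseDecomposition _ (by
    have h := DirectSum.Decomposition.isInternal 𝒱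
    rw [DirectSum.isInternal_submodule_iff_iSupIndep_and_iSup_eq_top] at h ⊢
    refine ⟨h.1.comp (f := fun i : ZMod 2 => i + 1) (add_left_injective 1), ?_⟩
    rw [← h.2]
    exact (Equiv.addRight (1 : ZMod 2)).iSup_comp (g := 𝒱))

end Graded

/-! ### The graded symmetric coalgebra -/

section Symmetric

variable {k W : Type*} [Field k] [AddCommGroup W] [Module k W]
variable (𝒲 : ZMod 2 → Submodule k W)

/-- The relations `u ⊗ v = (-1)^{|u||v|} v ⊗ u` of the graded symmetric algebra. -/
inductive SymRel : TensorAlgebra k W → TensorAlgebra k W → Prop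
  | comm {i j : ZMod 2} {u v : W} (hu : u ∈ 𝒲 i) (hv : v ∈ 𝒲 j) :
      SymRel (TensorAlgebra.ι k u * TensorAlgebra.ι k v)
        ((-1 : ℤˣ) ^ (i * j) • (TensorAlgebra.ι k v * TensorAlgebra.ι k u))

/-- The graded symmetric algebra of the super vector space `W`, with its unit. -/
def GradedSym : Type _ := RingQuot (SymRel 𝒲)

namespace GradedSym

instance : Ring (GradedSym 𝒲) := inferInstanceAs (Ring (RingQuot (SymRel 𝒲)))

instance : Algebra k (GradedSym 𝒲) := inferInstanceAs (Algebra k (RingQuot (SymRel 𝒲)))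

/-- The quotient map from the tensor algebra. -/
def mk : TensorAlgebra k W →ₐ[k] GradedSym 𝒲 := RingQuot.mkAlgHom k (SymRel 𝒲)

/-- The inclusion of `W` into its graded symmetric algebra. -/
def ι : W →ₗ[k] GradedSym 𝒲 :=
  (mk 𝒲).toLinearMap ∘ₗ TensorAlgebra.ι k

variable {𝒲} in
theorem ι_mul_ι {i j : ZMod 2} {u v : W} (hu : u ∈ 𝒲 i) (hv : v ∈ 𝒲 j) :
    ι 𝒲 u * ι 𝒲 v = (-1 : ℤˣ) ^ (i * j) • (ι 𝒲 v * ι 𝒲 u) := by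
  have h : mk 𝒲 _ = mk 𝒲 _ := RingQuot.mkAlgHom_rel k (SymRel.comm hu hv)
  rw [map_mul, Units.smul_def, map_zsmul, map_mul] at h
  exact h

/-- The universal property of the graded symmetric algebra. -/
def lift {A : Type*} [Ring A] [Algebra k A] (f : W →ₗ[k] A)
    (hf : ∀ (i j : ZMod 2) (u v : W), u ∈ 𝒲 i → v ∈ 𝒲 j →
      f u * f v = (-1 : ℤˣ) ^ (i * j) • (f v * f u)) : GradedSym 𝒲 →ₐ[k] A :=
  RingQuot.liftAlgHom k ⟨TensorAlgebra.lift k f, by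
    rintro _ _ ⟨hu, hv⟩
    rw [map_mul, Units.smul_def, map_zsmul, map_mul]
    simpa [Units.smul_def] using hf _ _ _ _ hu hv⟩

theorem lift_ι {A : Type*} [Ring A] [Algebra k A] (f : W →ₗ[k] A)
    (hf : ∀ (i j : ZMod 2) (u v : W), u ∈ 𝒲 i → v ∈ 𝒲 j →
      f u * f v = (-1 : ℤˣ) ^ (i * j) • (f v * f u)) (w : W) :
    lift 𝒲 f hf (ι 𝒲 w) = f w := by
  have h := RingQuot.liftAlgHom_mkAlgHom_apply k (s := SymRel 𝒲) (TensorAlgebra.lift k f) (by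
    rintro _ _ ⟨hu, hv⟩
    rw [map_mul, Units.smul_def, map_zsmul, map_mul]
    simpa [Units.smul_def] using hf _ _ _ _ hu hv) (TensorAlgebra.ι k w)
  rw [TensorAlgebra.lift_ι_apply] at h
  exact h

theorem algHom_ext {A : Type*} [Ring A] [Algebra k A] {f g : GradedSym 𝒲 →ₐ[k] A}
    (h : ∀ w, f (ι 𝒲 w) = g (ι 𝒲 w)) : f = g := by
  refine RingQuot.ringQuot_ext' k f g (TensorAlgebra.hom_ext ?_)
  ext w
  exact h w

/-- The projection of the symmetric algebra onto its component `W` of degree one: `w ∈ W` acts on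
`k × W` by `(a, m) ↦ (0, a w)`, so that `1 ↦ (1, 0)`, `w ↦ (0, w)` and products of two or more
elements of `W` go to zero when applied to `(1, 0)`. -/
def toBase : GradedSym 𝒲 →ₗ[k] W :=
  LinearMap.snd k k W ∘ₗ LinearMap.applyₗ ((1, 0) : k × W) ∘ₗ
    (lift 𝒲 (A := Module.End k (k × W))
      ((LinearMap.llcomp k (k × W) W (k × W) (LinearMap.inr k k W)) ∘ₗ
        (LinearMap.smulRightₗ (LinearMap.fst k k W))) (by
      intro i j u v _ _
      ext <;> simp)).toLinearMap

theorem toBase_one : toBase 𝒲 1 = 0 := by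
  simp [toBase]

theorem toBase_ι (w : W) : toBase 𝒲 (ι 𝒲 w) = w := by
  simp [toBase, lift_ι]

theorem toBase_ι_mul_ι (u v : W) : toBase 𝒲 (ι 𝒲 u * ι 𝒲 v) = 0 := by
  simp [toBase, lift_ι]

variable [DirectSum.Decomposition 𝒲]

/-- The parity involution: the algebra automorphism with `w ↦ (-1)^{|w|} w` for `w ∈ W`. -/
def invol : GradedSym 𝒲 →ₐ[k] GradedSym 𝒲 :=
  lift 𝒲 (ι 𝒲 ∘ₗ koszul 𝒲 1) (by
    intro i j u v hu hv
    simp only [LinearMap.comp_apply, koszul_of_mem 𝒲 1 hu, koszul_of_mem 𝒲 1 hv,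
      Units.smul_def, map_zsmul, smul_mul_assoc, mul_smul_comm]
    rw [ι_mul_ι hu hv, Units.smul_def]
    simp only [smul_smul]
    congr 1
    ring)

theorem invol_ι {i : ZMod 2} {w : W} (hw : w ∈ 𝒲 i) :
    invol 𝒲 (ι 𝒲 w) = (-1 : ℤˣ) ^ i • ι 𝒲 w := by
  rw [invol, lift_ι, LinearMap.comp_apply, koszul_of_mem 𝒲 1 hw, Units.smul_def, map_zsmul,
    mul_one, Units.smul_def]

theorem invol_invol (x : GradedSym 𝒲) : invol 𝒲 (invol 𝒲 x) = x := by
  have : (invol 𝒲).comp (invol 𝒲) = AlgHom.id k _ := by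
    apply algHom_ext
    intro w
    simp only [AlgHom.comp_apply, AlgHom.id_apply]
    induction w using DirectSum.Decomposition.inductionOn 𝒲 with
    | zero => simp
    | @homogeneous i m =>
      rw [invol_ι 𝒲 m.2, Units.smul_def, map_zsmul, invol_ι 𝒲 m.2, Units.smul_def, smul_smul,
        Int.units_coe_mul_self, one_smul]
    | add m m' h h' => simp only [map_add, h, h']
  exact DFunLike.congr_fun this x

/-- The elements of parity `i` of the symmetric algebra. A product `w₁ ⋯ wₙ` of homogeneous
elements of `W` has parity `|w₁| + ⋯ + |wₙ|`. -/
def parity (i : ZMod 2) : Submodule k (GradedSym 𝒲) :=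
  LinearMap.eqLocus (invol 𝒲).toLinearMap ((-1 : ℤˣ) ^ i • LinearMap.id)

theorem mem_parity {i : ZMod 2} {x : GradedSym 𝒲} :
    x ∈ parity 𝒲 i ↔ invol 𝒲 x = (-1 : ℤˣ) ^ i • x := Iff.rfl

theorem ι_mem_parity {i : ZMod 2} {w : W} (hw : w ∈ 𝒲 i) : ι 𝒲 w ∈ parity 𝒲 i :=
  invol_ι 𝒲 hw

instance : SetLike.GradedMonoid (parity 𝒲) where
  one_mem := by rw [mem_parity]; simp
  mul_mem i j x y hx hy := by
    rw [mem_parity] at hx hy ⊢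
    rw [map_mul, hx, hy, uzpow_add]
    simp only [Units.smul_def, smul_mul_assoc, mul_smul_comm, smul_smul, Units.val_mul]
    rw [mul_comm]

theorem half_mem (i : ZMod 2) (x : GradedSym 𝒲) :
    (2⁻¹ : k) • (x + (-1 : ℤˣ) ^ i • invol 𝒲 x) ∈ parity 𝒲 i := by
  rw [mem_parity, Units.smul_def, Units.smul_def, map_smul, map_add, map_zsmul, invol_invol,
    smul_comm _ (2⁻¹ : k), smul_add _ x, smul_smul, Int.units_coe_mul_self, one_smul, add_comm]

variable [CharZero k]

theorem eq_zero_of_mem_parity {i : ZMod 2} {x : GradedSym 𝒲} (hx : x ∈ parity 𝒲 i)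
    (hx' : x ∈ parity 𝒲 (i + 1)) : x = 0 := by
  rw [mem_parity] at hx hx'
  rw [hx, uzpow_add, uzpow_one, mul_neg_one, Units.neg_smul, eq_neg_iff_add_eq_zero] at hx'
  have h2 : x + x = 0 := by
    have := congrArg (fun z => (-1 : ℤˣ) ^ i • z) hx'
    simpa [smul_add, smul_smul] using this
  have h3 : (2 : k) • x = 0 := by rw [two_smul]; exact h2
  exact (smul_eq_zero.mp h3).resolve_left two_ne_zero

instance gradedAlgebra : GradedAlgebra (parity 𝒲) where
  toDecomposition := DirectSum.IsInternal.chooseDecomposition _ (by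
    rw [DirectSum.isInternal_submodule_iff_isCompl (parity 𝒲) (i := 0) (j := 1) (by decide)
      (by
        ext i
        have : i = 0 ∨ i = 1 := by revert i; decide
        simpa using this)]
    constructor
    · rw [Submodule.disjoint_def]
      intro x h0 h1
      exact eq_zero_of_mem_parity 𝒲 h0 (by simpa using h1)
    · rw [codisjoint_iff, eq_top_iff]
      intro x _
      have := Submodule.add_mem_sup (half_mem 𝒲 0 x) (half_mem 𝒲 1 x)
      convert this using 1
      rw [← smul_add]
      simp only [uzpow_zero, uzpow_one, one_smul, Units.neg_smul]
      rw [add_add_add_comm, add_neg_cancel, add_zero, ← two_smul k x, smul_smul,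
        inv_mul_cancel₀ two_ne_zero, one_smul])

/-- The comultiplication of the graded symmetric coalgebra as a morphism of superalgebras; it is
determined by `w ↦ w ⊗ 1 + 1 ⊗ w` on `W`. -/
def comulAlg : GradedSym 𝒲 →ₐ[k] parity 𝒲 ᵍ⊗[k] parity 𝒲 :=
  lift 𝒲 ((GradedTensorProduct.includeLeft (parity 𝒲) (parity 𝒲)).toLinearMap ∘ₗ ι 𝒲 +
      (GradedTensorProduct.includeRight (parity 𝒲) (parity 𝒲)).toLinearMap ∘ₗ ι 𝒲) (by
    intro i j u v hu hv
    have key : ∀ (a b : ZMod 2) (x y : W), x ∈ 𝒲 a → y ∈ 𝒲 b →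
        (1 : GradedSym 𝒲) ᵍ⊗ₜ[k] (ι 𝒲 x) * ((ι 𝒲 y) ᵍ⊗ₜ[k] (1 : GradedSym 𝒲)) =
          (-1 : ℤˣ) ^ (a * b) • ((ι 𝒲 y) ᵍ⊗ₜ[k] (ι 𝒲 x) : parity 𝒲 ᵍ⊗[k] parity 𝒲) := by
      intro a b x y hx hy
      have := GradedTensorProduct.tmul_coe_mul_coe_tmul (R := k) (parity 𝒲) (parity 𝒲) 1
        ⟨ι 𝒲 x, ι_mem_parity 𝒲 hx⟩ ⟨ι 𝒲 y, ι_mem_parity 𝒲 hy⟩ 1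
      simpa using this
    have keyr : ∀ (x y : W),
        ((ι 𝒲 x) ᵍ⊗ₜ[k] (1 : GradedSym 𝒲)) * ((1 : GradedSym 𝒲) ᵍ⊗ₜ[k] (ι 𝒲 y)) =
          ((ι 𝒲 x) ᵍ⊗ₜ[k] (ι 𝒲 y) : parity 𝒲 ᵍ⊗[k] parity 𝒲) := by
      intro x y
      have := GradedTensorProduct.tmul_one_mul_one_tmul (R := k) (parity 𝒲) (parity 𝒲)
        (ι 𝒲 x) (ι 𝒲 y)
      simpa using this
    have hl : (GradedTensorProduct.includeLeft (R := k) (parity 𝒲) (parity 𝒲)) (ι 𝒲 u) *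
        (GradedTensorProduct.includeLeft (R := k) (parity 𝒲) (parity 𝒲)) (ι 𝒲 v) =
        (-1 : ℤˣ) ^ (i * j) • ((GradedTensorProduct.includeLeft (R := k) (parity 𝒲) (parity 𝒲))
          (ι 𝒲 v) * (GradedTensorProduct.includeLeft (R := k) (parity 𝒲) (parity 𝒲)) (ι 𝒲 u)) := by
      rw [← map_mul, ι_mul_ι hu hv, Units.smul_def, map_zsmul, map_mul, Units.smul_def]
    have hr : (GradedTensorProduct.includeRight (R := k) (parity 𝒲) (parity 𝒲)) (ι 𝒲 u) *
        (GradedTensorProduct.includeRight (R := k) (parity 𝒲) (parity 𝒲)) (ι 𝒲 v) =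
        (-1 : ℤˣ) ^ (i * j) • ((GradedTensorProduct.includeRight (R := k) (parity 𝒲) (parity 𝒲))
          (ι 𝒲 v) *
          (GradedTensorProduct.includeRight (R := k) (parity 𝒲) (parity 𝒲)) (ι 𝒲 u)) := by
      rw [← map_mul, ι_mul_ι hu hv, Units.smul_def, map_zsmul, map_mul, Units.smul_def]
    simp only [LinearMap.add_apply, LinearMap.comp_apply, AlgHom.toLinearMap_apply, add_mul,
      mul_add, smul_add, hl, hr]
    simp only [GradedTensorProduct.includeLeft_apply, GradedTensorProduct.includeRight_apply,
      keyr, key i j u v hu hv, key j i v u hv hu, smul_smul]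
    rw [mul_comm j i, Int.units_mul_self, one_smul]
    abel)

theorem comulAlg_ι (w : W) :
    comulAlg 𝒲 (ι 𝒲 w) = (ι 𝒲 w) ᵍ⊗ₜ[k] (1 : GradedSym 𝒲) + (1 : GradedSym 𝒲) ᵍ⊗ₜ[k] (ι 𝒲 w) := by
  rw [comulAlg, lift_ι]
  simp

/-- The comultiplication `Δ` of the graded symmetric coalgebra, with counit. The coalgebra without
counit is obtained from it by leaving out the unit `1` and the terms `x ⊗ 1` and `1 ⊗ x`. -/
def comul : GradedSym 𝒲 →ₗ[k] GradedSym 𝒲 ⊗[k] GradedSym 𝒲 :=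
  (GradedTensorProduct.of k (parity 𝒲) (parity 𝒲)).symm.toLinearMap ∘ₗ
    (comulAlg 𝒲).toLinearMap

end GradedSym

variable [DirectSum.Decomposition 𝒲] [CharZero k]

/-- Coderivations of parity `q` of the graded symmetric coalgebra: `Δ D = (D ⊗ 1 + 1 ⊗ D) Δ`, where
`(1 ⊗ D) (x ⊗ y) = (-1)^{q|x|} x ⊗ D y`. The coderivations of the coalgebra without counit are those
with `D 1 = 0`. -/
structure IsCoderivation (q : ZMod 2) (D : GradedSym 𝒲 →ₗ[k] GradedSym 𝒲) : Prop where
  map_parity : ∀ (i : ZMod 2) (x : GradedSym 𝒲), x ∈ GradedSym.parity 𝒲 i → D x ∈ GradedSym.parity 𝒲 (i + q)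
  map_one : D 1 = 0
  comul_comp : GradedSym.comul 𝒲 ∘ₗ D =
    (TensorProduct.map D LinearMap.id + TensorProduct.map (koszul (GradedSym.parity 𝒲) q) D) ∘ₗ
      GradedSym.comul 𝒲

end Symmetric

/-! ### Cochains and the Lie algebra coboundary -/

section Cochains

variable {k V : Type*} [Field k] [AddCommGroup V] [Module k V]

/-- The sign `ε(σ; v₁, …, vₙ)`, for homogeneous `vᵢ` of parity `aᵢ`, with
`v₁ ⊙ ⋯ ⊙ vₙ = ε(σ; v) v_{σ(1)} ⊙ ⋯ ⊙ v_{σ(n)}`. -/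
def koszulSign {n : ℕ} (σ : Equiv.Perm (Fin n)) (a : Fin n → ZMod 2) : ℤˣ :=
  ∏ i, ∏ j, if i < j ∧ σ j < σ i then (-1 : ℤˣ) ^ (a (σ i) * a (σ j)) else 1

/-- The unshuffles of type `(p, n - p)`: the permutations of `n` letters that are increasing on the
first `p` letters and on the last `n - p` letters. -/
def unshuffles (p n : ℕ) : Finset (Equiv.Perm (Fin n)) :=
  open scoped Classical in
  Finset.univ.filter fun σ => ∀ i j : Fin n, i < j → (j.val < p ∨ p ≤ i.val) → σ i < σ j

/-- Families `(φ₁, φ₂, …)` of multilinear maps, `φₙ` in `n` variables; `φₙ₊₁` has index `n`. -/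
abbrev Family (k V : Type*) [Field k] [AddCommGroup V] [Module k V] : Type _ :=
  ∀ n : ℕ, MultilinearMap k (fun _ : Fin (n + 1) => V) V

/-- `(v₁, …, vₘ₊₂) ↦ φ(l(v₁, v₂), v₃, …, vₘ₊₂)`. -/
def compInner (l : V →ₗ[k] V →ₗ[k] V) {m : ℕ} (φ : MultilinearMap k (fun _ : Fin (m + 1) => V) V) :
    MultilinearMap k (fun _ : Fin (m + 2) => V) V :=
  LinearMap.uncurryLeft (M := fun _ : Fin (m + 2) => V)
    ((multilinearCurryLeftEquiv k (fun _ : Fin (m + 1) => V) V).symm.toLinearMap ∘ₗ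
      l.compr₂ φ.curryLeft)

/-- `(v₁, …, vₘ₊₂) ↦ l(φ(v₁, …, vₘ₊₁), vₘ₊₂)`. -/
def compOuter (l : V →ₗ[k] V →ₗ[k] V) {m : ℕ} (φ : MultilinearMap k (fun _ : Fin (m + 1) => V) V) :
    MultilinearMap k (fun _ : Fin (m + 2) => V) V :=
  MultilinearMap.uncurryRight (M := fun _ : Fin (m + 2) => V) (l.compMultilinearMap φ)

theorem compInner_apply (l : V →ₗ[k] V →ₗ[k] V) {m : ℕ}
    (φ : MultilinearMap k (fun _ : Fin (m + 1) => V) V) (v : Fin (m + 2) → V) :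
    compInner l φ v = φ (Fin.cons (l (v 0) (v 1)) fun i : Fin m => v i.succ.succ) := by
  rfl

theorem compOuter_apply (l : V →ₗ[k] V →ₗ[k] V) {m : ℕ}
    (φ : MultilinearMap k (fun _ : Fin (m + 1) => V) V) (v : Fin (m + 2) → V) :
    compOuter l φ v = l (φ fun i => v i.castSucc) (v (Fin.last (m + 1))) := by
  rfl

variable (𝒱 : ZMod 2 → Submodule k V) [DirectSum.Decomposition 𝒱]

/-- The multilinear map that agrees with `F a` on homogeneous arguments of parities `a`. -/
def glue {n : ℕ} (F : (Fin n → ZMod 2) → MultilinearMap k (fun _ : Fin n => V) V) :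
    MultilinearMap k (fun _ : Fin n => V) V :=
  ∑ a : Fin n → ZMod 2, (F a).compLinearMap fun i => proj 𝒱 (a i)

theorem glue_apply {n : ℕ} (F : (Fin n → ZMod 2) → MultilinearMap k (fun _ : Fin n => V) V)
    {a : Fin n → ZMod 2} {v : Fin n → V} (hv : ∀ i, v i ∈ 𝒱 (a i)) : glue 𝒱 F v = F a v := by
  rw [glue, _root_.sum_apply, Finset.sum_eq_single a]
  · simp [proj_of_mem 𝒱 (hv _)]
  · intro b _ hb
    obtain ⟨i, hi⟩ := Function.ne_iff.mp hb
    rw [MultilinearMap.compLinearMap_apply]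
    exact (F b).map_coord_zero i (by simp [proj_of_mem 𝒱 (hv i), hi])
  · simp

/-- The space `C^{n+1}(V)` of graded antisymmetric maps in `n + 1` variables with values in `V`: its
elements of parity `r`. -/
def altMaps (n : ℕ) (r : ZMod 2) : Submodule k (MultilinearMap k (fun _ : Fin (n + 1) => V) V) where
  carrier := {f | ∀ (a : Fin (n + 1) → ZMod 2) (v : Fin (n + 1) → V), (∀ i, v i ∈ 𝒱 (a i)) →
    f v ∈ 𝒱 (r + ∑ i, a i) ∧ ∀ σ : Equiv.Perm (Fin (n + 1)),
      f v = (Equiv.Perm.sign σ * koszulSign σ a) • f fun i => v (σ i)}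
  add_mem' := by
    intro f g hf hg a v hv
    refine ⟨add_mem (hf a v hv).1 (hg a v hv).1, fun σ => ?_⟩
    rw [_root_.add_apply, _root_.add_apply, smul_add, ← (hf a v hv).2 σ,
      ← (hg a v hv).2 σ]
  zero_mem' := by
    intro a v hv
    exact ⟨zero_mem _, fun σ => by simp⟩
  smul_mem' := by
    intro c f hf a v hv
    refine ⟨Submodule.smul_mem _ c (hf a v hv).1, fun σ => ?_⟩
    rw [_root_.smul_apply, _root_.smul_apply, smul_comm, ← (hf a v hv).2 σ]

/-- The part `C(V)_q` of total parity `q` of `C(V) = Hom(⋀ V, V) = ∏_{n ≥ 1} Hom(⋀ⁿ V, V)`: the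
component `φₙ` has parity `q + (n - 1)`, so that the corresponding map `⨀ⁿ ΠV → ΠV` has parity
`q`. -/
def cochains (q : ZMod 2) : Submodule k (Family k V) :=
  Submodule.pi Set.univ fun n => altMaps 𝒱 n (q + n)

/-- The axioms of a `ℤ/2`-graded Lie algebra. -/
structure IsLieSuperalgebra (l : V →ₗ[k] V →ₗ[k] V) : Prop where
  even : ∀ (i j : ZMod 2) (x y : V), x ∈ 𝒱 i → y ∈ 𝒱 j → l x y ∈ 𝒱 (i + j)
  skew : ∀ (i j : ZMod 2) (x y : V), x ∈ 𝒱 i → y ∈ 𝒱 j → l x y = -((-1 : ℤˣ) ^ (i * j) • l y x)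
  jacobi : ∀ (i j : ZMod 2) (x y z : V), x ∈ 𝒱 i → y ∈ 𝒱 j →
    l x (l y z) = l (l x y) z + (-1 : ℤˣ) ^ (i * j) • l y (l x z)

/-- The coboundary `dφ` of a multilinear map `φ` in `m + 1` variables for the bracket `l`. -/
def lieCoboundary (l : V →ₗ[k] V →ₗ[k] V) {m : ℕ}
    (φ : MultilinearMap k (fun _ : Fin (m + 1) => V) V) :
    MultilinearMap k (fun _ : Fin (m + 2) => V) V :=
  glue 𝒱 fun a =>
    ∑ σ ∈ unshuffles 2 (m + 2),
        (Equiv.Perm.sign σ * koszulSign σ a) • (compInner l φ).domDomCongr σ -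
      (-1 : ℤˣ) ^ m • ∑ σ ∈ unshuffles (m + 1) (m + 2),
        (Equiv.Perm.sign σ * koszulSign σ a) • (compOuter l φ).domDomCongr σ

theorem lieCoboundary_apply (l : V →ₗ[k] V →ₗ[k] V) {m : ℕ}
    (φ : MultilinearMap k (fun _ : Fin (m + 1) => V) V) {a : Fin (m + 2) → ZMod 2}
    {v : Fin (m + 2) → V} (hv : ∀ i, v i ∈ 𝒱 (a i)) :
    lieCoboundary 𝒱 l φ v =
      ∑ σ ∈ unshuffles 2 (m + 2), (Equiv.Perm.sign σ * koszulSign σ a) •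
        φ (Fin.cons (l (v (σ 0)) (v (σ 1))) fun i : Fin m => v (σ i.succ.succ)) -
      (-1 : ℤˣ) ^ m • ∑ σ ∈ unshuffles (m + 1) (m + 2), (Equiv.Perm.sign σ * koszulSign σ a) •
        l (φ fun i => v (σ i.castSucc)) (v (σ (Fin.last (m + 1)))) := by
  rw [lieCoboundary, glue_apply 𝒱 _ hv]
  simp [compInner_apply, compOuter_apply]

/-- The Lie algebra coboundary operator `d` on families of cochains; `(dφ)₁ = 0`. -/
def lieDiff (l : V →ₗ[k] V →ₗ[k] V) : Family k V →ₗ[k] Family k V where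
  toFun φ
    | 0 => 0
    | m + 1 => lieCoboundary 𝒱 l (φ m)
  map_add' φ ψ := by
    funext n
    cases n with
    | zero => simp
    | succ m =>
      ext v
      simp only [lieCoboundary, glue, Pi.add_apply, _root_.sum_apply,
        _root_.add_apply, MultilinearMap.compLinearMap_apply, _root_.sub_apply,
        _root_.smul_apply, MultilinearMap.domDomCongr_apply, compInner_apply,
        compOuter_apply, map_add, LinearMap.add_apply, smul_add]
      rw [← Finset.sum_add_distrib]
      refine Finset.sum_congr rfl fun a _ => ?_
      simp only [Finset.sum_add_distrib, smul_add]
      abel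
  map_smul' c φ := by
    funext n
    cases n with
    | zero => simp
    | succ m =>
      ext v
      simp only [lieCoboundary, glue, Pi.smul_apply, _root_.sum_apply,
        MultilinearMap.compLinearMap_apply, _root_.sub_apply, RingHom.id_apply,
        _root_.smul_apply, MultilinearMap.domDomCongr_apply, compInner_apply,
        compOuter_apply, map_smul, LinearMap.smul_apply, Finset.smul_sum, smul_sub]
      simp only [smul_comm _ c]

/-- The cocycles of total parity `q`. -/
def lieCocycles (l : V →ₗ[k] V →ₗ[k] V) (q : ZMod 2) : Submodule k (Family k V) :=
  cochains 𝒱 q ⊓ LinearMap.ker (lieDiff 𝒱 l)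

/-- The coboundaries of total parity `q`: the coboundary operator reverses the total parity. -/
def lieCoboundaries (l : V →ₗ[k] V →ₗ[k] V) (q : ZMod 2) : Submodule k (Family k V) :=
  (cochains 𝒱 (q + 1)).map (lieDiff 𝒱 l)

/-- The part of total parity `q` of the Lie algebra cohomology `H(V) = ∏_{n ≥ 1} Hⁿ(V)` with
coefficients in the adjoint representation. -/
abbrev LieCohomology (l : V →ₗ[k] V →ₗ[k] V) (q : ZMod 2) : Type _ :=
  lieCocycles 𝒱 l q ⧸ (lieCoboundaries 𝒱 l q).submoduleOf (lieCocycles 𝒱 l q)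

end Cochains

/-! ### L∞ algebras -/

section LInfinity

variable {k V : Type*} [Field k] [AddCommGroup V] [Module k V]
variable (𝒱 : ZMod 2 → Submodule k V) [DirectSum.Decomposition 𝒱]

/-- The graded symmetric algebra of the parity reversion of `V`. -/
abbrev SymRev : Type _ := GradedSym (parityRev 𝒱)

/-- The sign `(-1)^{(n-1) a₁ + (n-2) a₂ + ⋯ + aₙ₋₁}` of the isomorphism
`v₁ ∧ ⋯ ∧ vₙ ↦ ± π v₁ ⊙ ⋯ ⊙ π vₙ` between `⋀ⁿ V` and `⨀ⁿ ΠV`. -/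
def etaSign {n : ℕ} (a : Fin n → ZMod 2) : ℤˣ :=
  (-1 : ℤˣ) ^ (∑ i : Fin n, ((n - 1 - i.val : ℕ) : ZMod 2) * a i)

/-- The family `φₙ = η₁⁻¹ ∘ δₙ ∘ ηₙ` of maps `⋀ⁿ V → V` determined by a linear endomorphism `δ` of the
symmetric coalgebra of `ΠV`, where `δₙ : ⨀ⁿ ΠV → ΠV` is induced by `δ`. -/
def structureMaps (δ : SymRev 𝒱 →ₗ[k] SymRev 𝒱) : Family k V := fun n =>
  glue 𝒱 fun a => etaSign a •
    (GradedSym.toBase (parityRev 𝒱) ∘ₗ δ).compMultilinearMap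
      ((MultilinearMap.mkPiAlgebraFin k (n + 1) (SymRev 𝒱)).compLinearMap
        fun _ => GradedSym.ι (parityRev 𝒱))

theorem structureMaps_apply (δ : SymRev 𝒱 →ₗ[k] SymRev 𝒱) {n : ℕ} {a : Fin (n + 1) → ZMod 2}
    {v : Fin (n + 1) → V} (hv : ∀ i, v i ∈ 𝒱 (a i)) :
    structureMaps 𝒱 δ n v = etaSign a • GradedSym.toBase (parityRev 𝒱)
      (δ (List.ofFn fun i => GradedSym.ι (parityRev 𝒱) (v i)).prod) := by
  rw [structureMaps, glue_apply 𝒱 _ hv]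
  simp

variable [CharZero k]

/-- An `L∞` algebra structure on `V`: an odd codifferential on the symmetric coalgebra of `ΠV`. -/
structure LInfinityStructure where
  /-- the codifferential -/
  d : SymRev 𝒱 →ₗ[k] SymRev 𝒱
  isCoderivation : IsCoderivation (parityRev 𝒱) 1 d
  sq_zero : d ∘ₗ d = 0

variable {𝒱}

/-- The `L∞` structure is the one given by the binary bracket `l`: `l₂ = l` and `lₙ = 0` for
`n ≠ 2`. -/
def LInfinityStructure.IsInducedBy (D : LInfinityStructure 𝒱) (l : V →ₗ[k] V →ₗ[k] V) : Prop :=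
  (∀ v : Fin 2 → V, structureMaps 𝒱 D.d 1 v = l (v 0) (v 1)) ∧
    ∀ n : ℕ, n ≠ 1 → structureMaps 𝒱 D.d n = 0

/-- The `L∞` coboundary `[δ, d] = δ d - (-1)^q d δ` of a coderivation `δ` of parity `q`. -/
def LInfinityStructure.coboundary (D : LInfinityStructure 𝒱) (q : ZMod 2)
    (δ : SymRev 𝒱 →ₗ[k] SymRev 𝒱) : SymRev 𝒱 →ₗ[k] SymRev 𝒱 :=
  δ ∘ₗ D.d - (-1 : ℤˣ) ^ q • (D.d ∘ₗ δ)

end LInfinity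

/-! ### Extension of scalars by an infinitesimal parameter

For a parameter `t` of parity `p` with `t² = 0`, the elements `x + t y` of `M[t] = M ⊕ t M` are
represented by the pairs `(x, y)`. The parameter commutes with elements of `M` in the graded sense,
and so `t y` has parity `p + |y|`. -/

section Parameter

variable {k M : Type*} [Field k] [AddCommGroup M] [Module k M]

/-- Multiplication by `t`. -/
def tMul : M × M →ₗ[k] M × M := LinearMap.inr k M M ∘ₗ LinearMap.fst k M M

/-- The elements of parity `i` of `M[t]`. -/
def tParity (p : ZMod 2) (ℳ : ZMod 2 → Submodule k M) (i : ZMod 2) : Submodule k (M × M) :=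
  (ℳ i).prod (ℳ (i + p))

/-- `F : M[t] → M[t]` is a homomorphism of parity `q` of modules over `k[t]`. -/
structure IsTLinear (p : ZMod 2) (ℳ : ZMod 2 → Submodule k M) (q : ZMod 2)
    (F : M × M →ₗ[k] M × M) : Prop where
  map_parity : ∀ (i : ZMod 2) (z : M × M), z ∈ tParity p ℳ i → F z ∈ tParity p ℳ (i + q)
  map_tMul : ∀ z : M × M, F (tMul (k := k) z) = (-1 : ℤˣ) ^ (p * q) • tMul (k := k) (F z)

variable (p : ZMod 2) (ℳ : ZMod 2 → Submodule k M) [DirectSum.Decomposition ℳ]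

/-- The tensor product over `k[t]` of elements of `M[t]`, with values in `(M ⊗ M)[t]`:
`(x + t y) ⊗ (x' + t y') = x ⊗ x' + t (y ⊗ x' + (-1)^{p|x|} x ⊗ y')`. -/
def tTensor : M × M →ₗ[k] M × M →ₗ[k] (M ⊗[k] M) × (M ⊗[k] M) :=
  LinearMap.mk₂ k (fun z z' => (z.1 ⊗ₜ[k] z'.1, z.2 ⊗ₜ[k] z'.1 + koszul ℳ p z.1 ⊗ₜ[k] z'.2))
    (by
      intro x y z
      ext <;> simp only [Prod.fst_add, Prod.snd_add, map_add, TensorProduct.add_tmul]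
      abel)
    (by intro c x y; ext <;> simp [TensorProduct.smul_tmul'])
    (by
      intro x y z
      ext <;> simp only [Prod.fst_add, Prod.snd_add, TensorProduct.tmul_add]
      abel)
    (by intro c x y; ext <;> simp)

/-- The restriction to `M ⊗ M` of `F ⊗ 1 + 1 ⊗ F`, for `F` of parity `q`. -/
def tDerivation (q : ZMod 2) (F : M × M →ₗ[k] M × M) :
    M ⊗[k] M →ₗ[k] (M ⊗[k] M) × (M ⊗[k] M) :=
  TensorProduct.lift
    ((tTensor p ℳ).compl₁₂ (F ∘ₗ LinearMap.inl k M M) (LinearMap.inl k M M) +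
      (tTensor p ℳ).compl₁₂ (LinearMap.inl k M M ∘ₗ koszul ℳ q) (F ∘ₗ LinearMap.inl k M M))

/-- The restriction to `M ⊗ M` of `F ⊗ F`, for `F` even. -/
def tSquare (F : M × M →ₗ[k] M × M) : M ⊗[k] M →ₗ[k] (M ⊗[k] M) × (M ⊗[k] M) :=
  TensorProduct.lift
    ((tTensor p ℳ).compl₁₂ (F ∘ₗ LinearMap.inl k M M) (F ∘ₗ LinearMap.inl k M M))

end Parameter

/-! ### Infinitesimal deformations -/

section Deformations

variable {k V : Type*} [Field k] [CharZero k] [AddCommGroup V] [Module k V]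
variable {𝒱 : ZMod 2 → Submodule k V} [DirectSum.Decomposition 𝒱]

/-- The comultiplication over `k[t]`. -/
def tComul (𝒱 : ZMod 2 → Submodule k V) [DirectSum.Decomposition 𝒱] :
    SymRev 𝒱 × SymRev 𝒱 →ₗ[k]
      (SymRev 𝒱 ⊗[k] SymRev 𝒱) × (SymRev 𝒱 ⊗[k] SymRev 𝒱) :=
  (GradedSym.comul (parityRev 𝒱)).prodMap (GradedSym.comul (parityRev 𝒱))

/-- An infinitesimal deformation of an `L∞` algebra with a parameter `t` of parity `p`: an odd
codifferential over `k[t]`, where `t² = 0`, of the symmetric coalgebra of `ΠV` extended to `k[t]`,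
which reduces to the given codifferential modulo `t`. Both sides of `comul_comp` are `k[t]`-linear of
parity `1`, so it is enough to have it on `SymRev 𝒱`. -/
structure InfDeformation (D : LInfinityStructure 𝒱) (p : ZMod 2) where
  /-- the deformed codifferential -/
  d : SymRev 𝒱 × SymRev 𝒱 →ₗ[k] SymRev 𝒱 × SymRev 𝒱
  isTLinear : IsTLinear p (GradedSym.parity (parityRev 𝒱)) 1 d
  map_one : d (1, 0) = 0
  comul_comp : ∀ x : SymRev 𝒱, tComul 𝒱 (d (x, 0)) =
    tDerivation p (GradedSym.parity (parityRev 𝒱)) 1 d (GradedSym.comul (parityRev 𝒱) x)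
  sq_zero : d ∘ₗ d = 0
  reduces : ∀ x : SymRev 𝒱, (d (x, 0)).1 = D.d x

/-- The family `φ` for which the deformed structure is `l + t φ`. -/
def InfDeformation.cochain {D : LInfinityStructure 𝒱} {p : ZMod 2} (F : InfDeformation D p) :
    Family k V :=
  structureMaps 𝒱 (LinearMap.snd k _ _ ∘ₗ F.d ∘ₗ LinearMap.inl k _ _)

/-- Two infinitesimal deformations are equivalent if there is an automorphism over `k[t]` of the
extended symmetric coalgebra of `ΠV` that takes one to the other and is the identity modulo `t`.
The automorphisms of the coalgebra without counit correspond to those that fix `1`. -/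
def InfDeformation.Equivalent {D : LInfinityStructure 𝒱} {p : ZMod 2}
    (F F' : InfDeformation D p) : Prop :=
  ∃ ρ : (SymRev 𝒱 × SymRev 𝒱) ≃ₗ[k] (SymRev 𝒱 × SymRev 𝒱),
    IsTLinear p (GradedSym.parity (parityRev 𝒱)) 0 ρ.toLinearMap ∧
    ρ (1, 0) = (1, 0) ∧
    (∀ x : SymRev 𝒱, tComul 𝒱 (ρ (x, 0)) =
      tSquare p (GradedSym.parity (parityRev 𝒱)) ρ.toLinearMap (GradedSym.comul (parityRev 𝒱) x)) ∧
    (∀ x : SymRev 𝒱, (ρ (x, 0)).1 = x) ∧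
    ρ.toLinearMap ∘ₗ F.d = F'.d ∘ₗ ρ.toLinearMap

end Deformations

end SuperLie

end

open SuperLie

/-! Everything rests on the cofreeness of the symmetric coalgebra: a coderivation `δ` is the same
thing as its corestriction `toBase ∘ δ`, an arbitrary linear map to `W` of the right parity that
kills `1`. For existence, `coder f` is the map `x ↦ ∑ f(x') x''`; `comul_coder` and `toBase_coder`
show that it is a coderivation with corestriction `f`. For uniqueness (`IsCoderivation.eq_zero`),
let `E = coder toBase` be the Euler derivation, which multiplies degree `n` by `n`. If the
corestriction of `δ` vanishes, then by induction on the degree `E (δ x) = 0` and the counit kills `δ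
x`. In characteristic zero this forces `δ x = 0`.

A corestriction amounts to a family of graded symmetric maps on `ΠV` (`ofSymFamily`), and the signs
`etaSign` turn these into graded antisymmetric maps on `V`, because of `etaSign_mul_koszulSign`.
This gives the bijection between coderivations and cochains.

Let `D` be the coderivation of the bracket. Its corestriction is purely quadratic, so `δ D` only
sees the part of `Δ` whose left factor has degree two, and `D δ` only sees the part whose right
factor lies in `W`. On a monomial, `conv_quadratic_monomial` and `conv_toBase_right_monomial` write
these parts as sums over unshuffles, which are the two sums in the Lie coboundary. Hence
`structureMaps_commutator`: the cochain of `[δ, D]` is `d` of the cochain of `δ`. For `δ = D` it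
reads `2 D² = d l`, and `d l = 0` by the Jacobi identity, so `D` is a codifferential.

For deformations, compare coefficients of `t`. The map `D + t δ` is a codifferential if and only if
`δ` is a coderivation of parity `p + 1` with `[δ, D] = 0`. An automorphism that is the identity
modulo `t` has the form `1 + t β` with `β` a coderivation of parity `p`, and it changes `δ` by `[β,
D]` (`InfDeformation.equivalent_iff`). Deformations are therefore cocycles, and equivalence is
equality modulo coboundaries. -/

set_option linter.unusedSectionVars false

namespace SuperLie

/-! ### Signs and parity operators on super vector spaces -/

section Signs

variable {k M N : Type*} [Field k] [AddCommGroup M] [Module k M] [AddCommGroup N] [Module k N]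

theorem map_sign_smul (f : M →ₗ[k] N) (u : ℤˣ) (x : M) : f (u • x) = u • f x := by
  rw [Units.smul_def, map_zsmul, Units.smul_def]

theorem sign_smul_mem (S : Submodule k M) (u : ℤˣ) {x : M} (hx : x ∈ S) : u • x ∈ S := by
  rw [Units.smul_def]; exact zsmul_mem hx _

theorem sign_smul_tmul (u : ℤˣ) (x : M) (y : N) : (u • x) ⊗ₜ[k] y = u • (x ⊗ₜ[k] y) :=
  map_sign_smul ((TensorProduct.mk k M N).flip y) u x

theorem tmul_sign_smul (u : ℤˣ) (x : M) (y : N) : x ⊗ₜ[k] (u • y) = u • (x ⊗ₜ[k] y) :=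
  map_sign_smul (TensorProduct.mk k M N x) u y

theorem sign_smul_mul {A : Type*} [Ring A] (u : ℤˣ) (x y : A) : (u • x) * y = u • (x * y) := by
  rw [Units.smul_def, Units.smul_def, smul_mul_assoc]

theorem mul_sign_smul {A : Type*} [Ring A] (u : ℤˣ) (x y : A) : x * (u • y) = u • (x * y) := by
  rw [Units.smul_def, Units.smul_def, mul_smul_comm]

variable (ℳ : ZMod 2 → Submodule k M) [DirectSum.Decomposition ℳ]

theorem proj_mem (i : ZMod 2) (x : M) : proj ℳ i x ∈ ℳ i := by
  have : proj ℳ i x = (DirectSum.decompose ℳ x i : M) := rfl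
  rw [this]; exact SetLike.coe_mem _

theorem sum_proj (x : M) : ∑ i : ZMod 2, proj ℳ i x = x := by
  induction x using DirectSum.Decomposition.inductionOn ℳ with
  | zero => simp
  | @homogeneous i m => simp [proj_of_mem ℳ m.2]
  | add x y hx hy => simp only [map_add, Finset.sum_add_distrib, hx, hy]

/-- Linear maps that agree on homogeneous elements are equal. -/
theorem hom_ext_homogeneous {f g : M →ₗ[k] N} (h : ∀ i, ∀ x ∈ ℳ i, f x = g x) : f = g := by
  ext x
  rw [← sum_proj ℳ x, map_sum, map_sum]
  exact Finset.sum_congr rfl fun i _ => h i _ (proj_mem ℳ i x)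

theorem tensor_hom_ext_homogeneous {P : Type*} [AddCommGroup P] [Module k P]
    {f g : M ⊗[k] N →ₗ[k] P} (h : ∀ i, ∀ x ∈ ℳ i, ∀ y, f (x ⊗ₜ y) = g (x ⊗ₜ y)) : f = g := by
  apply TensorProduct.ext
  apply hom_ext_homogeneous ℳ
  intro i x hx
  ext y
  exact h i x hx y

theorem koszul_zero : koszul ℳ 0 = LinearMap.id := by
  apply hom_ext_homogeneous ℳ
  intro i x hx
  simp [koszul_of_mem ℳ 0 hx]

theorem koszul_koszul (p q : ZMod 2) (x : M) : koszul ℳ p (koszul ℳ q x) = koszul ℳ (p + q) x := by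
  suffices h : koszul ℳ p ∘ₗ koszul ℳ q = koszul ℳ (p + q) from LinearMap.congr_fun h x
  apply hom_ext_homogeneous ℳ
  intro i x hx
  rw [LinearMap.comp_apply, koszul_of_mem ℳ q hx, map_sign_smul, koszul_of_mem ℳ p hx,
    koszul_of_mem ℳ _ hx, smul_smul, ← uzpow_add]
  congr 2; ring

/-- A linear map of parity `q`. -/
def HasParity (𝒩 : ZMod 2 → Submodule k N) (q : ZMod 2) (f : M →ₗ[k] N) : Prop :=
  ∀ i, ∀ x ∈ ℳ i, f x ∈ 𝒩 (i + q)

variable {ℳ} in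
theorem HasParity.koszul_comm {𝒩 : ZMod 2 → Submodule k N} [DirectSum.Decomposition 𝒩] {q : ZMod 2}
    {f : M →ₗ[k] N} (hf : HasParity ℳ 𝒩 q f) (p : ZMod 2) (x : M) :
    koszul 𝒩 p (f x) = (-1 : ℤˣ) ^ (p * q) • f (koszul ℳ p x) := by
  suffices h : koszul 𝒩 p ∘ₗ f = (-1 : ℤˣ) ^ (p * q) • f ∘ₗ koszul ℳ p from LinearMap.congr_fun h x
  apply hom_ext_homogeneous ℳ
  intro i x hx
  rw [LinearMap.comp_apply, koszul_of_mem 𝒩 p (hf i x hx), LinearMap.smul_apply,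
    LinearMap.comp_apply, koszul_of_mem ℳ p hx, map_sign_smul, smul_smul, ← uzpow_add]
  congr 2; ring

/-- The component of the wrong parity changes sign, so twice that component is zero. Homogeneity
thus becomes a linear identity, which can be checked on generators. -/
theorem mem_of_koszul_one [CharZero k] {i : ZMod 2} {x : M}
    (h : koszul ℳ 1 x = (-1 : ℤˣ) ^ i • x) : x ∈ ℳ i := by
  have h0 := proj_mem ℳ i x
  have h1 := proj_mem ℳ (i + 1) x
  have hx : x = proj ℳ i x + proj ℳ (i + 1) x := by
    conv_lhs => rw [← sum_proj ℳ x]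
    fin_cases i
    · exact Fin.sum_univ_two _
    · exact (Fin.sum_univ_two _).trans (add_comm _ _)
  rw [hx, map_add, koszul_of_mem ℳ 1 h0, koszul_of_mem ℳ 1 h1, mul_one, mul_one, uzpow_add, uzpow_one,
    mul_neg_one, Units.neg_smul, smul_add, add_right_inj] at h
  have h2 : (2 : k) • ((-1 : ℤˣ) ^ i • proj ℳ (i + 1) x) = 0 := by
    rw [two_smul]; nth_rewrite 1 [← h]; simp
  have h3 := (smul_eq_zero.mp h2).resolve_left two_ne_zero
  have h4 : proj ℳ (i + 1) x = 0 := (smul_eq_zero_iff_eq _).mp h3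
  rw [hx, h4, add_zero]; exact h0

end Signs

/-! ### Induction on the graded symmetric algebra, and its counit -/

namespace GradedSym

variable {k W : Type*} [Field k] [AddCommGroup W] [Module k W]
variable (𝒲 : ZMod 2 → Submodule k W)

theorem mk_surjective : Function.Surjective (mk 𝒲) := RingQuot.mkAlgHom_surjective k _

theorem mul_ι_induction [DirectSum.Decomposition 𝒲] (Q : Submodule k (GradedSym 𝒲)) (h1 : 1 ∈ Q)
    (hι : ∀ i, ∀ w ∈ 𝒲 i, ∀ x ∈ Q, ι 𝒲 w * x ∈ Q) (x : GradedSym 𝒲) : x ∈ Q := by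
  have hι' : ∀ w, ∀ x ∈ Q, ι 𝒲 w * x ∈ Q := by
    intro w x hx
    rw [← sum_proj 𝒲 w, map_sum, Finset.sum_mul]
    exact sum_mem fun i _ => hι i _ (proj_mem 𝒲 i w) x hx
  -- The induction is on the property that left multiplication by `t` preserves `Q`: unlike
  -- membership in `Q`, it is stable under products.
  have key : ∀ t : TensorAlgebra k W, ∀ y ∈ Q, mk 𝒲 t * y ∈ Q := by
    intro t
    induction t using TensorAlgebra.induction with
    | algebraMap r =>
      intro y hy
      rw [AlgHom.commutes, ← Algebra.smul_def]; exact Q.smul_mem r hy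
    | ι w => exact hι' w
    | mul a b ha hb => intro y hy; rw [map_mul, mul_assoc]; exact ha _ (hb _ hy)
    | add a b ha hb => intro y hy; rw [map_add, add_mul]; exact add_mem (ha _ hy) (hb _ hy)
  obtain ⟨t, rfl⟩ := mk_surjective 𝒲 x
  simpa using key t 1 h1

theorem hom_ext_mul_ι [DirectSum.Decomposition 𝒲] {N : Type*} [AddCommGroup N] [Module k N]
    {f g : GradedSym 𝒲 →ₗ[k] N} (h1 : f 1 = g 1)
    (h : ∀ i, ∀ w ∈ 𝒲 i, ∀ x, f x = g x → f (ι 𝒲 w * x) = g (ι 𝒲 w * x)) : f = g := by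
  ext x
  exact mul_ι_induction 𝒲 (LinearMap.eqLocus f g) h1 h x

/-- The counit of the graded symmetric coalgebra. -/
noncomputable def counit : GradedSym 𝒲 →ₗ[k] k :=
  LinearMap.fst k k W ∘ₗ LinearMap.applyₗ ((1, 0) : k × W) ∘ₗ
    (lift 𝒲 (A := Module.End k (k × W))
      ((LinearMap.llcomp k (k × W) W (k × W) (LinearMap.inr k k W)) ∘ₗ
        (LinearMap.smulRightₗ (LinearMap.fst k k W))) (by
      intro i j u v _ _
      ext <;> simp)).toLinearMap

theorem counit_one : counit 𝒲 1 = 1 := by simp [counit]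

theorem counit_ι_mul (w : W) (x : GradedSym 𝒲) : counit 𝒲 (ι 𝒲 w * x) = 0 := by
  simp [counit, lift_ι]

theorem toBase_ι_mul (w : W) (x : GradedSym 𝒲) : toBase 𝒲 (ι 𝒲 w * x) = counit 𝒲 x • w := by
  simp [toBase, counit, lift_ι]

end GradedSym
-- The comultiplication on products with a generator
namespace GradedSym

variable {k W : Type*} [Field k] [CharZero k] [AddCommGroup W] [Module k W]
variable (𝒲 : ZMod 2 → Submodule k W) [DirectSum.Decomposition 𝒲]

/-- Multiplication by `w ⊗ 1 + 1 ⊗ w`, for `w ∈ W` of parity `i`. -/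
noncomputable def comulMul (i : ZMod 2) (w : W) :
    GradedSym 𝒲 ⊗[k] GradedSym 𝒲 →ₗ[k] GradedSym 𝒲 ⊗[k] GradedSym 𝒲 :=
  TensorProduct.map (LinearMap.mulLeft k (ι 𝒲 w)) LinearMap.id +
    TensorProduct.map (koszul (parity 𝒲) i) (LinearMap.mulLeft k (ι 𝒲 w))

theorem comulMul_tmul (i : ZMod 2) (w : W) (y z : GradedSym 𝒲) :
    comulMul 𝒲 i w (y ⊗ₜ z) = (ι 𝒲 w * y) ⊗ₜ z + koszul (parity 𝒲) i y ⊗ₜ (ι 𝒲 w * z) := by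
  simp [comulMul]

theorem comul_one : comul 𝒲 1 = 1 ⊗ₜ 1 := by
  simp only [comul, LinearMap.comp_apply, AlgHom.toLinearMap_apply, map_one]
  rfl

/-- `comulAlg` is multiplicative for the graded product, and multiplying `y ⊗ z` by `1 ⊗ w` moves
`w` past `y`. This sign is the `koszul` in `comulMul`; from here on only the ordinary tensor product
is needed. -/
theorem comul_ι_mul {i : ZMod 2} {w : W} (hw : w ∈ 𝒲 i) (x : GradedSym 𝒲) :
    comul 𝒲 (ι 𝒲 w * x) = comulMul 𝒲 i w (comul 𝒲 x) := by
  suffices h : (GradedTensorProduct.of k (parity 𝒲) (parity 𝒲)).symm.toLinearMap ∘ₗ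
      LinearMap.mulLeft k (comulAlg 𝒲 (ι 𝒲 w)) ∘ₗ
        (GradedTensorProduct.of k (parity 𝒲) (parity 𝒲)).toLinearMap = comulMul 𝒲 i w by
    have := LinearMap.congr_fun h (comul 𝒲 x)
    rw [← this]
    simp [comul]
  apply tensor_hom_ext_homogeneous (parity 𝒲)
  intro j y hy z
  have h1 := GradedTensorProduct.tmul_one_mul_coe_tmul (R := k) (parity 𝒲) (parity 𝒲)
    (ι 𝒲 w) ⟨y, hy⟩ z
  have h2 := GradedTensorProduct.tmul_coe_mul_coe_tmul (R := k) (parity 𝒲) (parity 𝒲) 1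
    ⟨ι 𝒲 w, ι_mem_parity 𝒲 hw⟩ ⟨y, hy⟩ z
  simp only [one_mul] at h1 h2
  simp only [LinearMap.comp_apply, LinearMap.mulLeft_apply, comulAlg_ι, add_mul, LinearEquiv.coe_coe]
  rw [comulMul_tmul, koszul_of_mem (parity 𝒲) i hy, sign_smul_tmul]
  erw [h1, h2]
  rw [map_add, mul_comm j i]
  congr 1

theorem hasParity_ι : HasParity 𝒲 (parity 𝒲) 0 (ι 𝒲) := by
  intro i w hw
  rw [add_zero]; exact ι_mem_parity 𝒲 hw

theorem hasParity_mulLeft_ι {i : ZMod 2} {w : W} (hw : w ∈ 𝒲 i) :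
    HasParity (parity 𝒲) (parity 𝒲) i (LinearMap.mulLeft k (ι 𝒲 w)) := by
  intro j x hx
  rw [add_comm]
  exact SetLike.GradedMul.mul_mem (ι_mem_parity 𝒲 hw) hx

theorem koszul_ι_mul {i : ZMod 2} {w : W} (hw : w ∈ 𝒲 i) (q : ZMod 2) (x : GradedSym 𝒲) :
    koszul (parity 𝒲) q (ι 𝒲 w * x) = (-1 : ℤˣ) ^ (q * i) • (ι 𝒲 w * koszul (parity 𝒲) q x) :=
  (hasParity_mulLeft_ι 𝒲 hw).koszul_comm q x

theorem koszul_one (q : ZMod 2) : koszul (parity 𝒲) q 1 = 1 := by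
  rw [koszul_of_mem (parity 𝒲) q (SetLike.GradedOne.one_mem : (1 : GradedSym 𝒲) ∈ parity 𝒲 0)]
  simp

theorem counit_koszul (q : ZMod 2) (x : GradedSym 𝒲) :
    counit 𝒲 (koszul (parity 𝒲) q x) = counit 𝒲 x := by
  suffices h : counit 𝒲 ∘ₗ koszul (parity 𝒲) q = counit 𝒲 from LinearMap.congr_fun h x
  apply hom_ext_mul_ι 𝒲
  · simp [koszul_one]
  · intro i w hw y _
    rw [LinearMap.comp_apply, koszul_ι_mul 𝒲 hw, map_sign_smul, counit_ι_mul, counit_ι_mul, smul_zero]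

/-- Moving `w` to the front collects one sign for each factor of `x`; together they make up
`koszul`. -/
theorem mul_ι_comm {i : ZMod 2} {w : W} (hw : w ∈ 𝒲 i) (x : GradedSym 𝒲) :
    x * ι 𝒲 w = ι 𝒲 w * koszul (parity 𝒲) i x := by
  suffices h : LinearMap.mulRight k (ι 𝒲 w) = LinearMap.mulLeft k (ι 𝒲 w) ∘ₗ koszul (parity 𝒲) i from
    LinearMap.congr_fun h x
  apply hom_ext_mul_ι 𝒲
  · simp [koszul_one]
  · intro j u hu y hy
    simp only [LinearMap.mulRight_apply, LinearMap.comp_apply, LinearMap.mulLeft_apply] at hy ⊢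
    rw [koszul_ι_mul 𝒲 hu, mul_assoc, hy, ← mul_assoc, ι_mul_ι hu hw, mul_sign_smul, sign_smul_mul,
      mul_assoc, mul_comm i j]

theorem toBase_koszul (q : ZMod 2) (x : GradedSym 𝒲) :
    koszul 𝒲 q (toBase 𝒲 x) = toBase 𝒲 (koszul (parity 𝒲) q x) := by
  suffices h : koszul 𝒲 q ∘ₗ toBase 𝒲 = toBase 𝒲 ∘ₗ koszul (parity 𝒲) q from
    LinearMap.congr_fun h x
  apply hom_ext_mul_ι 𝒲
  · simp [koszul_one, toBase_one]
  · intro j u hu y _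
    simp only [LinearMap.comp_apply]
    rw [koszul_ι_mul 𝒲 hu, map_sign_smul, toBase_ι_mul, toBase_ι_mul, counit_koszul, map_smul,
      koszul_of_mem 𝒲 q hu, smul_comm, mul_comm]

theorem hasParity_toBase : HasParity (parity 𝒲) 𝒲 0 (toBase 𝒲) := by
  intro i x hx
  apply mem_of_koszul_one
  rw [toBase_koszul, koszul_of_mem (parity 𝒲) 1 hx, map_sign_smul]
  simp

/-! ### Bilinear maps evaluated on the comultiplication -/

section Conv

variable {N : Type*} [AddCommGroup N] [Module k N]

/-- `x ↦ ∑ B(x', x'')`, where `Δ x = ∑ x' ⊗ x''`. -/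
noncomputable def conv (B : GradedSym 𝒲 →ₗ[k] GradedSym 𝒲 →ₗ[k] N) : GradedSym 𝒲 →ₗ[k] N :=
  TensorProduct.lift B ∘ₗ comul 𝒲

theorem conv_one (B : GradedSym 𝒲 →ₗ[k] GradedSym 𝒲 →ₗ[k] N) : conv 𝒲 B 1 = B 1 1 := by
  simp [conv, comul_one]

theorem conv_add (B B' : GradedSym 𝒲 →ₗ[k] GradedSym 𝒲 →ₗ[k] N) (x : GradedSym 𝒲) :
    conv 𝒲 (B + B') x = conv 𝒲 B x + conv 𝒲 B' x := by
  suffices h : TensorProduct.lift (B + B') = TensorProduct.lift B + TensorProduct.lift B' by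
    simp [conv, h]
  ext; simp

theorem conv_compr₂ {P : Type*} [AddCommGroup P] [Module k P]
    (B : GradedSym 𝒲 →ₗ[k] GradedSym 𝒲 →ₗ[k] N) (g : N →ₗ[k] P) (x : GradedSym 𝒲) :
    conv 𝒲 (B.compr₂ g) x = g (conv 𝒲 B x) := by
  suffices h : TensorProduct.lift (B.compr₂ g) = g ∘ₗ TensorProduct.lift B by
    simp [conv, h]
  ext; simp

theorem conv_ext {B B' : GradedSym 𝒲 →ₗ[k] GradedSym 𝒲 →ₗ[k] N}
    (h : ∀ i, ∀ y ∈ parity 𝒲 i, ∀ z, B y z = B' y z) (x : GradedSym 𝒲) :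
    conv 𝒲 B x = conv 𝒲 B' x := by
  have : B = B' := hom_ext_homogeneous (parity 𝒲) fun i y hy => LinearMap.ext (h i y hy)
  rw [this]

/-- The basic recursion: the new letter `w` goes either to the left factor of `Δ x` or, past that
factor, to the right one. All later expansions of `Δ` iterate it. -/
theorem conv_ι_mul (B : GradedSym 𝒲 →ₗ[k] GradedSym 𝒲 →ₗ[k] N) {i : ZMod 2} {w : W} (hw : w ∈ 𝒲 i)
    (x : GradedSym 𝒲) :
    conv 𝒲 B (ι 𝒲 w * x) = conv 𝒲 (B ∘ₗ LinearMap.mulLeft k (ι 𝒲 w)) x +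
      conv 𝒲 (B.compl₁₂ (koszul (parity 𝒲) i) (LinearMap.mulLeft k (ι 𝒲 w))) x := by
  rw [← conv_add]
  suffices h : TensorProduct.lift B ∘ₗ comulMul 𝒲 i w = TensorProduct.lift
      (B ∘ₗ LinearMap.mulLeft k (ι 𝒲 w) +
        B.compl₁₂ (koszul (parity 𝒲) i) (LinearMap.mulLeft k (ι 𝒲 w))) by
    rw [conv, conv, ← h, LinearMap.comp_apply, comul_ι_mul 𝒲 hw]; rfl
  ext y z
  simp [comulMul_tmul]

theorem conv_zero (x : GradedSym 𝒲) :
    conv 𝒲 (0 : GradedSym 𝒲 →ₗ[k] GradedSym 𝒲 →ₗ[k] N) x = 0 := by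
  have : TensorProduct.lift (0 : GradedSym 𝒲 →ₗ[k] GradedSym 𝒲 →ₗ[k] N) = 0 := by ext; simp
  simp [conv, this]

theorem conv_counit_left (f : GradedSym 𝒲 →ₗ[k] N) (x : GradedSym 𝒲) :
    conv 𝒲 ((counit 𝒲).smulRight f) x = f x := by
  -- The counit axiom itself is the case of the identity map; a general `f` is then composed with
  -- it.
  have h : conv 𝒲 ((counit 𝒲).smulRight LinearMap.id) x = x := by
    suffices h : conv 𝒲 ((counit 𝒲).smulRight LinearMap.id) = LinearMap.id from
      LinearMap.congr_fun h x
    apply hom_ext_mul_ι 𝒲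
    · simp [conv_one, counit_one]
    · intro i w hw y hy
      rw [conv_ι_mul 𝒲 _ hw, conv_ext 𝒲 (B' := 0), conv_zero, zero_add,
        conv_ext 𝒲 (B' := ((counit 𝒲).smulRight LinearMap.id).compr₂ (LinearMap.mulLeft k (ι 𝒲 w))),
        conv_compr₂, hy]
      · simp
      · intros; simp [counit_koszul]
      · intros; simp [counit_ι_mul]
  conv_rhs => rw [← h, ← conv_compr₂]
  apply conv_ext; intros; simp

theorem conv_counit_right (f : GradedSym 𝒲 →ₗ[k] N) (x : GradedSym 𝒲) :
    conv 𝒲 ((counit 𝒲).smulRight f).flip x = f x := by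
  have h : conv 𝒲 ((counit 𝒲).smulRight LinearMap.id).flip x = x := by
    suffices h : conv 𝒲 ((counit 𝒲).smulRight LinearMap.id).flip = LinearMap.id from
      LinearMap.congr_fun h x
    apply hom_ext_mul_ι 𝒲
    · simp [conv_one, counit_one]
    · intro i w hw y hy
      rw [conv_ι_mul 𝒲 _ hw, add_comm, conv_ext 𝒲 (B' := 0), conv_zero, zero_add,
        conv_ext 𝒲
          (B' := ((counit 𝒲).smulRight LinearMap.id).flip.compr₂ (LinearMap.mulLeft k (ι 𝒲 w))),
        conv_compr₂, hy]
      · simp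
      · intros; simp
      · intros; simp [counit_ι_mul]
  conv_rhs => rw [← h, ← conv_compr₂]
  apply conv_ext; intros; simp

end Conv

end GradedSym
namespace GradedSym

variable {k W : Type*} [Field k] [CharZero k] [AddCommGroup W] [Module k W]
variable (𝒲 : ZMod 2 → Submodule k W) [DirectSum.Decomposition 𝒲]

/-! ### The coderivation with given corestriction -/

/-- The coderivation `x ↦ ∑ f(x') x''` of the symmetric coalgebra determined by `f`. -/
noncomputable def coder (f : GradedSym 𝒲 →ₗ[k] W) : GradedSym 𝒲 →ₗ[k] GradedSym 𝒲 :=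
  conv 𝒲 (LinearMap.mul k (GradedSym 𝒲) ∘ₗ ι 𝒲 ∘ₗ f)

theorem coder_one (f : GradedSym 𝒲 →ₗ[k] W) : coder 𝒲 f 1 = ι 𝒲 (f 1) := by
  simp [coder, conv_one]

theorem coder_counit (u : W) (x : GradedSym 𝒲) :
    coder 𝒲 ((counit 𝒲).smulRight u) x = ι 𝒲 u * x := by
  have := conv_counit_left 𝒲 (LinearMap.mulLeft k (ι 𝒲 u)) x
  rw [LinearMap.mulLeft_apply] at this
  rw [← this, coder]
  apply conv_ext
  intros
  simp

/-- A Leibniz rule with a correction term. If `w` falls in the left factor it is absorbed into `f`;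
otherwise it moves in front of `f(x')`, of parity `|x'| + q`. The part `(-1)^{i|x'|}` of that sign
cancels the one already present in `Δ`, which leaves `(-1)^{iq}`. -/
theorem coder_ι_mul {q : ZMod 2} {f : GradedSym 𝒲 →ₗ[k] W} (hf : HasParity (parity 𝒲) 𝒲 q f)
    {i : ZMod 2} {w : W} (hw : w ∈ 𝒲 i) (x : GradedSym 𝒲) :
    coder 𝒲 f (ι 𝒲 w * x) = coder 𝒲 (f ∘ₗ LinearMap.mulLeft k (ι 𝒲 w)) x +
      (-1 : ℤˣ) ^ (i * q) • (ι 𝒲 w * coder 𝒲 f x) := by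
  rw [coder, conv_ι_mul 𝒲 _ hw]
  congr 1
  have := conv_compr₂ 𝒲 (LinearMap.mul k (GradedSym 𝒲) ∘ₗ ι 𝒲 ∘ₗ f)
    ((-1 : ℤˣ) ^ (i * q) • LinearMap.mulLeft k (ι 𝒲 w)) x
  rw [LinearMap.smul_apply, LinearMap.mulLeft_apply] at this
  rw [← this]
  apply conv_ext
  intro j y _ z
  have h1 : ι 𝒲 (f (koszul (parity 𝒲) i y)) * ι 𝒲 w =
      (-1 : ℤˣ) ^ (i * q) • (ι 𝒲 w * ι 𝒲 (f y)) := by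
    rw [mul_ι_comm 𝒲 hw, (hasParity_ι 𝒲).koszul_comm]
    rw [hf.koszul_comm, koszul_koszul, CharTwo.add_self_eq_zero, koszul_zero]
    simp [mul_sign_smul]
  simp only [LinearMap.compl₁₂_apply, LinearMap.comp_apply, LinearMap.mulLeft_apply,
    LinearMap.mul_apply', LinearMap.compr₂_apply, LinearMap.smul_apply]
  rw [← mul_assoc, h1, sign_smul_mul, mul_assoc]

theorem HasParity.comp_mulLeft_ι {q : ZMod 2} {f : GradedSym 𝒲 →ₗ[k] W}
    (hf : HasParity (parity 𝒲) 𝒲 q f) {i : ZMod 2} {w : W} (hw : w ∈ 𝒲 i) :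
    HasParity (parity 𝒲) 𝒲 (q + i) (f ∘ₗ LinearMap.mulLeft k (ι 𝒲 w)) := by
  intro j x hx
  have := hf _ _ (hasParity_mulLeft_ι 𝒲 hw j x hx)
  rwa [add_assoc, add_comm i q] at this

/-- The recursion `coder_ι_mul` replaces `f` by `f ∘ (w · )`, whose parity is different. An
induction on `x` must therefore carry all parities `q` and all `f` at once; the intersection of the
corresponding equalizers is the submodule used. -/
theorem hom_ext_of_parity {N : Type*} [AddCommGroup N] [Module k N]
    (L R : ZMod 2 → (GradedSym 𝒲 →ₗ[k] W) → GradedSym 𝒲 →ₗ[k] N)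
    (h1 : ∀ q f, HasParity (parity 𝒲) 𝒲 q f → L q f 1 = R q f 1)
    (hι : ∀ i, ∀ w ∈ 𝒲 i, ∀ x, (∀ q f, HasParity (parity 𝒲) 𝒲 q f → L q f x = R q f x) →
      ∀ q f, HasParity (parity 𝒲) 𝒲 q f → L q f (ι 𝒲 w * x) = R q f (ι 𝒲 w * x))
    {q : ZMod 2} {f : GradedSym 𝒲 →ₗ[k] W} (hf : HasParity (parity 𝒲) 𝒲 q f) (x : GradedSym 𝒲) :
    L q f x = R q f x := by
  have := mul_ι_induction 𝒲 (⨅ (q) (f) (_ : HasParity (parity 𝒲) 𝒲 q f),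
    LinearMap.eqLocus (L q f) (R q f)) (by simpa using h1) (by simpa using hι) x
  simp only [Submodule.mem_iInf] at this
  exact this q f hf

theorem hasParity_coder {q : ZMod 2} {f : GradedSym 𝒲 →ₗ[k] W} (hf : HasParity (parity 𝒲) 𝒲 q f) :
    HasParity (parity 𝒲) (parity 𝒲) q (coder 𝒲 f) := by
  have key := hom_ext_of_parity 𝒲 (fun _ f => koszul (parity 𝒲) 1 ∘ₗ coder 𝒲 f)
    (fun q f => (-1 : ℤˣ) ^ q • coder 𝒲 f ∘ₗ koszul (parity 𝒲) 1) (by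
      intro q f hf
      simp only [LinearMap.comp_apply, LinearMap.smul_apply, coder_one, koszul_one]
      have h1 := hf 0 1 SetLike.GradedOne.one_mem
      rw [zero_add] at h1
      rw [koszul_of_mem (parity 𝒲) 1 (ι_mem_parity 𝒲 h1), mul_one]) (by
      intro i w hw x ih q f hf
      have h1 := ih q f hf
      have h2 := ih _ _ (HasParity.comp_mulLeft_ι 𝒲 hf hw)
      simp only [LinearMap.comp_apply, LinearMap.smul_apply] at h1 h2 ⊢
      rw [coder_ι_mul 𝒲 hf hw, map_add, map_sign_smul, koszul_ι_mul 𝒲 hw, h1, h2,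
        koszul_ι_mul 𝒲 hw, map_sign_smul, coder_ι_mul 𝒲 hf hw]
      simp only [smul_add, smul_smul, mul_sign_smul, ← uzpow_add]
      congr 2 <;> congr 1 <;> ring) hf
  intro i x hx
  apply mem_of_koszul_one
  have := key x
  simp only [LinearMap.comp_apply, LinearMap.smul_apply] at this
  rw [this, koszul_of_mem (parity 𝒲) 1 hx, map_sign_smul, smul_smul, ← uzpow_add, mul_one, add_comm]

theorem comul_coder {q : ZMod 2} {f : GradedSym 𝒲 →ₗ[k] W} (hf : HasParity (parity 𝒲) 𝒲 q f) :
    comul 𝒲 ∘ₗ coder 𝒲 f =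
      (TensorProduct.map (coder 𝒲 f) LinearMap.id +
        TensorProduct.map (koszul (parity 𝒲) q) (coder 𝒲 f)) ∘ₗ comul 𝒲 := by
  ext x
  refine hom_ext_of_parity 𝒲 (fun _ f => comul 𝒲 ∘ₗ coder 𝒲 f) (fun q f =>
    (TensorProduct.map (coder 𝒲 f) LinearMap.id +
        TensorProduct.map (koszul (parity 𝒲) q) (coder 𝒲 f)) ∘ₗ comul 𝒲) ?_ ?_ hf x
  · intro q f hf
    have h1 := hf 0 1 SetLike.GradedOne.one_mem
    have := comul_ι_mul 𝒲 h1 1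
    rw [mul_one, comul_one, comulMul_tmul, koszul_one, mul_one] at this
    simp [coder_one, comul_one, koszul_one, this]
  · intro i w hw x ih q f hf
    have h1 := ih q f hf
    have h2 := ih _ _ (HasParity.comp_mulLeft_ι 𝒲 hf hw)
    simp only [LinearMap.comp_apply] at h1 h2 ⊢
    rw [coder_ι_mul 𝒲 hf hw, map_add, map_sign_smul, comul_ι_mul 𝒲 hw, h1, h2, comul_ι_mul 𝒲 hw]
    -- After the induction hypotheses both sides are operators applied to `Δ x`. The operators
    -- already agree on the whole tensor product, so only signs on homogeneous tensors remain to be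
    -- compared.
    suffices h : (TensorProduct.map (coder 𝒲 (f ∘ₗ LinearMap.mulLeft k (ι 𝒲 w))) LinearMap.id +
          TensorProduct.map (koszul (parity 𝒲) (q + i)) (coder 𝒲 (f ∘ₗ LinearMap.mulLeft k (ι 𝒲 w)))) +
        (-1 : ℤˣ) ^ (i * q) • (comulMul 𝒲 i w ∘ₗ (TensorProduct.map (coder 𝒲 f) LinearMap.id +
          TensorProduct.map (koszul (parity 𝒲) q) (coder 𝒲 f))) =
        (TensorProduct.map (coder 𝒲 f) LinearMap.id +
          TensorProduct.map (koszul (parity 𝒲) q) (coder 𝒲 f)) ∘ₗ comulMul 𝒲 i w from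
      LinearMap.congr_fun h (comul 𝒲 x)
    apply tensor_hom_ext_homogeneous (parity 𝒲)
    intro j y hy z
    have hy' := hasParity_coder 𝒲 hf j y hy
    simp only [LinearMap.add_apply, LinearMap.smul_apply, LinearMap.comp_apply, TensorProduct.map_tmul,
      LinearMap.id_apply, map_add, comulMul_tmul, koszul_of_mem (parity 𝒲) _ hy,
      koszul_of_mem (parity 𝒲) _ hy', coder_ι_mul 𝒲 hf hw, map_sign_smul, koszul_ι_mul 𝒲 hw,
      sign_smul_tmul, tmul_sign_smul, TensorProduct.add_tmul, TensorProduct.tmul_add, smul_add,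
      smul_smul, mul_sign_smul, ← uzpow_add]
    have e1 : i * q + (j + q) * i = j * i := by
      linear_combination CharTwo.add_self_eq_zero (i * q)
    have e2 : j * (q + i) = j * i + j * q := by ring
    have e3 : i * q + (j * q + j * i) = j * i + (j * q + i * q) := by ring
    simp only [e1, e2, e3, mul_comm q i, add_comm (i * q) (j * q)]
    abel

/-- The component of `f(x') x''` in `W` is `ε(x'') f(x')`, so the counit axiom on the right gives
the claim. -/
theorem toBase_coder (f : GradedSym 𝒲 →ₗ[k] W) (x : GradedSym 𝒲) : toBase 𝒲 (coder 𝒲 f x) = f x := by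
  rw [coder, ← conv_compr₂, ← conv_counit_right 𝒲 f x]
  apply conv_ext
  intros
  simp [toBase_ι_mul]

theorem isCoderivation_coder {q : ZMod 2} {f : GradedSym 𝒲 →ₗ[k] W}
    (hf : HasParity (parity 𝒲) 𝒲 q f) (h1 : f 1 = 0) : IsCoderivation 𝒲 q (coder 𝒲 f) where
  map_parity := hasParity_coder 𝒲 hf
  map_one := by rw [coder_one, h1, map_zero]
  comul_comp := comul_coder 𝒲 hf

end GradedSym
namespace GradedSym

variable {k W : Type*} [Field k] [CharZero k] [AddCommGroup W] [Module k W]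
variable (𝒲 : ZMod 2 → Submodule k W) [DirectSum.Decomposition 𝒲]

/-! ### Degrees and the Euler derivation -/

/-- The component of degree `n` of the graded symmetric algebra. -/
noncomputable def degree (n : ℕ) : Submodule k (GradedSym 𝒲) := LinearMap.range (ι 𝒲) ^ n

theorem mem_degree_zero {x : GradedSym 𝒲} : x ∈ degree 𝒲 0 ↔ ∃ c : k, x = c • 1 := by
  rw [degree, pow_zero, Submodule.mem_one]
  simp only [Algebra.algebraMap_eq_smul_one, eq_comm]

theorem ι_mul_mem_degree (w : W) {n : ℕ} {x : GradedSym 𝒲} (hx : x ∈ degree 𝒲 n) :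
    ι 𝒲 w * x ∈ degree 𝒲 (n + 1) := by
  rw [degree, pow_succ']
  exact Submodule.mul_mem_mul ⟨w, rfl⟩ hx

theorem degree_succ_induction {n : ℕ} (Q : Submodule k (GradedSym 𝒲))
    (h : ∀ i, ∀ w ∈ 𝒲 i, ∀ x ∈ degree 𝒲 n, ι 𝒲 w * x ∈ Q) {x : GradedSym 𝒲}
    (hx : x ∈ degree 𝒲 (n + 1)) : x ∈ Q := by
  rw [degree, pow_succ'] at hx
  induction hx using Submodule.mul_induction_on' with
  | mem_mul_mem a ha b hb =>
    obtain ⟨w, rfl⟩ := ha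
    rw [← sum_proj 𝒲 w, map_sum, Finset.sum_mul]
    exact sum_mem fun i _ => h i _ (proj_mem 𝒲 i w) b hb
  | add a _ b _ ha hb => exact add_mem ha hb

theorem mem_iSup_degree (x : GradedSym 𝒲) : x ∈ ⨆ n, degree 𝒲 n := by
  apply mul_ι_induction
  · exact Submodule.mem_iSup_of_mem 0 ((mem_degree_zero 𝒲).mpr ⟨1, (one_smul _ _).symm⟩)
  · intro i w _ x hx
    induction hx using Submodule.iSup_induction' with
    | mem n y hy => exact Submodule.mem_iSup_of_mem (n + 1) (ι_mul_mem_degree 𝒲 w hy)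
    | zero => simp
    | add y z _ _ hy hz => rw [mul_add]; exact add_mem hy hz

theorem hom_ext_degree {N : Type*} [AddCommGroup N] [Module k N] {f g : GradedSym 𝒲 →ₗ[k] N}
    (h : ∀ n, ∀ x ∈ degree 𝒲 n, f x = g x) : f = g := by
  ext x
  have : ⨆ n, degree 𝒲 n ≤ LinearMap.eqLocus f g := iSup_le h
  exact this (mem_iSup_degree 𝒲 x)

theorem counit_of_mem_degree_succ {n : ℕ} {x : GradedSym 𝒲} (hx : x ∈ degree 𝒲 (n + 1)) :
    counit 𝒲 x = 0 := by
  refine degree_succ_induction 𝒲 (LinearMap.ker (counit 𝒲)) (fun i w _ x _ => ?_) hx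
  exact counit_ι_mul 𝒲 w x

theorem toBase_of_mem_degree {n : ℕ} (hn : n ≠ 1) {x : GradedSym 𝒲} (hx : x ∈ degree 𝒲 n) :
    toBase 𝒲 x = 0 := by
  match n with
  | 0 =>
    obtain ⟨c, rfl⟩ := (mem_degree_zero 𝒲).mp hx
    rw [map_smul, toBase_one, smul_zero]
  | n + 2 =>
    refine degree_succ_induction 𝒲 (LinearMap.ker (toBase 𝒲)) (fun i w _ x hx => ?_) hx
    rw [LinearMap.mem_ker, toBase_ι_mul, counit_of_mem_degree_succ 𝒲 hx, zero_smul]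

theorem ι_toBase_of_mem_degree_one {x : GradedSym 𝒲} (hx : x ∈ degree 𝒲 1) :
    ι 𝒲 (toBase 𝒲 x) = x := by
  rw [degree, pow_one] at hx
  obtain ⟨w, rfl⟩ := hx
  rw [toBase_ι]

/-- In the Leibniz rule for `w x` the correction term is `w x` itself, because `toBase (w y) = ε(y)
w`. Each letter thus raises the eigenvalue by one. -/
theorem coder_toBase_of_mem_degree {n : ℕ} {x : GradedSym 𝒲} (hx : x ∈ degree 𝒲 n) :
    coder 𝒲 (toBase 𝒲) x = (n : k) • x := by
  induction n generalizing x with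
  | zero =>
    obtain ⟨c, rfl⟩ := (mem_degree_zero 𝒲).mp hx
    simp [coder_one, toBase_one]
  | succ n ih =>
    refine degree_succ_induction 𝒲 (LinearMap.eqLocus (coder 𝒲 (toBase 𝒲))
      (((n + 1 : ℕ) : k) • LinearMap.id)) (fun i w hw x hx => ?_) hx
    have h : toBase 𝒲 ∘ₗ LinearMap.mulLeft k (ι 𝒲 w) = (counit 𝒲).smulRight w := by
      ext y; simp [toBase_ι_mul]
    simp only [LinearMap.mem_eqLocus, LinearMap.smul_apply, LinearMap.id_apply]
    rw [coder_ι_mul 𝒲 (hasParity_toBase 𝒲) hw, h, coder_counit, ih hx]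
    simp only [mul_zero, uzpow_zero, one_smul, mul_smul_comm, Nat.cast_add, Nat.cast_one, add_smul]
    exact add_comm _ _

/-- Degree `n + 1` lies in the eigenspace of the Euler derivation for `n + 1`, which is nonzero in
characteristic zero. Since eigenspaces are independent, the kernel consists of scalars, and the
counit detects those. Directness of the sum of the degrees is not needed separately. -/
theorem eq_zero_of_coder_toBase {y : GradedSym 𝒲} (hy : coder 𝒲 (toBase 𝒲) y = 0)
    (h1 : counit 𝒲 y = 0) : y = 0 := by
  set E : Module.End k (GradedSym 𝒲) := coder 𝒲 (toBase 𝒲)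
  have hdec : ∀ x ∈ ⨆ n, degree 𝒲 n, ∃ (c : k) (r : GradedSym 𝒲),
      r ∈ (⨆ μ, ⨆ _ : μ ≠ (0 : k), E.eigenspace μ) ∧ x = c • 1 + r := by
    intro x hx
    induction hx using Submodule.iSup_induction' with
    | mem n x hx =>
      match n with
      | 0 =>
        obtain ⟨c, rfl⟩ := (mem_degree_zero 𝒲).mp hx
        exact ⟨c, 0, zero_mem _, (add_zero _).symm⟩
      | n + 1 =>
        refine ⟨0, x, ?_, by simp⟩
        refine Submodule.mem_iSup_of_mem ((n + 1 : ℕ) : k) (Submodule.mem_iSup_of_mem ?_ ?_)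
        · exact_mod_cast n.succ_ne_zero
        · exact Module.End.mem_eigenspace_iff.mpr (coder_toBase_of_mem_degree 𝒲 hx)
    | zero => exact ⟨0, 0, zero_mem _, by simp⟩
    | add x z _ _ hx hz =>
      obtain ⟨c, r, hr, rfl⟩ := hx
      obtain ⟨c', r', hr', rfl⟩ := hz
      exact ⟨c + c', r + r', add_mem hr hr', by rw [add_smul]; abel⟩
  obtain ⟨c, r, hr, rfl⟩ := hdec y (mem_iSup_degree 𝒲 y)
  have hE1 : E 1 = 0 := by simp [E, coder_one, toBase_one]
  have hr0 : r ∈ E.eigenspace 0 := by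
    rw [Module.End.mem_eigenspace_iff, zero_smul]
    simpa [hE1] using hy
  have : r = 0 := by
    have := (Module.End.eigenspaces_iSupIndep E) 0
    exact Submodule.disjoint_def.mp this r hr0 hr
  subst this
  rw [add_zero, map_smul, counit_one, smul_eq_mul, mul_one] at h1
  simp [h1]

/-- For `x` of degree `n + 1`, the terms of `Δ x` with left factor in `W` have right factor in
degree `n`. -/
theorem conv_toBase_eq_zero {N : Type*} [AddCommGroup N] [Module k N] {n : ℕ}
    (B : W →ₗ[k] GradedSym 𝒲 →ₗ[k] N) (hB : ∀ u, ∀ z ∈ degree 𝒲 n, B u z = 0)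
    {x : GradedSym 𝒲} (hx : x ∈ degree 𝒲 (n + 1)) : conv 𝒲 (B ∘ₗ toBase 𝒲) x = 0 := by
  induction n generalizing x B with
  | zero =>
    refine degree_succ_induction 𝒲 (LinearMap.ker (conv 𝒲 (B ∘ₗ toBase 𝒲))) (fun i w hw x hx => ?_) hx
    obtain ⟨c, rfl⟩ := (mem_degree_zero 𝒲).mp hx
    rw [LinearMap.mem_ker, conv_ι_mul 𝒲 _ hw, map_smul, map_smul, conv_one, conv_one]
    have := hB w 1 ((mem_degree_zero 𝒲).mpr ⟨1, (one_smul _ _).symm⟩)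
    simp [toBase_ι, this, koszul_one, toBase_one]
  | succ n ih =>
    refine degree_succ_induction 𝒲 (LinearMap.ker (conv 𝒲 (B ∘ₗ toBase 𝒲))) (fun i w hw x hx => ?_) hx
    rw [LinearMap.mem_ker, conv_ι_mul 𝒲 _ hw]
    rw [conv_ext 𝒲 (B' := (counit 𝒲).smulRight (B w)), conv_counit_left, hB w x hx, zero_add]
    · have := ih (B.compl₁₂ (koszul 𝒲 i) (LinearMap.mulLeft k (ι 𝒲 w))) (by
        intro u z hz
        exact hB _ _ (ι_mul_mem_degree 𝒲 w hz)) hx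
      rw [← this]
      apply conv_ext
      intro j y _ z
      simp [toBase_koszul]
    · intro j y _ z
      simp [toBase_ι_mul]

variable {𝒲}

theorem _root_.SuperLie.IsCoderivation.conv {q : ZMod 2} {δ : GradedSym 𝒲 →ₗ[k] GradedSym 𝒲}
    (hδ : IsCoderivation 𝒲 q δ) {N : Type*} [AddCommGroup N] [Module k N]
    (B : GradedSym 𝒲 →ₗ[k] GradedSym 𝒲 →ₗ[k] N) (x : GradedSym 𝒲) :
    conv 𝒲 B (δ x) = conv 𝒲 (B ∘ₗ δ) x + conv 𝒲 (B.compl₁₂ (koszul (parity 𝒲) q) δ) x := by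
  rw [← conv_add]
  have h := LinearMap.congr_fun hδ.comul_comp x
  simp only [LinearMap.comp_apply] at h
  rw [GradedSym.conv, GradedSym.conv, LinearMap.comp_apply, h]
  suffices h' : TensorProduct.lift B ∘ₗ (TensorProduct.map δ LinearMap.id +
      TensorProduct.map (koszul (parity 𝒲) q) δ) =
      TensorProduct.lift (B ∘ₗ δ + B.compl₁₂ (koszul (parity 𝒲) q) δ) from LinearMap.congr_fun h' _
  ext y z
  simp

/-- Applying `ε ⊗ ε` to the coderivation identity gives `ε(δ x) = 2 ε(δ x)`. -/
theorem _root_.SuperLie.IsCoderivation.counit_eq_zero {q : ZMod 2}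
    {δ : GradedSym 𝒲 →ₗ[k] GradedSym 𝒲} (hδ : IsCoderivation 𝒲 q δ) (x : GradedSym 𝒲) :
    counit 𝒲 (δ x) = 0 := by
  have h := hδ.conv ((counit 𝒲).smulRight (counit 𝒲)) x
  rw [conv_counit_left, conv_ext 𝒲 (B' := ((counit 𝒲).smulRight (counit 𝒲 ∘ₗ δ)).flip),
    conv_counit_right, conv_ext 𝒲 (B' := ((counit 𝒲).smulRight (counit 𝒲 ∘ₗ δ))),
    conv_counit_left] at h
  · simpa using h
  · intros; simp [counit_koszul]
  · intros; simp [mul_comm]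

/-- A coderivation is determined by its corestriction to `W`. -/
theorem _root_.SuperLie.IsCoderivation.eq_zero {q : ZMod 2} {δ : GradedSym 𝒲 →ₗ[k] GradedSym 𝒲}
    (hδ : IsCoderivation 𝒲 q δ) (h0 : ∀ x, toBase 𝒲 (δ x) = 0) : δ = 0 := by
  apply hom_ext_degree
  intro n
  induction n with
  | zero =>
    intro x hx
    obtain ⟨c, rfl⟩ := (mem_degree_zero 𝒲).mp hx
    rw [map_smul, hδ.map_one, smul_zero, LinearMap.zero_apply]
  | succ n ih =>
    intro x hx
    -- The Euler derivation of `δ x` has two kinds of terms. If `δ` hits the left factor, its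
    -- component in `W` is zero by `h0`. If `δ` hits the right factor, that factor has degree `n`
    -- and the induction hypothesis applies.
    apply eq_zero_of_coder_toBase 𝒲 _ (hδ.counit_eq_zero x)
    rw [coder, hδ.conv, conv_ext 𝒲 (B' := 0), conv_zero, zero_add]
    · rw [← conv_toBase_eq_zero 𝒲 ((LinearMap.mul k (GradedSym 𝒲)).compl₁₂ (ι 𝒲 ∘ₗ koszul 𝒲 q) δ)
        (fun u z hz => by simp [ih z hz]) hx]
      apply conv_ext
      intros
      simp [toBase_koszul]
    · intros; simp [h0]

end GradedSym

/-! ### Coderivations: recovery from the corestriction, and commutators -/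

section Coderivations

variable {k W : Type*} [Field k] [CharZero k] [AddCommGroup W] [Module k W]
variable {𝒲 : ZMod 2 → Submodule k W} [DirectSum.Decomposition 𝒲]

open GradedSym

theorem IsCoderivation.sub {q : ZMod 2} {δ δ' : GradedSym 𝒲 →ₗ[k] GradedSym 𝒲}
    (h : IsCoderivation 𝒲 q δ) (h' : IsCoderivation 𝒲 q δ') : IsCoderivation 𝒲 q (δ - δ') where
  map_parity i x hx := sub_mem (h.map_parity i x hx) (h'.map_parity i x hx)
  map_one := by rw [LinearMap.sub_apply, h.map_one, h'.map_one, sub_zero]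
  comul_comp := by
    rw [LinearMap.comp_sub, h.comul_comp, h'.comul_comp, ← LinearMap.sub_comp]
    congr 1
    ext y z
    simp [TensorProduct.sub_tmul, TensorProduct.tmul_sub]
    abel

theorem IsCoderivation.eq_of_toBase_eq {q : ZMod 2} {δ δ' : GradedSym 𝒲 →ₗ[k] GradedSym 𝒲}
    (h : IsCoderivation 𝒲 q δ) (h' : IsCoderivation 𝒲 q δ')
    (he : ∀ x, toBase 𝒲 (δ x) = toBase 𝒲 (δ' x)) : δ = δ' :=
  sub_eq_zero.mp ((h.sub h').eq_zero fun x => by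
    rw [LinearMap.sub_apply, map_sub, he, sub_self])

theorem IsCoderivation.eq_coder {q : ZMod 2} {δ : GradedSym 𝒲 →ₗ[k] GradedSym 𝒲}
    (h : IsCoderivation 𝒲 q δ) : δ = coder 𝒲 (toBase 𝒲 ∘ₗ δ) := by
  refine h.eq_of_toBase_eq (isCoderivation_coder 𝒲 (q := q) ?_ ?_) fun x =>
    (toBase_coder 𝒲 (toBase 𝒲 ∘ₗ δ) x).symm
  · intro i x hx
    have := hasParity_toBase 𝒲 _ _ (h.map_parity i x hx)
    rwa [add_zero] at this
  · rw [LinearMap.comp_apply, h.map_one, map_zero]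

/-- The mixed terms, in which `δ` and `D` act on different tensor factors, cancel because of the
sign in the graded commutator. -/
theorem IsCoderivation.commutator {q : ZMod 2} {δ D : GradedSym 𝒲 →ₗ[k] GradedSym 𝒲}
    (h : IsCoderivation 𝒲 q δ) (hD : IsCoderivation 𝒲 1 D) :
    IsCoderivation 𝒲 (q + 1) (δ ∘ₗ D - (-1 : ℤˣ) ^ q • (D ∘ₗ δ)) where
  map_parity i x hx := by
    apply sub_mem
    · have := h.map_parity _ _ (hD.map_parity i x hx)
      rwa [add_assoc, add_comm 1 q] at this
    · have := hD.map_parity _ _ (h.map_parity i x hx)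
      rw [add_assoc] at this
      exact sign_smul_mem _ _ this
  map_one := by simp [h.map_one, hD.map_one]
  comul_comp := by
    ext x
    have h1 := fun y => LinearMap.congr_fun h.comul_comp y
    have h2 := fun y => LinearMap.congr_fun hD.comul_comp y
    simp only [LinearMap.comp_apply] at h1 h2
    simp only [LinearMap.comp_apply, LinearMap.sub_apply, LinearMap.smul_apply, map_sub,
      map_sign_smul, h1, h2]
    suffices h : (TensorProduct.map δ LinearMap.id + TensorProduct.map (koszul (parity 𝒲) q) δ) ∘ₗ
        (TensorProduct.map D LinearMap.id + TensorProduct.map (koszul (parity 𝒲) 1) D) -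
        (-1 : ℤˣ) ^ q • ((TensorProduct.map D LinearMap.id +
          TensorProduct.map (koszul (parity 𝒲) 1) D) ∘ₗ
          (TensorProduct.map δ LinearMap.id + TensorProduct.map (koszul (parity 𝒲) q) δ)) =
        TensorProduct.map (δ ∘ₗ D - (-1 : ℤˣ) ^ q • (D ∘ₗ δ)) LinearMap.id +
          TensorProduct.map (koszul (parity 𝒲) (q + 1)) (δ ∘ₗ D - (-1 : ℤˣ) ^ q • (D ∘ₗ δ)) from
      LinearMap.congr_fun h (comul 𝒲 x)
    apply tensor_hom_ext_homogeneous (parity 𝒲)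
    intro j y hy z
    simp only [LinearMap.add_apply, LinearMap.sub_apply, LinearMap.smul_apply, LinearMap.comp_apply,
      TensorProduct.map_tmul, LinearMap.id_apply, map_add, koszul_of_mem (parity 𝒲) _ hy,
      koszul_of_mem (parity 𝒲) _ (h.map_parity j y hy),
      koszul_of_mem (parity 𝒲) _ (hD.map_parity j y hy), map_sign_smul,
      sign_smul_tmul, tmul_sign_smul, TensorProduct.sub_tmul, TensorProduct.tmul_sub, smul_add,
      smul_smul, ← uzpow_add, mul_one, mul_add, add_mul, one_mul]
    have e1 : q + (j + q) = j := by linear_combination CharTwo.add_self_eq_zero q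
    have e3 : j * q + j = j + j * q := by ring
    have e5 : j * q + q = q + j * q := by ring
    simp only [e1, e3, e5]
    abel

end Coderivations

/-! ### Infinitesimal deformations as coefficients of the parameter -/

section Deformations

variable {k V : Type*} [Field k] [CharZero k] [AddCommGroup V] [Module k V]
variable {𝒱 : ZMod 2 → Submodule k V} [DirectSum.Decomposition 𝒱]

open GradedSym

theorem LInfinityStructure.isCoderivation_coboundary (D : LInfinityStructure 𝒱) {q : ZMod 2}
    {δ : SymRev 𝒱 →ₗ[k] SymRev 𝒱} (h : IsCoderivation (parityRev 𝒱) q δ) :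
    IsCoderivation (parityRev 𝒱) (q + 1) (D.coboundary q δ) :=
  h.commutator D.isCoderivation

theorem LInfinityStructure.coboundary_coboundary (D : LInfinityStructure 𝒱) (q : ZMod 2)
    (δ : SymRev 𝒱 →ₗ[k] SymRev 𝒱) : D.coboundary (q + 1) (D.coboundary q δ) = 0 := by
  ext x
  have h : ∀ y, D.d (D.d y) = 0 := LinearMap.congr_fun D.sq_zero
  simp [coboundary, h, uzpow_add]

namespace InfDeformation

variable {D : LInfinityStructure 𝒱} {p : ZMod 2}

/-- The coderivation `δ` with `D_t = D + t δ`. -/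
noncomputable def increment (F : InfDeformation D p) : SymRev 𝒱 →ₗ[k] SymRev 𝒱 :=
  LinearMap.snd k _ _ ∘ₗ F.d ∘ₗ LinearMap.inl k _ _

/-- The deformed differential is odd, so moving it past `t` costs `(-1)^p`; as `t² = 0`, only `D`
acts on the coefficient of `t`. -/
theorem d_apply (F : InfDeformation D p) (x y : SymRev 𝒱) :
    F.d (x, y) = (D.d x, F.increment x + (-1 : ℤˣ) ^ p • D.d y) := by
  have h1 : F.d (x, 0) = (D.d x, F.increment x) := Prod.ext (F.reduces x) rfl
  have h2 := F.isTLinear.map_tMul (y, 0)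
  have h3 : tMul (k := k) (y, (0 : SymRev 𝒱)) = (0, y) := rfl
  have h4 : tMul (k := k) (F.d (y, 0)) = (0, D.d y) := Prod.ext rfl (F.reduces y)
  rw [h3, h4, mul_one] at h2
  have : ((x, y) : SymRev 𝒱 × SymRev 𝒱) = (x, 0) + (0, y) := by simp
  rw [this, map_add, h1, h2]
  simp [Prod.smul_mk]

theorem ext_increment {F F' : InfDeformation D p} (h : F.increment = F'.increment) : F = F' := by
  have : F.d = F'.d := by
    ext1 <;> ext1 x
    · simp only [LinearMap.comp_apply, LinearMap.inl_apply, d_apply, h]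
    · simp only [LinearMap.comp_apply, LinearMap.inr_apply, d_apply, h]
  cases F; cases F'; simp only at this; subst this; rfl

theorem tDerivation_tmul {M : Type*} [AddCommGroup M] [Module k M] (ℳ : ZMod 2 → Submodule k M)
    [DirectSum.Decomposition ℳ] (p q : ZMod 2) (F : M × M →ₗ[k] M × M) {A B : M →ₗ[k] M}
    (hF : ∀ x, F (x, 0) = (A x, B x)) (y z : M) :
    tDerivation p ℳ q F (y ⊗ₜ z) = (A y ⊗ₜ z + koszul ℳ q y ⊗ₜ A z,
      B y ⊗ₜ z + koszul ℳ (p + q) y ⊗ₜ B z) := by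
  simp [tDerivation, tTensor, hF, koszul_koszul]

/-- Pulling `t` out past the left factor adds `p` to the Koszul sign. The coefficient `B` of `t`
therefore acts as a derivation of parity `p + q`. -/
theorem tDerivation_apply {M : Type*} [AddCommGroup M] [Module k M] (ℳ : ZMod 2 → Submodule k M)
    [DirectSum.Decomposition ℳ] (p q : ZMod 2) (F : M × M →ₗ[k] M × M) {A B : M →ₗ[k] M}
    (hF : ∀ x, F (x, 0) = (A x, B x)) (t : M ⊗[k] M) :
    tDerivation p ℳ q F t =
      ((TensorProduct.map A LinearMap.id + TensorProduct.map (koszul ℳ q) A :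
          M ⊗[k] M →ₗ[k] M ⊗[k] M) t,
        (TensorProduct.map B LinearMap.id + TensorProduct.map (koszul ℳ (p + q)) B :
          M ⊗[k] M →ₗ[k] M ⊗[k] M) t) := by
  suffices h : tDerivation p ℳ q F =
      (TensorProduct.map A LinearMap.id + TensorProduct.map (koszul ℳ q) A).prod
        (TensorProduct.map B LinearMap.id + TensorProduct.map (koszul ℳ (p + q)) B) from
    LinearMap.congr_fun h t
  apply TensorProduct.ext'
  intro y z
  rw [tDerivation_tmul ℳ p q F hF]
  simp

/-- In `(1 + t B) ⊗ (1 + t B)` the quadratic term vanishes. Compatibility of `1 + t B` with `Δ` is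
thus the coderivation identity for `B`. -/
theorem tSquare_apply {M : Type*} [AddCommGroup M] [Module k M] (ℳ : ZMod 2 → Submodule k M)
    [DirectSum.Decomposition ℳ] (p : ZMod 2) (F : M × M →ₗ[k] M × M) {B : M →ₗ[k] M}
    (hF : ∀ x, F (x, 0) = (x, B x)) (t : M ⊗[k] M) :
    tSquare p ℳ F t =
      (t, (TensorProduct.map B LinearMap.id + TensorProduct.map (koszul ℳ p) B :
        M ⊗[k] M →ₗ[k] M ⊗[k] M) t) := by
  suffices h : tSquare p ℳ F = LinearMap.id.prod
        (TensorProduct.map B LinearMap.id + TensorProduct.map (koszul ℳ p) B) from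
    LinearMap.congr_fun h t
  apply TensorProduct.ext'
  intro y z
  simp [tSquare, tTensor, hF]

theorem isCoderivation_increment (F : InfDeformation D p) :
    IsCoderivation (parityRev 𝒱) (p + 1) F.increment where
  map_parity i x hx := by
    have := F.isTLinear.map_parity i (x, 0) ⟨hx, zero_mem _⟩
    rw [add_comm p 1, ← add_assoc]
    exact this.2
  map_one := congrArg Prod.snd F.map_one
  comul_comp := by
    ext x
    have h := F.comul_comp x
    rw [tDerivation_apply _ p 1 F.d (A := D.d) (B := F.increment) (fun x => by simp [d_apply])] at h
    exact congrArg Prod.snd h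

/-- The coefficient of `t` in the square of the deformed differential is `δ D + (-1)^p D δ`, the
graded commutator for `δ` of parity `p + 1`. -/
theorem coboundary_increment (F : InfDeformation D p) : D.coboundary (p + 1) F.increment = 0 := by
  ext x
  have h := congrArg Prod.snd (LinearMap.congr_fun F.sq_zero (x, 0))
  simp only [LinearMap.comp_apply, d_apply] at h
  simpa [LInfinityStructure.coboundary, uzpow_add] using h

/-- The infinitesimal deformation `D + t δ`. -/
noncomputable def ofIncrement (δ : SymRev 𝒱 →ₗ[k] SymRev 𝒱) (h : IsCoderivation (parityRev 𝒱) (p + 1) δ)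
    (h0 : D.coboundary (p + 1) δ = 0) : InfDeformation D p where
  d := (D.d ∘ₗ LinearMap.fst k _ _).prod
    (δ ∘ₗ LinearMap.fst k _ _ + (-1 : ℤˣ) ^ p • D.d ∘ₗ LinearMap.snd k _ _)
  isTLinear :=
    { map_parity := by
        intro i z hz
        refine ⟨D.isCoderivation.map_parity i _ hz.1, add_mem ?_ (sign_smul_mem _ _ ?_)⟩
        · have := h.map_parity i _ hz.1
          rwa [add_comm p 1, ← add_assoc] at this
        · have := D.isCoderivation.map_parity _ _ hz.2
          rwa [add_right_comm] at this
      map_tMul := by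
        intro z
        ext <;> simp [tMul] }
  map_one := by simp [h.map_one, D.isCoderivation.map_one]
  comul_comp := by
    intro x
    rw [tDerivation_apply _ p 1 _ (A := D.d) (B := δ) (fun x => by simp)]
    have h1 := LinearMap.congr_fun D.isCoderivation.comul_comp x
    have h2 := LinearMap.congr_fun h.comul_comp x
    refine Prod.ext h1 ?_
    simpa [tComul] using h2
  sq_zero := by
    apply LinearMap.ext
    rintro ⟨x, y⟩
    have hD : ∀ y, D.d (D.d y) = 0 := LinearMap.congr_fun D.sq_zero
    have h1 := LinearMap.congr_fun h0 x
    simp only [LInfinityStructure.coboundary, uzpow_add] at h1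
    ext
    · simp [hD]
    · simpa [hD, map_sign_smul] using h1
  reduces x := rfl

theorem increment_ofIncrement (δ : SymRev 𝒱 →ₗ[k] SymRev 𝒱)
    (h : IsCoderivation (parityRev 𝒱) (p + 1) δ) (h0 : D.coboundary (p + 1) δ = 0) :
    (ofIncrement δ h h0).increment = δ := by
  ext x
  simp [increment, ofIncrement]

/-- Write the automorphism as `1 + t β`. Intertwining `D + t δ` with `D + t δ'` means `β D + δ = δ'
+ (-1)^p D β`. -/
theorem equivalent_iff (F F' : InfDeformation D p) :
    F.Equivalent F' ↔ ∃ β, IsCoderivation (parityRev 𝒱) p β ∧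
      F'.increment - F.increment = D.coboundary p β := by
  constructor
  · rintro ⟨ρ, hT, h1, hΔ, hρ, hd⟩
    set β : SymRev 𝒱 →ₗ[k] SymRev 𝒱 := LinearMap.snd k _ _ ∘ₗ ρ.toLinearMap ∘ₗ LinearMap.inl k _ _
    have hβ : ∀ x, ρ (x, 0) = (x, β x) := fun x => Prod.ext (hρ x) rfl
    have hρ' : ∀ x y, ρ (x, y) = (x, β x + y) := by
      intro x y
      have h2 := hT.map_tMul (y, 0)
      simp only [LinearEquiv.coe_coe, hβ] at h2
      have h3 : ρ (0, y) = (0, y) := by simpa [tMul] using h2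
      have : ((x, y) : SymRev 𝒱 × SymRev 𝒱) = (x, 0) + (0, y) := by simp
      rw [this, map_add, hβ, h3]
      simp
    refine ⟨β, ⟨?_, ?_, ?_⟩, ?_⟩
    · intro i x hx
      have := (hT.map_parity i (x, 0) ⟨hx, zero_mem _⟩).2
      rwa [add_zero] at this
    · simpa [hβ] using congrArg Prod.snd h1
    · ext x
      have h := hΔ x
      rw [tSquare_apply _ p _ (B := β) (fun x => by simp [hβ])] at h
      simpa [tComul, hβ] using congrArg Prod.snd h
    · ext x
      have h := congrArg Prod.snd (LinearMap.congr_fun hd (x, 0))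
      simp only [LinearMap.comp_apply, LinearEquiv.coe_coe, d_apply, hρ', add_zero, map_zero,
        smul_zero] at h
      simp only [LInfinityStructure.coboundary, LinearMap.sub_apply, LinearMap.smul_apply,
        LinearMap.comp_apply]
      rw [sub_eq_sub_iff_add_eq_add, ← h]
  · rintro ⟨β, hβ, h⟩
    -- The inverse of `1 + t β` is `1 - t β`, since `t² = 0`.
    refine ⟨LinearEquiv.ofLinearMap
      ((LinearMap.fst k _ _).prod (β ∘ₗ LinearMap.fst k _ _ + LinearMap.snd k _ _))
      ((LinearMap.fst k _ _).prod (LinearMap.snd k _ _ - β ∘ₗ LinearMap.fst k _ _)) ?_ ?_,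
      ⟨?_, ?_⟩, ?_, ?_, ?_, ?_⟩
    · apply LinearMap.ext; rintro ⟨x, y⟩; simp
    · apply LinearMap.ext; rintro ⟨x, y⟩; simp
    · rintro i ⟨x, y⟩ ⟨hx, hy⟩
      rw [add_zero]
      exact ⟨hx, add_mem (hβ.map_parity i x hx) hy⟩
    · rintro ⟨x, y⟩
      simp [tMul]
    · simp [hβ.map_one]
    · intro x
      rw [tSquare_apply _ p _ (B := β) (fun x => by simp)]
      have h2 := LinearMap.congr_fun hβ.comul_comp x
      refine Prod.ext rfl ?_
      simpa [tComul] using h2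
    · intro x; simp
    · apply LinearMap.ext
      rintro ⟨x, y⟩
      have h' := LinearMap.congr_fun h x
      simp only [LInfinityStructure.coboundary, LinearMap.sub_apply, LinearMap.smul_apply,
        LinearMap.comp_apply, sub_eq_sub_iff_add_eq_add] at h'
      ext
      · simp [d_apply]
      · change β (F.d (x, y)).1 + (F.d (x, y)).2 = (F'.d (x, β x + y)).2
        simp only [d_apply, map_add, smul_add]
        rw [← add_assoc, ← add_assoc, ← h']

end InfDeformation
end Deformations

/-! ### Koszul signs of permutations and the signs of parity reversion -/

section KoszulSigns

/-- Induction over permutations by multiplication with adjacent transpositions. -/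
theorem perm_induction {n : ℕ} {P : Equiv.Perm (Fin (n + 1)) → Prop} (one : P 1)
    (mul : ∀ σ (i : Fin n), P σ → P (σ * Equiv.swap i.castSucc i.succ))
    (σ : Equiv.Perm (Fin (n + 1))) : P σ := by
  have h : σ ∈ Submonoid.closure (Set.range fun i : Fin n => Equiv.swap i.castSucc i.succ) := by
    rw [Equiv.Perm.mclosure_swap_castSucc_succ]; trivial
  induction h using Submonoid.closure_induction_right with
  | one => exact one
  | mul_right x _ y hy ih =>
    obtain ⟨i, rfl⟩ := hy
    exact mul x i ih

theorem koszulSign_one {n : ℕ} (a : Fin n → ZMod 2) : koszulSign 1 a = 1 := by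
  rw [koszulSign]
  refine Finset.prod_eq_one fun i _ => Finset.prod_eq_one fun j _ => if_neg ?_
  rintro ⟨h, h'⟩
  exact absurd h h'.asymm

theorem swap_lt_swap_iff {n : ℕ} (i : Fin n) {x y : Fin (n + 1)}
    (h : ¬ (x = i.castSucc ∧ y = i.succ)) (h' : ¬ (x = i.succ ∧ y = i.castSucc)) :
    Equiv.swap i.castSucc i.succ x < Equiv.swap i.castSucc i.succ y ↔ x < y := by
  simp only [Equiv.swap_apply_def, Fin.ext_iff, Fin.lt_def, Fin.val_castSucc, Fin.val_succ] at *
  split_ifs <;> simp only [Fin.val_castSucc, Fin.val_succ] <;> omega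

/-- An adjacent transposition changes the relative order of one pair of positions only. The factor
of that pair is gained or lost, which is the same for signs. -/
theorem koszulSign_mul_swap {n : ℕ} (σ : Equiv.Perm (Fin (n + 1))) (i : Fin n)
    (a : Fin (n + 1) → ZMod 2) :
    koszulSign (σ * Equiv.swap i.castSucc i.succ) a =
      koszulSign σ a * (-1 : ℤˣ) ^ (a (σ i.castSucc) * a (σ i.succ)) := by
  set τ := Equiv.swap i.castSucc i.succ with hτ
  have hne : i.castSucc ≠ i.succ := i.castSucc_lt_succ.ne
  have h1 : koszulSign (σ * τ) a = ∏ x, ∏ y,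
      if τ x < τ y ∧ σ y < σ x then (-1 : ℤˣ) ^ (a (σ x) * a (σ y)) else 1 := by
    rw [koszulSign, ← Equiv.prod_comp τ]
    refine Finset.prod_congr rfl fun x _ => ?_
    rw [← Equiv.prod_comp τ]
    refine Finset.prod_congr rfl fun y _ => ?_
    simp [hτ]
  -- Both orders of the exceptional pair occur in the double product; exactly one of them is an
  -- inversion of `σ`, so the two correction factors contribute the sign once.
  have h2 : ∀ x y, (if τ x < τ y ∧ σ y < σ x then (-1 : ℤˣ) ^ (a (σ x) * a (σ y)) else 1) =
      (if x < y ∧ σ y < σ x then (-1 : ℤˣ) ^ (a (σ x) * a (σ y)) else 1) *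
      ((if x = i.castSucc then if y = i.succ then if σ y < σ x then
          (-1 : ℤˣ) ^ (a (σ x) * a (σ y)) else 1 else 1 else 1) *
        (if x = i.succ then if y = i.castSucc then if σ y < σ x then
          (-1 : ℤˣ) ^ (a (σ x) * a (σ y)) else 1 else 1 else 1)) := by
    intro x y
    by_cases hA : x = i.castSucc ∧ y = i.succ
    · obtain ⟨rfl, rfl⟩ := hA
      simp [hτ, hne, i.castSucc_lt_succ, i.castSucc_lt_succ.asymm]
      split_ifs <;> simp
    by_cases hB : x = i.succ ∧ y = i.castSucc
    · obtain ⟨rfl, rfl⟩ := hB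
      simp [hτ, hne.symm, i.castSucc_lt_succ, i.castSucc_lt_succ.asymm]
    have hC : (if x = i.castSucc then if y = i.succ then if σ y < σ x then
          (-1 : ℤˣ) ^ (a (σ x) * a (σ y)) else 1 else 1 else 1) = 1 := by
      split_ifs with h h' <;> first | rfl | exact absurd ⟨h, h'⟩ hA
    have hD : (if x = i.succ then if y = i.castSucc then if σ y < σ x then
          (-1 : ℤˣ) ^ (a (σ x) * a (σ y)) else 1 else 1 else 1) = 1 := by
      split_ifs with h h' <;> first | rfl | exact absurd ⟨h, h'⟩ hB
    rw [hC, hD, mul_one, mul_one, if_congr (and_congr_left' (swap_lt_swap_iff i hA hB)) rfl rfl]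
  rw [h1]
  simp only [h2, Finset.prod_mul_distrib]
  rw [koszulSign]
  congr 1
  simp only [Finset.prod_ite_irrel, Finset.prod_const_one, Finset.prod_ite_eq', Finset.mem_univ, if_true]
  rcases lt_or_gt_of_ne (σ.injective.ne hne) with h | h
  · simp [h, h.asymm, mul_comm]
  · simp [h, h.asymm]

theorem koszulSign_swap {n : ℕ} (i : Fin n) (a : Fin (n + 1) → ZMod 2) :
    koszulSign (Equiv.swap i.castSucc i.succ) a = (-1 : ℤˣ) ^ (a i.castSucc * a i.succ) := by
  have := koszulSign_mul_swap 1 i a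
  rwa [one_mul, koszulSign_one, one_mul] at this

/-- Adjacent weights differ by one, so modulo two the exchange shifts the weight of each of the two
entries by one. -/
theorem etaSign_swap {n : ℕ} (i : Fin n) (a : Fin (n + 1) → ZMod 2) :
    etaSign (fun j => a (Equiv.swap i.castSucc i.succ j)) =
      etaSign a * (-1 : ℤˣ) ^ (a i.castSucc + a i.succ) := by
  set τ := Equiv.swap i.castSucc i.succ with hτ
  have hne : i.castSucc ≠ i.succ := i.castSucc_lt_succ.ne
  rw [etaSign, etaSign, ← uzpow_add]
  congr 1
  rw [← Equiv.sum_comp τ]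
  have h : ∀ j, ((n + 1 - 1 - (τ j).val : ℕ) : ZMod 2) * a (τ (τ j)) =
      ((n + 1 - 1 - j.val : ℕ) : ZMod 2) * a j +
      ((if j = i.castSucc then a j else 0) + (if j = i.succ then a j else 0)) := by
    intro j
    have hτj : τ (τ j) = j := by simp [hτ]
    rw [hτj]
    have h2 : ((n - i.val : ℕ) : ZMod 2) = ((n - (i.val + 1) : ℕ) : ZMod 2) + 1 := by
      have : n - i.val = n - (i.val + 1) + 1 := by omega
      rw [this, Nat.cast_add, Nat.cast_one]
    have h1 : (1 : ZMod 2) + 1 = 0 := rfl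
    by_cases hA : j = i.castSucc
    · subst hA
      simp only [hτ, Equiv.swap_apply_left, if_true, hne, if_false, Fin.val_castSucc, Fin.val_succ,
        add_tsub_cancel_right, h2]
      linear_combination (-a i.castSucc) * h1
    by_cases hB : j = i.succ
    · subst hB
      simp only [hτ, Equiv.swap_apply_right, if_true, hne.symm, if_false, Fin.val_castSucc, Fin.val_succ,
        add_tsub_cancel_right, h2]
      ring
    · rw [hτ, Equiv.swap_apply_of_ne_of_ne hA hB]
      simp [hA, hB]
  simp only [h, Finset.sum_add_distrib, Finset.sum_ite_eq', Finset.mem_univ, if_true]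

/-- The signs of the isomorphism `⋀ⁿ V ≅ ⨀ⁿ ΠV` intertwine the antisymmetric and symmetric Koszul
signs. -/
theorem etaSign_mul_koszulSign {n : ℕ} (σ : Equiv.Perm (Fin (n + 1))) (a : Fin (n + 1) → ZMod 2) :
    etaSign a * koszulSign σ (fun i => a i + 1) =
      Equiv.Perm.sign σ * koszulSign σ a * etaSign fun i => a (σ i) := by
  induction σ using perm_induction with
  | one => simp [koszulSign_one]
  | mul σ i ih =>
    have h := etaSign_swap i (fun j => a (σ j))
    simp only [koszulSign_mul_swap, Equiv.Perm.sign_mul, Equiv.Perm.mul_apply, h,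
      Equiv.Perm.sign_swap i.castSucc_lt_succ.ne]
    rw [← mul_assoc, ih]
    -- In `(x + 1)(y + 1) = xy + (x + y) + 1` the three summands account for the Koszul sign on `V`,
    -- the change of `etaSign` and the sign of the transposition.
    have key : ∀ x y : ZMod 2, (-1 : ℤˣ) ^ ((x + 1) * (y + 1)) =
        -((-1 : ℤˣ) ^ (x * y) * (-1 : ℤˣ) ^ (x + y)) := by
      decide
    rw [key]
    apply Units.ext
    push_cast
    ring

end KoszulSigns

/-! ### Monomials and their reordering -/

namespace GradedSym

variable {k W : Type*} [Field k] [AddCommGroup W] [Module k W]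
variable (𝒲 : ZMod 2 → Submodule k W)

/-- The product `w₁ ⋯ wₙ` in the graded symmetric algebra. -/
noncomputable def monomial {n : ℕ} (w : Fin n → W) : GradedSym 𝒲 := (List.ofFn fun i => ι 𝒲 (w i)).prod

theorem monomial_zero (w : Fin 0 → W) : monomial 𝒲 w = 1 := by simp [monomial]

theorem monomial_succ {n : ℕ} (w : Fin (n + 1) → W) :
    monomial 𝒲 w = ι 𝒲 (w 0) * monomial 𝒲 fun i => w i.succ := by
  simp [monomial, List.ofFn_succ]

theorem monomial_succ_last {n : ℕ} (w : Fin (n + 1) → W) :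
    monomial 𝒲 w = (monomial 𝒲 fun i => w i.castSucc) * ι 𝒲 (w (Fin.last n)) := by
  rw [monomial, List.ofFn_succ', List.concat_eq_append, List.prod_append, List.prod_singleton]
  rfl

variable {𝒲}

theorem monomial_swap {n : ℕ} (i : Fin n) {b : Fin (n + 1) → ZMod 2} {w : Fin (n + 1) → W}
    (hw : ∀ j, w j ∈ 𝒲 (b j)) :
    monomial 𝒲 w = (-1 : ℤˣ) ^ (b i.castSucc * b i.succ) •
      monomial 𝒲 fun j => w (Equiv.swap i.castSucc i.succ j) := by
  induction n with
  | zero => exact i.elim0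
  | succ n ih =>
    cases i using Fin.cases with
    | zero =>
      rw [monomial_succ, monomial_succ, monomial_succ 𝒲 fun j => w (Equiv.swap _ _ j),
        monomial_succ 𝒲 fun j => w (Equiv.swap _ _ _), ← mul_assoc, ← mul_assoc]
      have h0 : Equiv.swap (0 : Fin (n + 1)).castSucc (0 : Fin (n + 1)).succ 0 = 1 :=
        Equiv.swap_apply_left _ _
      have h1 : Equiv.swap (0 : Fin (n + 1)).castSucc (0 : Fin (n + 1)).succ (0 : Fin (n + 1)).succ = 0 :=
        Equiv.swap_apply_right _ _
      have h2 : ∀ j : Fin n, Equiv.swap (0 : Fin (n + 1)).castSucc (0 : Fin (n + 1)).succ j.succ.succ =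
          j.succ.succ := fun j =>
        Equiv.swap_apply_of_ne_of_ne (by simp [Fin.ext_iff]) (by simp [Fin.ext_iff])
      simp only [h0, h1, h2]
      rw [ι_mul_ι (hw 0) (hw (Fin.succ 0)), smul_mul_assoc]
      rfl
    | succ i =>
      rw [monomial_succ, ih i (fun j => hw j.succ), monomial_succ 𝒲 fun j => w (Equiv.swap _ _ j)]
      have h0 : Equiv.swap i.succ.castSucc i.succ.succ 0 = 0 :=
        Equiv.swap_apply_of_ne_of_ne (by simp [Fin.ext_iff]) (by simp [Fin.ext_iff])
      have h1 : ∀ j : Fin (n + 1), Equiv.swap i.succ.castSucc i.succ.succ j.succ =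
          (Equiv.swap i.castSucc i.succ j).succ := by
        intro j
        simp only [Equiv.swap_apply_def, Fin.ext_iff, Fin.val_castSucc, Fin.val_succ]
        split_ifs <;> simp_all
      simp only [h0, h1]
      rw [mul_smul_comm]
      rfl

theorem monomial_perm {n : ℕ} (σ : Equiv.Perm (Fin (n + 1))) {b : Fin (n + 1) → ZMod 2}
    {w : Fin (n + 1) → W} (hw : ∀ j, w j ∈ 𝒲 (b j)) :
    monomial 𝒲 w = koszulSign σ b • monomial 𝒲 fun j => w (σ j) := by
  induction σ using perm_induction with
  | one => simp [koszulSign_one]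
  | mul σ i ih =>
    rw [ih, monomial_swap i (fun j => hw (σ j)), koszulSign_mul_swap, smul_smul]
    rfl

theorem monomial_mem_parity [DirectSum.Decomposition 𝒲] {n : ℕ} {b : Fin n → ZMod 2} {w : Fin n → W}
    (hw : ∀ j, w j ∈ 𝒲 (b j)) : monomial 𝒲 w ∈ parity 𝒲 (∑ i, b i) := by
  induction n with
  | zero => rw [monomial_zero, Fin.sum_univ_zero]; exact SetLike.GradedOne.one_mem
  | succ n ih =>
    rw [monomial_succ, Fin.sum_univ_succ]
    exact SetLike.GradedMul.mul_mem (ι_mem_parity 𝒲 (hw 0)) (ih fun j => hw j.succ)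

end GradedSym

/-! ### Multilinear maps tested on homogeneous arguments -/

section Multilinear

variable {k M N : Type*} [Field k] [AddCommGroup M] [Module k M] [AddCommGroup N] [Module k N]
variable (ℳ : ZMod 2 → Submodule k M) [DirectSum.Decomposition ℳ]

theorem multilinear_ext_homogeneous {n : ℕ} {f g : MultilinearMap k (fun _ : Fin n => M) N}
    (h : ∀ (a : Fin n → ZMod 2) (v : Fin n → M), (∀ i, v i ∈ ℳ (a i)) → f v = g v) : f = g := by
  ext v
  have hv : v = fun i => ∑ j : ZMod 2, proj ℳ j (v i) := funext fun i => (sum_proj ℳ (v i)).symm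
  rw [hv, f.map_sum, g.map_sum]
  exact Finset.sum_congr rfl fun a _ => h a _ fun i => proj_mem ℳ (a i) (v i)

end Multilinear

namespace GradedSym

variable {k W N : Type*} [Field k] [AddCommGroup W] [Module k W]
variable [AddCommGroup N] [Module k N]
variable (𝒲 : ZMod 2 → Submodule k W) [DirectSum.Decomposition 𝒲]

/-! ### Linear maps from families of graded symmetric multilinear maps -/

variable (N) in
/-- Families of graded symmetric multilinear maps. -/
def symFamily : Submodule k (∀ n : ℕ, MultilinearMap k (fun _ : Fin n => W) N) where
  carrier := {φ | ∀ (n : ℕ) (i : Fin n) (b : Fin (n + 1) → ZMod 2) (v : Fin (n + 1) → W),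
    (∀ j, v j ∈ 𝒲 (b j)) → φ (n + 1) v = (-1 : ℤˣ) ^ (b i.castSucc * b i.succ) •
      φ (n + 1) fun j => v (Equiv.swap i.castSucc i.succ j)}
  add_mem' := by
    intro φ ψ hφ hψ n i b v hv
    rw [Pi.add_apply, _root_.add_apply, _root_.add_apply, smul_add, ← hφ n i b v hv, ← hψ n i b v hv]
  zero_mem' := by
    intro n i b v hv
    simp
  smul_mem' := by
    intro c φ hφ n i b v hv
    rw [Pi.smul_apply, _root_.smul_apply, _root_.smul_apply, smul_comm, ← hφ n i b v hv]

variable (k W N) in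
/-- Insertion of a vector as the last argument of the members of a family of multilinear maps. -/
noncomputable def contract : W →ₗ[k] Module.End k (∀ n : ℕ, MultilinearMap k (fun _ : Fin n => W) N) :=
  LinearMap.mk₂ k (fun w φ n => (LinearMap.applyₗ w).compMultilinearMap (φ (n + 1)).curryRight)
    (by intro w w' φ; ext n v; simp)
    (by intro c w φ; ext n v; simp)
    (by intro w φ φ'; ext n v; simp)
    (by intro c w φ; ext n v; simp)

theorem contract_apply (w : W) (φ : ∀ n : ℕ, MultilinearMap k (fun _ : Fin n => W) N) (n : ℕ)
    (v : Fin n → W) : contract k W N w φ n v = φ (n + 1) (Fin.snoc v w) := by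
  simp [contract]

theorem contract_mem {φ : ∀ n : ℕ, MultilinearMap k (fun _ : Fin n => W) N}
    (hφ : φ ∈ symFamily N 𝒲) (w : W) : contract k W N w φ ∈ symFamily N 𝒲 := by
  rw [← sum_proj 𝒲 w, map_sum, LinearMap.sum_apply]
  refine sum_mem fun c _ => ?_
  generalize hw' : proj 𝒲 c w = w'
  have hw : w' ∈ 𝒲 c := hw' ▸ proj_mem 𝒲 c w
  intro n i b v hv
  rw [contract_apply, contract_apply,
    hφ (n + 1) i.castSucc (Fin.snoc b c : Fin (n + 2) → ZMod 2) (Fin.snoc v w') (by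
      intro j
      cases j using Fin.lastCases with
      | last => simpa using hw
      | cast j => simpa using hv j)]
  congr 2
  · rw [← Fin.castSucc_succ, Fin.snoc_castSucc (α := fun _ => ZMod 2),
      Fin.snoc_castSucc (α := fun _ => ZMod 2)]
  · funext j
    cases j using Fin.lastCases with
    | last =>
      rw [Equiv.swap_apply_of_ne_of_ne (by simp [Fin.ext_iff]; omega) (by simp [Fin.ext_iff]; omega)]
      simp
    | cast j =>
      have : Equiv.swap i.castSucc.castSucc i.castSucc.succ j.castSucc =
          (Equiv.swap i.castSucc i.succ j).castSucc := by
        simp only [Equiv.swap_apply_def, Fin.ext_iff, Fin.val_castSucc, Fin.val_succ]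
        split_ifs <;> simp_all
      rw [this]
      simp

/-- The two contractions fill the last two slots, which the symmetry of `φ` exchanges. This is the
relation that lets contraction extend to an action of `GradedSym 𝒲`. -/
theorem contract_comm {φ : ∀ n : ℕ, MultilinearMap k (fun _ : Fin n => W) N}
    (hφ : φ ∈ symFamily N 𝒲) {i j : ZMod 2} {u v : W} (hu : u ∈ 𝒲 i) (hv : v ∈ 𝒲 j) :
    contract k W N u (contract k W N v φ) =
      (-1 : ℤˣ) ^ (i * j) • contract k W N v (contract k W N u φ) := by
  funext n
  rw [Pi.smul_apply]
  apply multilinear_ext_homogeneous 𝒲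
  intro a x hx
  rw [_root_.smul_apply]
  simp only [contract_apply]
  rw [hφ (n + 1) (Fin.last n) (Fin.snoc (Fin.snoc a i : Fin (n + 1) → ZMod 2) j : Fin (n + 2) → ZMod 2)
    _ (by
      intro l
      cases l using Fin.lastCases with
      | last => simpa using hv
      | cast l =>
        cases l using Fin.lastCases with
        | last => simpa using hu
        | cast l => simpa using hx l)]
  congr 2
  · simp
  · funext l
    cases l using Fin.lastCases with
    | last =>
      rw [← Fin.succ_last, Equiv.swap_apply_right, Fin.succ_last]
      simp
    | cast l =>
      cases l using Fin.lastCases with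
      | last =>
        rw [Equiv.swap_apply_left, Fin.succ_last]
        simp
      | cast l =>
        rw [Equiv.swap_apply_of_ne_of_ne (by simp [Fin.ext_iff]; omega) (by simp [Fin.ext_iff]; omega)]
        simp

variable (N) in
/-- The action of the symmetric algebra on families of graded symmetric multilinear maps. -/
noncomputable def contractSym : GradedSym 𝒲 →ₐ[k] Module.End k (symFamily N 𝒲) :=
  lift 𝒲
    { toFun := fun w => (contract k W N w).restrict fun _ hφ => contract_mem 𝒲 hφ w
      map_add' := by intro w w'; ext φ; simp
      map_smul' := by intro c w; ext φ; simp } (by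
    intro i j u v hu hv
    ext φ : 2
    exact contract_comm 𝒲 φ.2 hu hv)

/-- The linear map on the symmetric algebra given by a family of graded symmetric multilinear maps. -/
noncomputable def ofSymFamily (φ : symFamily N 𝒲) : GradedSym 𝒲 →ₗ[k] N where
  toFun x := (contractSym N 𝒲 x φ).1 0 Fin.elim0
  map_add' := by intro x y; simp
  map_smul' := by intro c x; simp

/-- A product acts by composition, so its last factor is contracted first, and contraction fills the
last slot; the induction therefore removes letters from the right. This is the universal property of
the symmetric powers, derived from that of the algebra. -/
theorem ofSymFamily_monomial (φ : symFamily N 𝒲) {n : ℕ} (w : Fin n → W) :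
    ofSymFamily 𝒲 φ (monomial 𝒲 w) = φ.1 n w := by
  induction n generalizing φ with
  | zero =>
    simp only [ofSymFamily, LinearMap.coe_mk, AddHom.coe_mk, monomial_zero, map_one, Module.End.one_apply]
    congr 1
    exact Subsingleton.elim _ _
  | succ n ih =>
    have := ih ⟨contract k W N (w (Fin.last n)) φ.1, contract_mem 𝒲 φ.2 _⟩ fun i => w i.castSucc
    rw [contract_apply] at this
    simp only [ofSymFamily, LinearMap.coe_mk, AddHom.coe_mk, monomial_succ_last, map_mul,
      Module.End.mul_apply] at this ⊢
    have h : contractSym N 𝒲 (ι 𝒲 (w (Fin.last n))) φ =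
        ⟨contract k W N (w (Fin.last n)) φ.1, contract_mem 𝒲 φ.2 _⟩ := by
      rw [contractSym, lift_ι]; rfl
    rw [h, this]
    congr 1
    exact Fin.snoc_init_self w

/-! ### Linear maps are determined by their values on products of homogeneous elements -/

variable [CharZero k]

theorem degree_le_span (n : ℕ) : degree 𝒲 n ≤ Submodule.span k {x | ∃ (b : Fin n → ZMod 2)
    (w : Fin n → W), (∀ j, w j ∈ 𝒲 (b j)) ∧ x = monomial 𝒲 w} := by
  induction n with
  | zero =>
    intro x hx
    obtain ⟨c, rfl⟩ := (mem_degree_zero 𝒲).mp hx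
    exact Submodule.smul_mem _ _ (Submodule.subset_span
      ⟨Fin.elim0, Fin.elim0, fun j => j.elim0, (monomial_zero 𝒲 _).symm⟩)
  | succ n ih =>
    intro x hx
    refine degree_succ_induction 𝒲 _ (fun i w hw x hx => ?_) hx
    replace hx := ih hx
    induction hx using Submodule.span_induction with
    | mem y hy =>
      obtain ⟨b, v, hv, rfl⟩ := hy
      refine Submodule.subset_span ⟨Fin.cons i b, Fin.cons w v, fun j => ?_, ?_⟩
      · cases j using Fin.cases with
        | zero => simpa using hw
        | succ j => simpa using hv j
      · rw [monomial_succ]; simp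
    | zero => simp
    | add y z _ _ hy hz => rw [mul_add]; exact add_mem hy hz
    | smul c y _ hy => rw [mul_smul_comm]; exact Submodule.smul_mem _ _ hy

theorem hom_ext_monomial_degree {f g : GradedSym 𝒲 →ₗ[k] N} {n : ℕ}
    (h : ∀ (b : Fin n → ZMod 2) (w : Fin n → W), (∀ j, w j ∈ 𝒲 (b j)) →
      f (monomial 𝒲 w) = g (monomial 𝒲 w)) {x : GradedSym 𝒲} (hx : x ∈ degree 𝒲 n) : f x = g x := by
  have : degree 𝒲 n ≤ LinearMap.eqLocus f g := by
    refine (degree_le_span 𝒲 n).trans (Submodule.span_le.mpr ?_)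
    rintro _ ⟨b, w, hw, rfl⟩
    exact h b w hw
  exact this hx

theorem hom_ext_monomial {f g : GradedSym 𝒲 →ₗ[k] N}
    (h : ∀ (n : ℕ) (b : Fin n → ZMod 2) (w : Fin n → W), (∀ j, w j ∈ 𝒲 (b j)) →
      f (monomial 𝒲 w) = g (monomial 𝒲 w)) : f = g :=
  hom_ext_degree 𝒲 fun n _ hx => hom_ext_monomial_degree 𝒲 (h n) hx

/-- Having parity `q` amounts to commuting with the parity involutions up to `(-1)^q`, an identity
of linear maps that monomials suffice to check. -/
theorem hasParity_of_monomial (𝒩 : ZMod 2 → Submodule k N) [DirectSum.Decomposition 𝒩]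
    {q : ZMod 2} {f : GradedSym 𝒲 →ₗ[k] N}
    (h : ∀ (n : ℕ) (b : Fin n → ZMod 2) (w : Fin n → W), (∀ j, w j ∈ 𝒲 (b j)) →
      f (monomial 𝒲 w) ∈ 𝒩 (∑ j, b j + q)) : HasParity (parity 𝒲) 𝒩 q f := by
  have key : koszul 𝒩 1 ∘ₗ f = (-1 : ℤˣ) ^ q • f ∘ₗ koszul (parity 𝒲) 1 := by
    apply hom_ext_monomial
    intro n b w hw
    rw [LinearMap.comp_apply, koszul_of_mem 𝒩 1 (h n b w hw), LinearMap.smul_apply,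
      LinearMap.comp_apply, koszul_of_mem (parity 𝒲) 1 (monomial_mem_parity hw), map_sign_smul,
      smul_smul, ← uzpow_add, mul_one, mul_one, add_comm]
  intro i x hx
  apply mem_of_koszul_one
  have := LinearMap.congr_fun key x
  rw [LinearMap.comp_apply, LinearMap.smul_apply, LinearMap.comp_apply,
    koszul_of_mem (parity 𝒲) 1 hx, map_sign_smul, smul_smul, ← uzpow_add, mul_one] at this
  rw [this, add_comm]

end GradedSym

/-! ### Coderivations and cochains -/

section Bijection

variable {k V : Type*} [Field k] [CharZero k] [AddCommGroup V] [Module k V]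
variable {𝒱 : ZMod 2 → Submodule k V} [DirectSum.Decomposition 𝒱]

open GradedSym

theorem zmod_two_add_one_add_one : ∀ i : ZMod 2, i + 1 + 1 = i := by decide

theorem mem_parityRev {i : ZMod 2} {v : V} (hv : v ∈ 𝒱 i) : v ∈ parityRev 𝒱 (i + 1) := by
  rw [parityRev, zmod_two_add_one_add_one]; exact hv

theorem mem_of_mem_parityRev {i : ZMod 2} {v : V} (hv : v ∈ parityRev 𝒱 i) : v ∈ 𝒱 (i + 1) := hv

theorem structureMaps_eq_monomial (δ : SymRev 𝒱 →ₗ[k] SymRev 𝒱) {n : ℕ} {a : Fin (n + 1) → ZMod 2}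
    {v : Fin (n + 1) → V} (hv : ∀ i, v i ∈ 𝒱 (a i)) :
    structureMaps 𝒱 δ n v =
      etaSign a • toBase (parityRev 𝒱) (δ (monomial (parityRev 𝒱) v)) :=
  structureMaps_apply 𝒱 δ hv

theorem toBase_monomial (δ : SymRev 𝒱 →ₗ[k] SymRev 𝒱) {n : ℕ} {a : Fin (n + 1) → ZMod 2}
    {v : Fin (n + 1) → V} (hv : ∀ i, v i ∈ 𝒱 (a i)) :
    toBase (parityRev 𝒱) (δ (monomial (parityRev 𝒱) v)) = etaSign a • structureMaps 𝒱 δ n v := by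
  rw [structureMaps_eq_monomial δ hv, smul_smul, Int.units_mul_self, one_smul]

theorem structureMaps_mem_cochains {q : ZMod 2} {δ : SymRev 𝒱 →ₗ[k] SymRev 𝒱}
    (h : IsCoderivation (parityRev 𝒱) q δ) : structureMaps 𝒱 δ ∈ cochains 𝒱 q := by
  intro n _ a v hv
  have hw : ∀ i, v i ∈ parityRev 𝒱 (a i + 1) := fun i => mem_parityRev (hv i)
  constructor
  · rw [structureMaps_eq_monomial δ hv]
    apply sign_smul_mem
    have := hasParity_toBase (parityRev 𝒱) _ _ (h.map_parity _ _ (monomial_mem_parity hw))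
    have := mem_of_mem_parityRev this
    -- The `n + 1` arguments and the value are each shifted by one parity; together with `q` this
    -- leaves `q + n` modulo two.
    convert this using 2
    rw [Finset.sum_add_distrib, Finset.sum_const, Finset.card_univ, Fintype.card_fin, nsmul_eq_mul]
    push_cast
    have h1 : (1 : ZMod 2) + 1 = 0 := rfl
    linear_combination -h1
  · intro σ
    rw [structureMaps_eq_monomial δ hv, structureMaps_eq_monomial δ (fun i => hv (σ i)),
      monomial_perm σ hw, map_sign_smul, map_sign_smul, smul_smul, smul_smul, etaSign_mul_koszulSign]

theorem toBase_eq_of_structureMaps_eq {δ δ' : SymRev 𝒱 →ₗ[k] SymRev 𝒱} (h1 : δ 1 = δ' 1)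
    (h : structureMaps 𝒱 δ = structureMaps 𝒱 δ') (x : SymRev 𝒱) :
    toBase (parityRev 𝒱) (δ x) = toBase (parityRev 𝒱) (δ' x) := by
  suffices h : toBase (parityRev 𝒱) ∘ₗ δ = toBase (parityRev 𝒱) ∘ₗ δ' from LinearMap.congr_fun h x
  apply hom_ext_monomial
  intro n b w hw
  match n with
  | 0 => simp only [monomial_zero, LinearMap.comp_apply, h1]
  | n + 1 => rw [LinearMap.comp_apply, LinearMap.comp_apply, toBase_monomial δ hw, h,
      toBase_monomial δ' hw]

theorem IsCoderivation.eq_of_structureMaps_eq {q : ZMod 2} {δ δ' : SymRev 𝒱 →ₗ[k] SymRev 𝒱}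
    (hδ : IsCoderivation (parityRev 𝒱) q δ) (hδ' : IsCoderivation (parityRev 𝒱) q δ')
    (h : structureMaps 𝒱 δ = structureMaps 𝒱 δ') : δ = δ' :=
  hδ.eq_of_toBase_eq hδ' (toBase_eq_of_structureMaps_eq (by rw [hδ.map_one, hδ'.map_one]) h)

/-- The family of maps `⨀ⁿ ΠV → ΠV` corresponding to a family of maps `⋀ⁿ V → V`. -/
noncomputable def symOfAlt (𝒱 : ZMod 2 → Submodule k V) [DirectSum.Decomposition 𝒱]
    (φ : Family k V) : ∀ n : ℕ, MultilinearMap k (fun _ : Fin n => V) V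
  | 0 => 0
  | n + 1 => glue 𝒱 fun a => etaSign a • φ n

theorem symOfAlt_succ (φ : Family k V) {n : ℕ} {a : Fin (n + 1) → ZMod 2}
    {v : Fin (n + 1) → V} (hv : ∀ i, v i ∈ 𝒱 (a i)) : symOfAlt 𝒱 φ (n + 1) v = etaSign a • φ n v := by
  rw [symOfAlt, glue_apply 𝒱 _ hv, _root_.smul_apply]

theorem symOfAlt_mem {q : ZMod 2} {φ : Family k V} (hφ : φ ∈ cochains 𝒱 q) :
    symOfAlt 𝒱 φ ∈ symFamily V (parityRev 𝒱) := by
  intro n i b v hv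
  set τ := Equiv.swap i.castSucc i.succ with hτ
  have hv' : ∀ j, v j ∈ 𝒱 (b j + 1) := fun j => mem_of_mem_parityRev (hv j)
  -- Here `b` are the parities in `ΠV`, so those in `V` are `b + 1`, and shifting these once more
  -- gives back `b`.
  have h1 := etaSign_mul_koszulSign τ (fun j => b j + 1)
  have h2 : (fun j => b j + 1 + 1) = b := funext fun j => zmod_two_add_one_add_one (b j)
  rw [h2, koszulSign_swap] at h1
  rw [symOfAlt_succ φ hv', symOfAlt_succ φ (fun j => hv' (τ j)),
    (hφ n trivial _ v hv').2 τ, smul_smul, smul_smul]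
  congr 1
  exact (by decide : ∀ e s t e' : ℤˣ, e * s = t * e' → e * t = s * e') _ _ _ _ h1

/-- The signs turn `φ` into a symmetric family, the universal property turns the family into a map
`f` on the symmetric algebra, and `coder f` is the coderivation. The family is zero in arity zero,
so that `f 1 = 0`. -/
theorem exists_coderivation {q : ZMod 2} {φ : Family k V} (hφ : φ ∈ cochains 𝒱 q) :
    ∃ δ, IsCoderivation (parityRev 𝒱) q δ ∧ structureMaps 𝒱 δ = φ := by
  set f := ofSymFamily (parityRev 𝒱) ⟨symOfAlt 𝒱 φ, symOfAlt_mem hφ⟩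
  have hf1 : f 1 = 0 := by
    have := ofSymFamily_monomial (parityRev 𝒱) ⟨symOfAlt 𝒱 φ, symOfAlt_mem hφ⟩ (n := 0) Fin.elim0
    rwa [monomial_zero] at this
  have hf : HasParity (parity (parityRev 𝒱)) (parityRev 𝒱) q f := by
    apply hasParity_of_monomial
    intro n b w hw
    match n with
    | 0 => rw [monomial_zero, hf1]; exact zero_mem _
    | n + 1 =>
      have hw' : ∀ j, w j ∈ 𝒱 (b j + 1) := fun j => mem_of_mem_parityRev (hw j)
      rw [ofSymFamily_monomial]
      simp only [symOfAlt_succ φ hw']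
      apply sign_smul_mem
      have := (hφ n trivial _ w hw').1
      rw [parityRev]
      convert this using 2
      rw [Finset.sum_add_distrib, Finset.sum_const, Finset.card_univ, Fintype.card_fin, nsmul_eq_mul]
      push_cast
      linear_combination - CharTwo.add_self_eq_zero (n : ZMod 2)
  refine ⟨coder (parityRev 𝒱) f, isCoderivation_coder _ hf hf1, ?_⟩
  funext n
  apply multilinear_ext_homogeneous 𝒱
  intro a v hv
  rw [structureMaps_eq_monomial _ hv, toBase_coder, ofSymFamily_monomial]
  simp only [symOfAlt_succ φ hv, smul_smul, Int.units_mul_self, one_smul]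

theorem bijOn_structureMaps (q : ZMod 2) :
    Set.BijOn (structureMaps 𝒱) {δ | IsCoderivation (parityRev 𝒱) q δ} (cochains 𝒱 q) :=
  ⟨fun _ h => structureMaps_mem_cochains h, fun _ h _ h' => h.eq_of_structureMaps_eq h',
    fun _ hφ => exists_coderivation hφ⟩

end Bijection

/-! ### Unshuffles that separate one or two letters -/

section Unshuffles

/-- The permutation `0 ↦ i`, `k + 1 ↦ i.succAbove (τ k)`. -/
noncomputable def consPerm {n : ℕ} (i : Fin (n + 1)) (τ : Equiv.Perm (Fin n)) :
    Equiv.Perm (Fin (n + 1)) :=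
  Equiv.ofBijective (Fin.cons i fun k => i.succAbove (τ k)) (Finite.injective_iff_bijective.mp
    (Fin.cons_injective_iff.mpr ⟨by rintro ⟨k, hk⟩; exact Fin.succAbove_ne _ _ hk,
      Fin.succAbove_right_injective.comp τ.injective⟩))

theorem consPerm_zero {n : ℕ} (i : Fin (n + 1)) (τ : Equiv.Perm (Fin n)) : consPerm i τ 0 = i := rfl

theorem consPerm_succ {n : ℕ} (i : Fin (n + 1)) (τ : Equiv.Perm (Fin n)) (k : Fin n) :
    consPerm i τ k.succ = i.succAbove (τ k) := rfl

theorem exists_eq_consPerm {n : ℕ} (σ : Equiv.Perm (Fin (n + 1))) : ∃ τ, σ = consPerm (σ 0) τ := by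
  have h : ∀ k : Fin n, ∃ m, (σ 0).succAbove m = σ k.succ := fun k =>
    Fin.exists_succAbove_eq (σ.injective.ne (Fin.succ_ne_zero k))
  choose τ hτ using h
  have hinj : Function.Injective τ := by
    intro k l hkl
    have := hτ k
    rw [hkl, hτ l] at this
    exact (Fin.succ_injective _ (σ.injective this)).symm
  refine ⟨Equiv.ofBijective τ (Finite.injective_iff_bijective.mp hinj), ?_⟩
  ext k
  cases k using Fin.cases with
  | zero => rfl
  | succ k => rw [consPerm_succ, Equiv.ofBijective_apply, hτ]

/-- The permutation that increases on all letters but the last and takes the last one to `i`. -/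
noncomputable def lastPerm {n : ℕ} (i : Fin (n + 1)) : Equiv.Perm (Fin (n + 1)) :=
  Equiv.ofBijective (Fin.snoc i.succAbove i) (Finite.injective_iff_bijective.mp
    (Fin.snoc_injective_iff.mpr ⟨Fin.succAbove_right_injective,
      by rintro ⟨k, hk⟩; exact Fin.succAbove_ne _ _ hk⟩))

theorem lastPerm_last {n : ℕ} (i : Fin (n + 1)) : lastPerm i (Fin.last n) = i := by
  simp [lastPerm]

theorem lastPerm_castSucc {n : ℕ} (i : Fin (n + 1)) (k : Fin n) :
    lastPerm i k.castSucc = i.succAbove k := by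
  simp [lastPerm]

theorem perm_eq_one_of_strictMono {n : ℕ} {σ : Equiv.Perm (Fin n)} (h : StrictMono σ) : σ = 1 := by
  have : ⇑σ = id := (h.range_inj strictMono_id).mp (by rw [σ.surjective.range_eq, Set.range_id])
  ext k
  rw [this]; rfl

theorem mem_unshuffles {p n : ℕ} {σ : Equiv.Perm (Fin n)} :
    σ ∈ unshuffles p n ↔ ∀ i j : Fin n, i < j → (j.val < p ∨ p ≤ i.val) → σ i < σ j := by
  simp [unshuffles]

/-- Such an unshuffle is determined by the letter in last position: the others follow in increasing
order. -/
theorem sum_unshuffles_last {n : ℕ} {N : Type*} [AddCommMonoid N] (F : Equiv.Perm (Fin (n + 1)) → N) :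
    ∑ σ ∈ unshuffles n (n + 1), F σ = ∑ i, F (lastPerm i) := by
  classical
  have himg : unshuffles n (n + 1) = Finset.univ.image lastPerm := by
    ext σ
    simp only [mem_unshuffles, Finset.mem_image, Finset.mem_univ, true_and]
    constructor
    · intro h
      refine ⟨σ (Fin.last n), ?_⟩
      have : (fun k : Fin n => σ k.castSucc) = (σ (Fin.last n)).succAbove := by
        have hmono : StrictMono fun k : Fin n => σ k.castSucc := fun k l hkl =>
          h _ _ (Fin.castSucc_lt_castSucc_iff.mpr hkl) (Or.inl l.is_lt)
        refine (hmono.range_inj (Fin.strictMono_succAbove _)).mp ?_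
        rw [Fin.range_succAbove]
        ext x
        constructor
        · rintro ⟨k, rfl⟩
          exact σ.injective.ne k.castSucc_lt_last.ne
        · intro hx
          obtain ⟨y, rfl⟩ := σ.surjective x
          cases y using Fin.lastCases with
          | last => exact absurd rfl hx
          | cast y => exact ⟨y, rfl⟩
      ext k
      cases k using Fin.lastCases with
      | last => rw [lastPerm_last]
      | cast k => rw [lastPerm_castSucc, ← this]
    · rintro ⟨i, rfl⟩ x y hxy h
      have hy : y.val < n := by
        rcases h with h | h
        · exact h
        · have := Fin.lt_def.mp hxy; have := y.is_lt; omega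
      have hx : x.val < n := (Fin.lt_def.mp hxy).trans hy
      have ex : x = (⟨x.val, hx⟩ : Fin n).castSucc := rfl
      have ey : y = (⟨y.val, hy⟩ : Fin n).castSucc := rfl
      rw [ex, ey, lastPerm_castSucc, lastPerm_castSucc]
      exact Fin.strictMono_succAbove i hxy
  rw [himg, Finset.sum_image]
  intro i _ j _ h
  rw [← lastPerm_last i, h, lastPerm_last]

/-- Such an unshuffle is determined by its first two letters. The second is `i.succAbove j`, and `i
< i.succAbove j` means `i ≤ j.castSucc`. -/
theorem sum_unshuffles_two {n : ℕ} {N : Type*} [AddCommMonoid N] (F : Equiv.Perm (Fin (n + 2)) → N) :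
    ∑ σ ∈ unshuffles 2 (n + 2), F σ =
      ∑ i, ∑ j : Fin (n + 1), if i ≤ j.castSucc then F (consPerm i (consPerm j 1)) else 0 := by
  classical
  have himg : unshuffles 2 (n + 2) =
      ((Finset.univ : Finset (Fin (n + 2) × Fin (n + 1))).filter fun x => x.1 ≤ x.2.castSucc).image
        fun x => consPerm x.1 (consPerm x.2 1) := by
    ext σ
    simp only [mem_unshuffles, Finset.mem_image, Finset.mem_filter, Finset.mem_univ, true_and,
      Prod.exists]
    constructor
    · intro h
      obtain ⟨τ, hτ⟩ := exists_eq_consPerm σ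
      obtain ⟨ρ, hρ⟩ := exists_eq_consPerm τ
      generalize σ 0 = i at hτ
      generalize τ 0 = j at hρ
      subst hτ hρ
      refine ⟨i, j, ?_, ?_⟩
      · have := h 0 (Fin.succ 0) (Fin.succ_pos 0) (Or.inl (by simp))
        rw [consPerm_zero, consPerm_succ, consPerm_zero] at this
        exact Fin.lt_succAbove_iff_le_castSucc _ _ |>.mp this
      · rw [perm_eq_one_of_strictMono (σ := ρ)]
        intro k l hkl
        have := h k.succ.succ l.succ.succ (by simpa using hkl) (Or.inr (by simp))
        rw [consPerm_succ, consPerm_succ, consPerm_succ, consPerm_succ] at this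
        exact (Fin.strictMono_succAbove j).lt_iff_lt.mp ((Fin.strictMono_succAbove i).lt_iff_lt.mp this)
    · rintro ⟨i, j, hij, rfl⟩ x y hxy h
      cases x using Fin.cases with
      | zero =>
        cases y using Fin.cases with
        | zero => exact absurd hxy (lt_irrefl _)
        | succ y =>
          cases y using Fin.cases with
          | zero =>
            rw [consPerm_zero, consPerm_succ, consPerm_zero]
            exact (Fin.lt_succAbove_iff_le_castSucc _ _).mpr hij
          | succ y => simp at h
      | succ x =>
        cases y using Fin.cases with
        | zero => simp at hxy
        | succ y =>
          cases x using Fin.cases with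
          | zero =>
            cases y using Fin.cases with
            | zero => exact absurd hxy (lt_irrefl _)
            | succ y => simp at h
          | succ x =>
            cases y using Fin.cases with
            | zero => simp at hxy
            | succ y =>
              rw [consPerm_succ, consPerm_succ, consPerm_succ, consPerm_succ]
              exact Fin.strictMono_succAbove i (Fin.strictMono_succAbove j (by simpa using hxy))
  rw [himg, Finset.sum_image, Finset.sum_filter, Fintype.sum_prod_type]
  rintro ⟨i, j⟩ _ ⟨i', j'⟩ _ h
  simp only at h
  have h1 : i = i' := by rw [← consPerm_zero i (consPerm j 1), h, consPerm_zero]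
  subst h1
  have h2 := congrArg (fun σ => σ (Fin.succ 0)) h
  simp only [consPerm_succ, consPerm_zero] at h2
  rw [Fin.succAbove_right_injective h2]

/-- The sign of moving the letter `i` to the front. -/
noncomputable def firstSign {n : ℕ} (i : Fin (n + 1)) (b : Fin (n + 1) → ZMod 2) : ℤˣ :=
  ∏ k : Fin n, if i.succAbove k < i then (-1 : ℤˣ) ^ (b i * b (i.succAbove k)) else 1

/-- Inversions that involve the first position give `firstSign`. The remaining ones are those of
`τ`, because `succAbove` preserves order. -/
theorem koszulSign_consPerm {n : ℕ} (i : Fin (n + 1)) (τ : Equiv.Perm (Fin n))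
    (b : Fin (n + 1) → ZMod 2) :
    koszulSign (consPerm i τ) b = firstSign i b * koszulSign τ fun k => b (i.succAbove k) := by
  rw [koszulSign, Fin.prod_univ_succ, Fin.prod_univ_succ]
  congr 1
  · rw [firstSign]
    simp only [consPerm_zero, consPerm_succ, Fin.succ_pos, lt_irrefl, false_and, if_false, one_mul,
      true_and]
    exact Equiv.prod_comp τ fun k => if i.succAbove k < i then (-1 : ℤˣ) ^ (b i * b (i.succAbove k)) else 1
  · rw [koszulSign]
    refine Finset.prod_congr rfl fun k _ => ?_
    rw [Fin.prod_univ_succ]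
    simp [consPerm_succ, (Fin.strictMono_succAbove i).lt_iff_lt]

theorem firstSign_zero {n : ℕ} (b : Fin (n + 1) → ZMod 2) : firstSign 0 b = 1 := by
  simp [firstSign]

theorem firstSign_succ {n : ℕ} (i : Fin (n + 1)) (b : Fin (n + 2) → ZMod 2) :
    firstSign i.succ b = (-1 : ℤˣ) ^ (b i.succ * b 0) * firstSign i fun k => b k.succ := by
  rw [firstSign, Fin.prod_univ_succ]
  simp [firstSign]

/-- The sign of moving the letter `i` to the end. -/
noncomputable def lastSign {n : ℕ} (i : Fin (n + 1)) (b : Fin (n + 1) → ZMod 2) : ℤˣ :=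
  ∏ k : Fin n, if i < i.succAbove k then (-1 : ℤˣ) ^ (b (i.succAbove k) * b i) else 1

theorem koszulSign_lastPerm {n : ℕ} (i : Fin (n + 1)) (b : Fin (n + 1) → ZMod 2) :
    koszulSign (lastPerm i) b = lastSign i b := by
  rw [koszulSign, Fin.prod_univ_castSucc]
  have h1 : ∀ x : Fin n, (∏ y, if x.castSucc < y ∧ lastPerm i y < lastPerm i x.castSucc then
      (-1 : ℤˣ) ^ (b (lastPerm i x.castSucc) * b (lastPerm i y)) else 1) =
      if i < i.succAbove x then (-1 : ℤˣ) ^ (b (i.succAbove x) * b i) else 1 := by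
    intro x
    rw [Fin.prod_univ_castSucc, Finset.prod_eq_one, one_mul, lastPerm_last, lastPerm_castSucc]
    · simp [Fin.castSucc_lt_last]
    · intro y _
      rw [lastPerm_castSucc, lastPerm_castSucc]
      refine if_neg ?_
      rintro ⟨h, h'⟩
      have h2 := (Fin.strictMono_succAbove i).lt_iff_lt.mp h'
      exact absurd (Fin.castSucc_lt_castSucc_iff.mp h) h2.asymm
  simp only [h1]
  rw [lastSign, Finset.prod_eq_one (s := Finset.univ) (f := fun y => if Fin.last n < y ∧ _ then _ else _),
    mul_one]
  intro y _
  exact if_neg fun h => absurd h.1 (Fin.le_last y).not_gt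

theorem prod_neg_one_uzpow {ι : Type*} (s : Finset ι) (c : ι → ZMod 2) :
    ∏ i ∈ s, (-1 : ℤˣ) ^ c i = (-1 : ℤˣ) ^ ∑ i ∈ s, c i := by
  classical
  induction s using Finset.induction_on with
  | empty => simp
  | insert a s ha ih => rw [Finset.prod_insert ha, Finset.sum_insert ha, ih, uzpow_add]

theorem lastSign_zero {n : ℕ} (b : Fin (n + 1) → ZMod 2) :
    lastSign 0 b = (-1 : ℤˣ) ^ ((∑ k : Fin n, b k.succ) * b 0) := by
  simp [lastSign, prod_neg_one_uzpow, Finset.sum_mul]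

theorem lastSign_succ {n : ℕ} (i : Fin (n + 1)) (b : Fin (n + 2) → ZMod 2) :
    lastSign i.succ b = lastSign i fun k => b k.succ := by
  rw [lastSign, Fin.prod_univ_succ]
  simp [lastSign]

end Unshuffles

namespace GradedSym

variable {k W N : Type*} [Field k] [CharZero k] [AddCommGroup W] [Module k W]
variable [AddCommGroup N] [Module k N]
variable (𝒲 : ZMod 2 → Submodule k W) [DirectSum.Decomposition 𝒲]

/-! ### Expansions of the comultiplication -/

/-- Only terms of `Δ` with one letter on the left survive; that letter is brought to the front, at
the cost of `firstSign`. The recursion for `firstSign` matches the one for `conv`. -/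
theorem conv_toBase_left_monomial {n : ℕ} (B : W →ₗ[k] GradedSym 𝒲 →ₗ[k] N) {b : Fin (n + 1) → ZMod 2}
    {w : Fin (n + 1) → W} (hw : ∀ j, w j ∈ 𝒲 (b j)) :
    conv 𝒲 (B ∘ₗ toBase 𝒲) (monomial 𝒲 w) =
      ∑ i, firstSign i b • B (w i) (monomial 𝒲 fun k => w (i.succAbove k)) := by
  have step : ∀ (B : W →ₗ[k] GradedSym 𝒲 →ₗ[k] N) {i : ZMod 2} {u : W} (_ : u ∈ 𝒲 i) (x : GradedSym 𝒲),
      conv 𝒲 (B ∘ₗ toBase 𝒲) (ι 𝒲 u * x) = B u x +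
        conv 𝒲 (B.compl₁₂ (koszul 𝒲 i) (LinearMap.mulLeft k (ι 𝒲 u)) ∘ₗ toBase 𝒲) x := by
    intro B i u hu x
    rw [conv_ι_mul 𝒲 _ hu, ← conv_counit_left 𝒲 (B u) x]
    congr 1 <;> apply conv_ext <;> intros <;> simp [toBase_ι_mul, toBase_koszul]
  induction n generalizing B with
  | zero =>
    rw [monomial_succ, step B (hw 0), monomial_zero, conv_one]
    simp [toBase_one, firstSign_zero, monomial_zero]
  | succ n ih =>
    rw [monomial_succ, step B (hw 0), ih _ (fun j => hw j.succ)]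
    conv_rhs => rw [Fin.sum_univ_succ, firstSign_zero, one_smul]
    refine congrArg₂ (· + ·) rfl (Finset.sum_congr rfl fun i _ => ?_)
    rw [firstSign_succ, monomial_succ 𝒲 fun k => w (i.succ.succAbove k)]
    simp [koszul_of_mem 𝒲 _ (hw i.succ), LinearMap.smul_apply, smul_smul, mul_comm]

theorem conv_toBase_right_monomial {n : ℕ} (B : GradedSym 𝒲 →ₗ[k] W →ₗ[k] N)
    {b : Fin (n + 1) → ZMod 2} {w : Fin (n + 1) → W} (hw : ∀ j, w j ∈ 𝒲 (b j)) :
    conv 𝒲 (B.compl₂ (toBase 𝒲)) (monomial 𝒲 w) =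
      ∑ i, lastSign i b • B (monomial 𝒲 fun k => w (i.succAbove k)) (w i) := by
  have step : ∀ (B : GradedSym 𝒲 →ₗ[k] W →ₗ[k] N) {i : ZMod 2} {u : W} (_ : u ∈ 𝒲 i) (x : GradedSym 𝒲),
      conv 𝒲 (B.compl₂ (toBase 𝒲)) (ι 𝒲 u * x) = B (koszul (parity 𝒲) i x) u +
        conv 𝒲 ((B ∘ₗ LinearMap.mulLeft k (ι 𝒲 u)).compl₂ (toBase 𝒲)) x := by
    intro B i u hu x
    rw [conv_ι_mul 𝒲 _ hu, add_comm]
    have := conv_counit_right 𝒲 (B.flip u ∘ₗ koszul (parity 𝒲) i) x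
    simp only [LinearMap.comp_apply, LinearMap.flip_apply] at this
    rw [← this]
    congr 1
    apply conv_ext; intros; simp [toBase_ι_mul]
  induction n generalizing B with
  | zero =>
    rw [monomial_succ, step B (hw 0), monomial_zero, conv_one]
    simp [toBase_one, lastSign_zero, monomial_zero, koszul_one]
  | succ n ih =>
    rw [monomial_succ, step B (hw 0), ih _ (fun j => hw j.succ), koszul_of_mem (parity 𝒲) _ (monomial_mem_parity fun j => hw j.succ), map_sign_smul,
      LinearMap.smul_apply]
    conv_rhs => rw [Fin.sum_univ_succ, lastSign_zero]
    refine congrArg₂ (· + ·) rfl (Finset.sum_congr rfl fun i _ => ?_)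
    rw [lastSign_succ, monomial_succ 𝒲 fun k => w (i.succ.succAbove k)]
    simp

/-- The first letter lies either in the left factor, where exactly one partner must join it, or in
the right factor. The first case reduces to `conv_toBase_left_monomial`, since `B (w y)` depends
only on the component of `y` in `W`. -/
theorem conv_quadratic_monomial_succ {n : ℕ} (B : GradedSym 𝒲 →ₗ[k] GradedSym 𝒲 →ₗ[k] N)
    (hB : ∀ m ≠ 2, ∀ y ∈ degree 𝒲 m, B y = 0)
    {b : Fin (n + 2) → ZMod 2} {w : Fin (n + 2) → W} (hw : ∀ j, w j ∈ 𝒲 (b j)) :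
    conv 𝒲 B (monomial 𝒲 w) = (∑ j : Fin (n + 1), koszulSign (consPerm 0 (consPerm j 1)) b •
        B (ι 𝒲 (w 0) * ι 𝒲 (w j.succ)) (monomial 𝒲 fun l => w (j.succAbove l).succ)) +
      conv 𝒲 (B.compl₁₂ (koszul (parity 𝒲) (b 0)) (LinearMap.mulLeft k (ι 𝒲 (w 0))))
        (monomial 𝒲 fun i => w i.succ) := by
  have hlow : ∀ u (y : GradedSym 𝒲), B (ι 𝒲 u * y) = B (ι 𝒲 u * ι 𝒲 (toBase 𝒲 y)) := by
    intro u
    have : B ∘ₗ LinearMap.mulLeft k (ι 𝒲 u) =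
        B ∘ₗ LinearMap.mulLeft k (ι 𝒲 u) ∘ₗ ι 𝒲 ∘ₗ toBase 𝒲 := by
      apply hom_ext_degree 𝒲
      intro m y hy
      by_cases hm : m = 1
      · subst hm
        simp [ι_toBase_of_mem_degree_one 𝒲 hy]
      · simp [toBase_of_mem_degree 𝒲 hm hy, hB (m + 1) (by omega) _ (ι_mul_mem_degree 𝒲 u hy)]
    exact LinearMap.congr_fun this
  rw [monomial_succ, conv_ι_mul 𝒲 _ (hw 0)]
  congr 1
  rw [conv_ext 𝒲 (B' := (B ∘ₗ LinearMap.mulLeft k (ι 𝒲 (w 0)) ∘ₗ ι 𝒲) ∘ₗ toBase 𝒲) (by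
      intro i y _ z
      simp only [LinearMap.comp_apply, LinearMap.mulLeft_apply]
      rw [hlow]),
    conv_toBase_left_monomial 𝒲 _ fun j => hw j.succ]
  refine Finset.sum_congr rfl fun j _ => ?_
  rw [koszulSign_consPerm, koszulSign_consPerm, koszulSign_one, firstSign_zero, one_mul, mul_one]
  simp

theorem koszul_mem_degree (q : ZMod 2) {n : ℕ} {x : GradedSym 𝒲} (hx : x ∈ degree 𝒲 n) :
    koszul (parity 𝒲) q x ∈ degree 𝒲 n := by
  induction n generalizing x with
  | zero =>
    obtain ⟨c, rfl⟩ := (mem_degree_zero 𝒲).mp hx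
    rwa [map_smul, koszul_one]
  | succ n ih =>
    refine degree_succ_induction 𝒲 ((degree 𝒲 (n + 1)).comap (koszul (parity 𝒲) q))
      (fun i w hw x hx => ?_) hx
    rw [Submodule.mem_comap, koszul_ι_mul 𝒲 hw]
    exact sign_smul_mem _ _ (ι_mul_mem_degree 𝒲 w (ih hx))

theorem conv_quadratic_monomial {n : ℕ} (B : GradedSym 𝒲 →ₗ[k] GradedSym 𝒲 →ₗ[k] N)
    (hB : ∀ m ≠ 2, ∀ y ∈ degree 𝒲 m, B y = 0)
    {b : Fin (n + 2) → ZMod 2} {w : Fin (n + 2) → W} (hw : ∀ j, w j ∈ 𝒲 (b j)) :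
    conv 𝒲 B (monomial 𝒲 w) = ∑ i, ∑ j : Fin (n + 1), if i ≤ j.castSucc then
      koszulSign (consPerm i (consPerm j 1)) b • B (ι 𝒲 (w i) * ι 𝒲 (w (i.succAbove j)))
        (monomial 𝒲 fun l => w (i.succAbove (j.succAbove l))) else 0 := by
  induction n generalizing B with
  | zero =>
    rw [conv_quadratic_monomial_succ 𝒲 B hB hw]
    conv_rhs => rw [Fin.sum_univ_succ]
    refine congrArg₂ (· + ·) (by simp) ?_
    have hB1 : B 1 = 0 := hB 0 (by simp) 1 ((mem_degree_zero 𝒲).mpr ⟨1, (one_smul _ _).symm⟩)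
    have hBι : ∀ u, B (ι 𝒲 u) = 0 := fun u => hB 1 (by simp) _ (by
      have := ι_mul_mem_degree 𝒲 u ((mem_degree_zero 𝒲).mpr ⟨1, (one_smul _ _).symm⟩)
      rwa [mul_one] at this)
    rw [monomial_succ, conv_ι_mul 𝒲 _ (hw (Fin.succ 0)), monomial_zero, conv_one, conv_one]
    simp [koszul_one, hB1, koszul_of_mem (parity 𝒲) _ (ι_mem_parity 𝒲 (hw 1)), hBι]
  | succ n ih =>
    rw [conv_quadratic_monomial_succ 𝒲 B hB hw]
    conv_rhs => rw [Fin.sum_univ_succ]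
    refine congrArg₂ (· + ·) (by simp) ?_
    rw [ih _ (fun m hm y hy => by
      ext z
      simp [hB m hm _ (koszul_mem_degree 𝒲 (b 0) hy)]) (fun j => hw j.succ)]
    refine Finset.sum_congr rfl fun i _ => ?_
    conv_rhs => rw [Fin.sum_univ_succ]
    -- The index `0` for `j` would put the letter `0` after a larger one, and is excluded by the
    -- order condition.
    rw [if_neg (by simp), zero_add]
    refine Finset.sum_congr rfl fun j _ => ?_
    by_cases hij : i ≤ j.castSucc
    · have hij' : i.succ ≤ j.succ.castSucc := by
        simpa [Fin.le_def] using hij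
      rw [if_pos hij, if_pos hij', monomial_succ 𝒲 fun l => w (i.succ.succAbove (j.succ.succAbove l))]
      have hmem : ι 𝒲 (w i.succ) * ι 𝒲 (w (i.succAbove j).succ) ∈
          parity 𝒲 (b i.succ + b (i.succAbove j).succ) :=
        SetLike.GradedMul.mul_mem (ι_mem_parity 𝒲 (hw _)) (ι_mem_parity 𝒲 (hw _))
      simp only [koszulSign_consPerm, koszulSign_one, mul_one, firstSign_succ,
        LinearMap.compl₁₂_apply, koszul_of_mem (parity 𝒲) _ hmem, map_sign_smul, LinearMap.smul_apply,
        smul_smul, Fin.succ_succAbove_zero, Fin.succ_succAbove_succ, LinearMap.mulLeft_apply]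
      congr 1
      rw [add_mul, uzpow_add]
      exact (by decide : ∀ x y z t : ℤˣ, x * y * (z * t) = z * x * (t * y)) _ _ _ _
    · have hij' : ¬ i.succ ≤ j.succ.castSucc := by
        simpa [Fin.le_def] using hij
      rw [if_neg hij, if_neg hij']

end GradedSym

theorem etaSign_cons {m : ℕ} (c : Fin (m + 2) → ZMod 2) :
    etaSign (Fin.cons (c 0 + c (Fin.succ 0)) fun k : Fin m => c k.succ.succ : Fin (m + 1) → ZMod 2) =
      etaSign c * (-1 : ℤˣ) ^ c 0 := by
  rw [etaSign, etaSign, ← uzpow_add]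
  congr 1
  rw [Fin.sum_univ_succ, Fin.sum_univ_succ (n := m + 1), Fin.sum_univ_succ (n := m)]
  have h : ∀ k : Fin m, m + 1 - 1 - (k.val + 1) = m + 2 - 1 - (k.val + 1 + 1) := fun k => by omega
  simp only [Fin.cons_zero, Fin.cons_succ, Fin.val_succ, h, Fin.val_zero]
  have h1 : m + 1 - 1 - 0 = m := by omega
  have h2 : m + 2 - 1 - 0 = m + 1 := by omega
  have h3 : m + 2 - 1 - (0 + 1) = m := by omega
  rw [h1, h2, h3]
  push_cast
  linear_combination - CharTwo.add_self_eq_zero (c 0)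

/-- The last entry has weight zero, and its removal lowers every other weight by one. -/
theorem etaSign_castSucc {m : ℕ} (c : Fin (m + 2) → ZMod 2) :
    etaSign c = etaSign (fun k : Fin (m + 1) => c k.castSucc) *
      (-1 : ℤˣ) ^ ∑ k : Fin (m + 1), c k.castSucc := by
  rw [etaSign, etaSign, ← uzpow_add]
  congr 1
  rw [Fin.sum_univ_castSucc, ← Finset.sum_add_distrib]
  have h1 : m + 2 - 1 - (Fin.last (m + 1)).val = 0 := by simp
  rw [h1, Nat.cast_zero, zero_mul, add_zero]
  refine Finset.sum_congr rfl fun k _ => ?_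
  have h2 : m + 2 - 1 - k.castSucc.val = (m + 1 - 1 - k.val) + 1 := by
    have := k.is_lt
    simp only [Fin.val_castSucc]
    omega
  rw [h2]
  push_cast
  ring

/-! ### The commutator with the bracket is the Lie coboundary -/

section Comparison

variable {k V : Type*} [Field k] [CharZero k] [AddCommGroup V] [Module k V]
variable {𝒱 : ZMod 2 → Submodule k V} [DirectSum.Decomposition 𝒱]

open GradedSym

theorem structureMaps_sub (δ δ' : SymRev 𝒱 →ₗ[k] SymRev 𝒱) :
    structureMaps 𝒱 (δ - δ') = structureMaps 𝒱 δ - structureMaps 𝒱 δ' := by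
  funext n
  apply multilinear_ext_homogeneous 𝒱
  intro a v hv
  rw [Pi.sub_apply, _root_.sub_apply]
  simp only [structureMaps_eq_monomial _ hv, LinearMap.sub_apply, map_sub, smul_sub]

theorem structureMaps_zero : structureMaps 𝒱 (0 : SymRev 𝒱 →ₗ[k] SymRev 𝒱) = 0 := by
  rw [← sub_self (0 : SymRev 𝒱 →ₗ[k] SymRev 𝒱), structureMaps_sub, sub_self]

theorem ι_mem_degree_one (u : V) : ι (parityRev 𝒱) u ∈ degree (parityRev 𝒱) 1 := by
  have := ι_mul_mem_degree (parityRev 𝒱) u ((mem_degree_zero _).mpr ⟨1, (one_smul _ _).symm⟩)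
  rwa [mul_one] at this

variable {l : V →ₗ[k] V →ₗ[k] V} {D : SymRev 𝒱 →ₗ[k] SymRev 𝒱}

theorem toBase_of_mem_degree_ne_two (h1 : D 1 = 0) (h0 : ∀ n ≠ 1, structureMaps 𝒱 D n = 0) {m : ℕ}
    (hm : m ≠ 2) {x : SymRev 𝒱} (hx : x ∈ degree (parityRev 𝒱) m) :
    toBase (parityRev 𝒱) (D x) = 0 := by
  refine hom_ext_monomial_degree (parityRev 𝒱) (f := toBase (parityRev 𝒱) ∘ₗ D) (g := 0)
    (fun b w hw => ?_) hx
  match m with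
  | 0 => rw [monomial_zero, LinearMap.comp_apply, h1, map_zero, LinearMap.zero_apply]
  | n + 1 => rw [LinearMap.comp_apply, toBase_monomial D hw, h0 n (by omega)]; simp

theorem toBase_ι_mul_ι_of_bracket (hl : ∀ v : Fin 2 → V, structureMaps 𝒱 D 1 v = l (v 0) (v 1))
    {i j : ZMod 2} {u v : V} (hu : u ∈ 𝒱 i) (hv : v ∈ 𝒱 j) :
    toBase (parityRev 𝒱) (D (ι (parityRev 𝒱) u * ι (parityRev 𝒱) v)) = (-1 : ℤˣ) ^ i • l u v := by
  have := toBase_monomial D (a := ![i, j]) (v := ![u, v]) (by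
    intro x; fin_cases x <;> assumption)
  rw [hl, monomial_succ, monomial_succ, monomial_zero, mul_one] at this
  simpa [etaSign] using this

/-- Since `D = coder f` with `f` quadratic, `D` of a monomial replaces two letters by their bracket,
placed in front. The sign of the binary bracket on `ΠV` is absorbed by `etaSign_cons`. -/
theorem structureMaps_comp_bracket (hD : IsCoderivation (parityRev 𝒱) 1 D)
    (hl : ∀ v : Fin 2 → V, structureMaps 𝒱 D 1 v = l (v 0) (v 1))
    (h0 : ∀ n ≠ 1, structureMaps 𝒱 D n = 0) (hle : ∀ (i j : ZMod 2) (x y : V), x ∈ 𝒱 i → y ∈ 𝒱 j →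
      l x y ∈ 𝒱 (i + j)) (δ : SymRev 𝒱 →ₗ[k] SymRev 𝒱) {m : ℕ} {a : Fin (m + 2) → ZMod 2}
    {v : Fin (m + 2) → V} (hv : ∀ i, v i ∈ 𝒱 (a i)) :
    structureMaps 𝒱 (δ ∘ₗ D) (m + 1) v = ∑ σ ∈ unshuffles 2 (m + 2),
      (Equiv.Perm.sign σ * koszulSign σ a) • structureMaps 𝒱 δ m
        (Fin.cons (l (v (σ 0)) (v (σ 1))) fun i : Fin m => v (σ i.succ.succ)) := by
  have hw : ∀ i, v i ∈ parityRev 𝒱 (a i + 1) := fun i => mem_parityRev (hv i)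
  set f := toBase (parityRev 𝒱) ∘ₗ D with hf
  set g := toBase (parityRev 𝒱) ∘ₗ δ with hg
  have hDf : D = coder (parityRev 𝒱) f := hD.eq_coder
  rw [structureMaps_eq_monomial _ hv, LinearMap.comp_apply]
  have h1 : toBase (parityRev 𝒱) (δ (D (monomial (parityRev 𝒱) v))) =
      g (coder (parityRev 𝒱) f (monomial (parityRev 𝒱) v)) := by rw [← hDf]; rfl
  rw [h1, coder, ← conv_compr₂, conv_quadratic_monomial _ _ (fun m hm y hy => by
    ext z
    have := toBase_of_mem_degree_ne_two hD.map_one h0 hm hy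
    simp [hf, this]) hw, sum_unshuffles_two, Finset.smul_sum]
  refine Finset.sum_congr rfl fun i _ => ?_
  rw [Finset.smul_sum]
  refine Finset.sum_congr rfl fun j _ => ?_
  split_ifs
  · set σ := consPerm i (consPerm j 1) with hσ
    have e0 : σ 0 = i := rfl
    have e1 : σ 1 = i.succAbove j := rfl
    have e2 : ∀ x : Fin m, σ x.succ.succ = i.succAbove (j.succAbove x) := fun _ => rfl
    simp only [e0, e1, e2]
    have hu : l (v i) (v (i.succAbove j)) ∈ 𝒱 (a i + a (i.succAbove j)) := hle _ _ _ _ (hv _) (hv _)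
    rw [structureMaps_eq_monomial δ
      (a := Fin.cons (a i + a (i.succAbove j)) fun x => a (i.succAbove (j.succAbove x))) (by
        intro x
        cases x using Fin.cases with
        | zero => simpa using hu
        | succ x => simpa using hv _), monomial_succ]
    have hfu : f (ι (parityRev 𝒱) (v i) * ι (parityRev 𝒱) (v (i.succAbove j))) =
        (-1 : ℤˣ) ^ a i • l (v i) (v (i.succAbove j)) := toBase_ι_mul_ι_of_bracket hl (hv _) (hv _)
    simp only [LinearMap.compr₂_apply, LinearMap.comp_apply, hfu, map_sign_smul,
      LinearMap.smul_apply, LinearMap.mul_apply', smul_smul, Fin.cons_zero, Fin.cons_succ, hg]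
    congr 1
    have h3 := etaSign_cons fun x => a (σ x)
    have h4 := etaSign_mul_koszulSign σ a
    have e1' : σ (Fin.succ 0) = i.succAbove j := rfl
    simp only [e0, e1', e2] at h3
    rw [h3, ← mul_assoc, h4, mul_assoc, mul_assoc]
  · simp

/-- In `δ = coder g` each term has the form `g(x') x''`, and the quadratic `f` sees only the
component of `x''` in `W`. The bracket then contributes the parity of the value of `φ`, namely `q +
m` plus the parities of its arguments; the latter part cancels against `etaSign_castSucc`. -/
theorem structureMaps_bracket_comp (hD : IsCoderivation (parityRev 𝒱) 1 D)
    (hl : ∀ v : Fin 2 → V, structureMaps 𝒱 D 1 v = l (v 0) (v 1))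
    (h0 : ∀ n ≠ 1, structureMaps 𝒱 D n = 0) {q : ZMod 2} {δ : SymRev 𝒱 →ₗ[k] SymRev 𝒱}
    (hδ : IsCoderivation (parityRev 𝒱) q δ) {m : ℕ} {a : Fin (m + 2) → ZMod 2}
    {v : Fin (m + 2) → V} (hv : ∀ i, v i ∈ 𝒱 (a i)) :
    structureMaps 𝒱 (D ∘ₗ δ) (m + 1) v = (-1 : ℤˣ) ^ (q + m) • ∑ σ ∈ unshuffles (m + 1) (m + 2),
      (Equiv.Perm.sign σ * koszulSign σ a) •
        l (structureMaps 𝒱 δ m fun i => v (σ i.castSucc)) (v (σ (Fin.last (m + 1)))) := by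
  have hw : ∀ i, v i ∈ parityRev 𝒱 (a i + 1) := fun i => mem_parityRev (hv i)
  set f := toBase (parityRev 𝒱) ∘ₗ D with hf
  set g := toBase (parityRev 𝒱) ∘ₗ δ with hg
  have hδg : δ = coder (parityRev 𝒱) g := hδ.eq_coder
  have hlow : ∀ u y, f (ι (parityRev 𝒱) u * y) =
      f (ι (parityRev 𝒱) u * ι (parityRev 𝒱) (toBase (parityRev 𝒱) y)) := by
    intro u
    have : f ∘ₗ LinearMap.mulLeft k (ι (parityRev 𝒱) u) =
        f ∘ₗ LinearMap.mulLeft k (ι (parityRev 𝒱) u) ∘ₗ ι (parityRev 𝒱) ∘ₗ toBase (parityRev 𝒱) := by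
      apply hom_ext_degree
      intro n y hy
      by_cases hn : n = 1
      · subst hn
        simp [ι_toBase_of_mem_degree_one _ hy]
      · simp [toBase_of_mem_degree _ hn hy, hf, toBase_of_mem_degree_ne_two hD.map_one h0
          (m := n + 1) (by omega) (ι_mul_mem_degree _ u hy)]
    exact LinearMap.congr_fun this
  rw [structureMaps_eq_monomial _ hv, LinearMap.comp_apply]
  have h1 : toBase (parityRev 𝒱) (D (δ (monomial (parityRev 𝒱) v))) =
      f (coder (parityRev 𝒱) g (monomial (parityRev 𝒱) v)) := by rw [← hδg]; rfl
  rw [h1, coder, ← conv_compr₂, conv_ext (parityRev 𝒱)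
    (B' := (((LinearMap.mul k (SymRev 𝒱)).compl₁₂ (ι (parityRev 𝒱) ∘ₗ g) (ι (parityRev 𝒱))).compr₂
      f).compl₂ (toBase (parityRev 𝒱))) (by
      intro i y _ z
      simp only [LinearMap.compr₂_apply, LinearMap.comp_apply, LinearMap.compl₂_apply,
        LinearMap.compl₁₂_apply, LinearMap.mul_apply']
      exact hlow _ _), conv_toBase_right_monomial _ _ hw, sum_unshuffles_last, Finset.smul_sum,
    Finset.smul_sum]
  refine Finset.sum_congr rfl fun i _ => ?_
  have hv' : ∀ x, v (i.succAbove x) ∈ 𝒱 (a (i.succAbove x)) := fun x => hv _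
  have hφ := (structureMaps_mem_cochains hδ m trivial _ _ hv').1
  simp only [lastPerm_last, lastPerm_castSucc]
  have hgm : g (monomial (parityRev 𝒱) fun x => v (i.succAbove x)) =
      etaSign (fun x => a (i.succAbove x)) • structureMaps 𝒱 δ m fun x => v (i.succAbove x) :=
    toBase_monomial δ hv'
  have hfu := toBase_ι_mul_ι_of_bracket hl hφ (hv i)
  simp only [LinearMap.compr₂_apply, LinearMap.compl₁₂_apply, LinearMap.comp_apply, hgm, map_sign_smul,
    LinearMap.smul_apply, LinearMap.mul_apply', smul_smul, hf, hfu]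
  congr 1
  have h3 := etaSign_castSucc fun x => a (lastPerm i x)
  have h4 := etaSign_mul_koszulSign (lastPerm i) a
  rw [koszulSign_lastPerm] at h4
  simp only [lastPerm_castSucc] at h3
  rw [h3] at h4
  rw [← mul_assoc, ← mul_assoc, h4, uzpow_add _ (q + (m : ZMod 2))]
  exact (by decide : ∀ s e x y z : ℤˣ, s * (e * x) * e * (z * x) = z * s) _ _ _ 1 _

theorem structureMaps_commutator (hD : IsCoderivation (parityRev 𝒱) 1 D)
    (hl : ∀ v : Fin 2 → V, structureMaps 𝒱 D 1 v = l (v 0) (v 1))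
    (h0 : ∀ n ≠ 1, structureMaps 𝒱 D n = 0) (hle : ∀ (i j : ZMod 2) (x y : V), x ∈ 𝒱 i → y ∈ 𝒱 j →
      l x y ∈ 𝒱 (i + j)) {q : ZMod 2} {δ : SymRev 𝒱 →ₗ[k] SymRev 𝒱}
    (hδ : IsCoderivation (parityRev 𝒱) q δ) :
    structureMaps 𝒱 (δ ∘ₗ D - (-1 : ℤˣ) ^ q • (D ∘ₗ δ)) = lieDiff 𝒱 l (structureMaps 𝒱 δ) := by
  funext n
  apply multilinear_ext_homogeneous 𝒱
  intro a v hv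
  match n with
  | 0 =>
    -- In arity one both compositions vanish: `D` kills `W` as there is no unary bracket, and `δ`
    -- maps `W` into `W`, where `D` is zero again.
    have hDι : ∀ u, D (ι (parityRev 𝒱) u) = 0 := by
      intro u
      rw [hD.eq_coder, coder]
      refine (LinearMap.congr_fun (?_ : conv _ _ ∘ₗ ι (parityRev 𝒱) = 0) u)
      apply hom_ext_homogeneous (parityRev 𝒱)
      intro i w hw
      have h1 := toBase_of_mem_degree_ne_two hD.map_one h0 (m := 1) (by simp) (ι_mem_degree_one w)
      rw [LinearMap.comp_apply, ← mul_one (ι (parityRev 𝒱) w), conv_ι_mul _ _ hw, conv_one, conv_one]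
      simp [h1, koszul_one, hD.map_one]
    have hδι : ∀ u, δ (ι (parityRev 𝒱) u) = ι (parityRev 𝒱) (toBase (parityRev 𝒱) (δ (ι (parityRev 𝒱) u))) := by
      intro u
      conv_lhs => rw [hδ.eq_coder, coder]
      refine (LinearMap.congr_fun (?_ : conv _ _ ∘ₗ ι (parityRev 𝒱) = ι (parityRev 𝒱) ∘ₗ
        toBase (parityRev 𝒱) ∘ₗ δ ∘ₗ ι (parityRev 𝒱)) u)
      apply hom_ext_homogeneous (parityRev 𝒱)
      intro i w hw
      rw [LinearMap.comp_apply, ← mul_one (ι (parityRev 𝒱) w), conv_ι_mul _ _ hw, conv_one, conv_one]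
      simp [koszul_one, hδ.map_one]
    have h2 := fun u => toBase_of_mem_degree_ne_two hD.map_one h0 (m := 1) (by simp) (ι_mem_degree_one u)
    rw [structureMaps_eq_monomial _ hv, monomial_succ, monomial_zero, mul_one]
    simp only [LinearMap.sub_apply, LinearMap.comp_apply, LinearMap.smul_apply, hDι, map_zero, zero_sub,
      map_neg, map_sign_smul]
    rw [hδι, h2]
    simp [lieDiff]
  | m + 1 =>
    have h1 := structureMaps_comp_bracket hD hl h0 hle δ hv
    have h2 := structureMaps_bracket_comp hD hl h0 hδ hv
    have h3 := lieCoboundary_apply 𝒱 l (structureMaps 𝒱 δ m) hv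
    have h4 : structureMaps 𝒱 (δ ∘ₗ D - (-1 : ℤˣ) ^ q • (D ∘ₗ δ)) (m + 1) v =
        structureMaps 𝒱 (δ ∘ₗ D) (m + 1) v - (-1 : ℤˣ) ^ q • structureMaps 𝒱 (D ∘ₗ δ) (m + 1) v := by
      simp only [structureMaps_eq_monomial _ hv, LinearMap.sub_apply, LinearMap.smul_apply, map_sub,
        map_sign_smul, smul_sub, smul_smul]
      rw [mul_comm]
    -- The parity `q` cancels, which leaves the sign `(-1)^{n-1}` of the Lie coboundary for `n = m +
    -- 1`.
    have h5 : (-1 : ℤˣ) ^ q * (-1 : ℤˣ) ^ (q + (m : ZMod 2)) = (-1 : ℤˣ) ^ m := by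
      rw [uzpow_add, ← mul_assoc, Int.units_mul_self, one_mul, uzpow_natCast]
    change _ = lieCoboundary 𝒱 l (structureMaps 𝒱 δ m) v
    rw [h4, h1, h2, h3, smul_smul, h5]

end Comparison

/-! ### The codifferential of a Lie bracket -/

section Existence

variable {k V : Type*} [Field k] [CharZero k] [AddCommGroup V] [Module k V]
variable {𝒱 : ZMod 2 → Submodule k V} [DirectSum.Decomposition 𝒱]

open GradedSym

/-- The family consisting of a bilinear map only. -/
noncomputable def bracketFamily (l : V →ₗ[k] V →ₗ[k] V) : Family k V
  | 1 => compInner l (MultilinearMap.ofSubsingleton k V V (0 : Fin 1) LinearMap.id)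
  | _ => 0

theorem bracketFamily_one (l : V →ₗ[k] V →ₗ[k] V) (v : Fin 2 → V) :
    bracketFamily l 1 v = l (v 0) (v 1) := rfl

theorem bracketFamily_of_ne (l : V →ₗ[k] V →ₗ[k] V) {n : ℕ} (hn : n ≠ 1) : bracketFamily l n = 0 := by
  match n with
  | 0 => rfl
  | 1 => exact absurd rfl hn
  | n + 2 => rfl

variable {l : V →ₗ[k] V →ₗ[k] V}

theorem bracketFamily_mem_cochains (hl : IsLieSuperalgebra 𝒱 l) : bracketFamily l ∈ cochains 𝒱 1 := by
  intro n _
  by_cases hn : n = 1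
  · subst hn
    intro a v hv
    rw [bracketFamily_one]
    constructor
    · have := hl.even _ _ _ _ (hv 0) (hv 1)
      rw [Fin.sum_univ_two]
      convert this using 2
      rw [Nat.cast_one, CharTwo.add_self_eq_zero, zero_add]
    · intro σ
      rw [bracketFamily_one]
      rcases (by decide : ∀ σ : Equiv.Perm (Fin 2), σ = 1 ∨ σ = Equiv.swap (0 : Fin 1).castSucc (0 : Fin 1).succ) σ
        with rfl | rfl
      · simp [koszulSign_one]
      · rw [koszulSign_swap, Equiv.Perm.sign_swap (by decide), neg_one_mul, Units.neg_smul]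
        exact hl.skew _ _ _ _ (hv 0) (hv 1)
  · rw [bracketFamily_of_ne l hn]
    exact zero_mem _

theorem sum_unshuffles_jacobi (hl : IsLieSuperalgebra 𝒱 l) {a : Fin 3 → ZMod 2} {v : Fin 3 → V} (hv : ∀ i, v i ∈ 𝒱 (a i)) :
    ∑ σ ∈ unshuffles 2 3, (Equiv.Perm.sign σ * koszulSign σ a) •
      l (l (v (σ 0)) (v (σ 1))) (v (σ 2)) = 0 := by
  -- This trades the sign of the permutation for `lastSign` with shifted parities, which is an
  -- explicit product over at most two letters.
  have hsign : ∀ i, Equiv.Perm.sign (lastPerm i) * koszulSign (lastPerm i) a =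
      etaSign a * lastSign i (fun j => a j + 1) * etaSign fun j => a (lastPerm i j) := by
    intro i
    have := etaSign_mul_koszulSign (lastPerm i) a
    rw [koszulSign_lastPerm] at this
    rw [this, mul_assoc, Int.units_mul_self, mul_one]
  have e0 : ∀ i : Fin 3, lastPerm i 0 = i.succAbove 0 := fun i => lastPerm_castSucc i 0
  have e1 : ∀ i : Fin 3, lastPerm i 1 = i.succAbove 1 := fun i => lastPerm_castSucc i 1
  have e2 : ∀ i : Fin 3, lastPerm i 2 = i := fun i => lastPerm_last i
  rw [sum_unshuffles_last, Fin.sum_univ_three, hsign, hsign, hsign]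
  simp only [e0, e1, e2]
  have s00 : (0 : Fin 3).succAbove 0 = 1 := rfl
  have s01 : (0 : Fin 3).succAbove 1 = 2 := rfl
  have s10 : (1 : Fin 3).succAbove 0 = 0 := rfl
  have s11 : (1 : Fin 3).succAbove 1 = 2 := rfl
  have s20 : (2 : Fin 3).succAbove 0 = 0 := rfl
  have s21 : (2 : Fin 3).succAbove 1 = 1 := rfl
  have heta : ∀ c : Fin 3 → ZMod 2, etaSign c = (-1 : ℤˣ) ^ c 1 := by
    intro c
    rw [etaSign, Fin.sum_univ_three]
    congr 1
    simp
    exact Or.inl rfl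
  have l0 : lastSign (0 : Fin 3) (fun j => a j + 1) = (-1 : ℤˣ) ^ ((a 1 + 1) * (a 0 + 1)) *
      (-1 : ℤˣ) ^ ((a 2 + 1) * (a 0 + 1)) := by
    rw [lastSign, Fin.prod_univ_two, s00, s01, if_pos (by decide), if_pos (by decide)]
  have l1 : lastSign (1 : Fin 3) (fun j => a j + 1) = (-1 : ℤˣ) ^ ((a 2 + 1) * (a 1 + 1)) := by
    rw [lastSign, Fin.prod_univ_two, s10, s11, if_neg (by decide), if_pos (by decide), one_mul]
  have l2 : lastSign (2 : Fin 3) (fun j => a j + 1) = 1 := by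
    rw [lastSign, Fin.prod_univ_two, s20, s21, if_neg (by decide), if_neg (by decide), one_mul]
  have h02 := hl.even _ _ _ _ (hv 0) (hv 2)
  have h12 := hl.even _ _ _ _ (hv 1) (hv 2)
  rw [l0, l1, l2]
  simp only [heta, e1, s00, s01, s10, s11, s20, s21]
  -- Skew symmetry makes two of the terms `[v₀, [v₁, v₂]]` and `[v₁, [v₀, v₂]]`; the Jacobi identity
  -- expands the first, and everything cancels up to signs depending on three parities.
  rw [hl.skew _ _ _ _ h12 (hv 0), hl.skew _ _ _ _ h02 (hv 1), hl.jacobi _ _ _ _ (v 2) (hv 0) (hv 1)]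
  generalize a 0 = x
  generalize a 1 = y
  generalize a 2 = z
  simp only [smul_neg, smul_add, smul_smul]
  rw [(by decide : ∀ x y z : ZMod 2, (-1 : ℤˣ) ^ y * ((-1 : ℤˣ) ^ ((y + 1) * (x + 1)) *
      (-1 : ℤˣ) ^ ((z + 1) * (x + 1))) * (-1 : ℤˣ) ^ z * (-1 : ℤˣ) ^ ((y + z) * x) = 1) x y z,
    (by decide : ∀ x y z : ZMod 2, (-1 : ℤˣ) ^ y * (-1 : ℤˣ) ^ ((z + 1) * (y + 1)) *
      (-1 : ℤˣ) ^ z * (-1 : ℤˣ) ^ ((x + z) * y) = -(-1 : ℤˣ) ^ (x * y)) x y z,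
    (by decide : ∀ x y z : ZMod 2, (-1 : ℤˣ) ^ y * ((-1 : ℤˣ) ^ ((y + 1) * (x + 1)) *
      (-1 : ℤˣ) ^ ((z + 1) * (x + 1))) * (-1 : ℤˣ) ^ z * ((-1 : ℤˣ) ^ ((y + z) * x) *
      (-1 : ℤˣ) ^ (x * y)) = (-1 : ℤˣ) ^ (x * y)) x y z]
  simp only [mul_one, Int.units_mul_self, one_smul, Units.neg_smul, neg_neg]
  abel

theorem lieDiff_bracketFamily (hl : IsLieSuperalgebra 𝒱 l) : lieDiff 𝒱 l (bracketFamily l) = 0 := by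
  have hz : ∀ m, lieCoboundary 𝒱 l (0 : MultilinearMap k (fun _ : Fin (m + 1) => V) V) = 0 := fun m =>
    congrFun (map_zero (lieDiff 𝒱 l)) (m + 1)
  funext n
  match n with
  | 0 => rfl
  | m + 1 =>
    change lieCoboundary 𝒱 l (bracketFamily l m) = 0
    by_cases hm : m = 1
    · subst hm
      apply multilinear_ext_homogeneous 𝒱
      intro a v hv
      have := sum_unshuffles_jacobi hl hv
      rw [lieCoboundary_apply 𝒱 l _ hv]
      -- For `φ = l` both sums run over the unshuffles of type `(2, 1)` and both are the Jacobi sum,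
      -- so each vanishes separately.
      refine (congrArg₂ (fun x y => x - (-1 : ℤˣ) ^ 1 • y) ?_ ?_).trans (?_ : (0 : V) - (-1 : ℤˣ) ^ 1 • (0 : V) = 0)
      · exact this
      · exact this
      · simp
    · rw [bracketFamily_of_ne l hm, hz]

/-- For odd `D` the commutator `[D, D]` is `2 D²`, a coderivation whose cochain is `d l = 0`. It
vanishes, and one can divide by two. -/
theorem exists_lInfinityStructure (hl : IsLieSuperalgebra 𝒱 l) : ∃ D : LInfinityStructure 𝒱, D.IsInducedBy l := by
  obtain ⟨D, hD, hDl⟩ := exists_coderivation (bracketFamily_mem_cochains hl)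
  have h1 : ∀ v : Fin 2 → V, structureMaps 𝒱 D 1 v = l (v 0) (v 1) := fun v => by
    rw [hDl, bracketFamily_one]
  have h0 : ∀ n ≠ 1, structureMaps 𝒱 D n = 0 := fun n hn => by rw [hDl, bracketFamily_of_ne l hn]
  have hc := structureMaps_commutator hD h1 h0 hl.even hD
  rw [hDl, lieDiff_bracketFamily hl] at hc
  have hcod := hD.commutator hD
  have hz : D ∘ₗ D - (-1 : ℤˣ) ^ (1 : ZMod 2) • (D ∘ₗ D) = 0 := by
    apply hcod.eq_zero
    intro x
    rw [toBase_eq_of_structureMaps_eq (δ' := 0) (by rw [hcod.map_one]; rfl)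
      (by rw [hc, structureMaps_zero])]
    simp
  refine ⟨⟨D, hD, ?_⟩, h1, h0⟩
  ext x
  have hx := LinearMap.congr_fun hz x
  rw [uzpow_one, Units.neg_smul, one_smul, sub_neg_eq_add, LinearMap.add_apply, ← two_smul k,
    LinearMap.zero_apply, smul_eq_zero] at hx
  exact hx.resolve_left two_ne_zero

end Existence

theorem LInfinityStructure.IsInducedBy.unique {k V : Type*} [Field k] [CharZero k] [AddCommGroup V]
    [Module k V] {𝒱 : ZMod 2 → Submodule k V} [DirectSum.Decomposition 𝒱] {l : V →ₗ[k] V →ₗ[k] V}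
    {D D' : LInfinityStructure 𝒱} (h : D.IsInducedBy l) (h' : D'.IsInducedBy l) : D = D' := by
  have : D.d = D'.d := by
    apply D.isCoderivation.eq_of_structureMaps_eq D'.isCoderivation
    funext n
    by_cases hn : n = 1
    · subst hn
      ext v
      rw [h.1, h'.1]
    · rw [h.2 n hn, h'.2 n hn]
  cases D; cases D'; simp only at this; subst this; rfl

/-! ### Cocycles, coboundaries and classes of deformations -/

section Classification

variable {k V : Type*} [Field k] [CharZero k] [AddCommGroup V] [Module k V]
variable {𝒱 : ZMod 2 → Submodule k V} [DirectSum.Decomposition 𝒱]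
variable {l : V →ₗ[k] V →ₗ[k] V} {D : LInfinityStructure 𝒱}

theorem LInfinityStructure.IsInducedBy.structureMaps_coboundary (hl : IsLieSuperalgebra 𝒱 l)
    (hD : D.IsInducedBy l) {q : ZMod 2} {δ : SymRev 𝒱 →ₗ[k] SymRev 𝒱}
    (hδ : IsCoderivation (parityRev 𝒱) q δ) :
    structureMaps 𝒱 (D.coboundary q δ) = lieDiff 𝒱 l (structureMaps 𝒱 δ) :=
  structureMaps_commutator D.isCoderivation hD.1 hD.2 hl.even hδ

theorem LInfinityStructure.IsInducedBy.coboundary_eq_zero_iff (hl : IsLieSuperalgebra 𝒱 l)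
    (hD : D.IsInducedBy l) {q : ZMod 2} {δ : SymRev 𝒱 →ₗ[k] SymRev 𝒱}
    (hδ : IsCoderivation (parityRev 𝒱) q δ) :
    D.coboundary q δ = 0 ↔ structureMaps 𝒱 δ ∈ lieCocycles 𝒱 l q := by
  have hc := hD.structureMaps_coboundary hl hδ
  rw [lieCocycles, Submodule.mem_inf, LinearMap.mem_ker, ← hc,
    and_iff_right (structureMaps_mem_cochains hδ)]
  constructor
  · intro h; rw [h, structureMaps_zero]
  · intro h
    have hcod := D.isCoderivation_coboundary hδ
    apply hcod.eq_zero
    intro x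
    rw [toBase_eq_of_structureMaps_eq (δ' := 0) (by rw [hcod.map_one]; rfl)
      (by rw [h, structureMaps_zero])]
    simp

/-- The identity `d² = 0` is transported from the coalgebra, where `[[δ, D], D] = 0` is immediate
from `D² = 0`. -/
theorem LInfinityStructure.IsInducedBy.lieCoboundaries_le (hl : IsLieSuperalgebra 𝒱 l)
    (hD : D.IsInducedBy l) (q : ZMod 2) : lieCoboundaries 𝒱 l q ≤ lieCocycles 𝒱 l q := by
  rintro _ ⟨φ, hφ, rfl⟩
  obtain ⟨δ, hδ, rfl⟩ := exists_coderivation hφ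
  have hcod := D.isCoderivation_coboundary hδ
  have h := D.coboundary_coboundary (q + 1) δ
  rw [zmod_two_add_one_add_one] at hcod h
  rw [← hD.structureMaps_coboundary hl hδ]
  exact (hD.coboundary_eq_zero_iff hl hcod).mp h

namespace InfDeformation

variable {p : ZMod 2}

theorem cochain_mem (hl : IsLieSuperalgebra 𝒱 l) (hD : D.IsInducedBy l) (F : InfDeformation D p) :
    F.cochain ∈ lieCocycles 𝒱 l (p + 1) :=
  (hD.coboundary_eq_zero_iff hl F.isCoderivation_increment).mp F.coboundary_increment

theorem cochain_injective : Function.Injective (cochain : InfDeformation D p → Family k V) :=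
  fun F F' h => ext_increment
    (F.isCoderivation_increment.eq_of_structureMaps_eq F'.isCoderivation_increment h)

theorem exists_cochain_eq (hl : IsLieSuperalgebra 𝒱 l) (hD : D.IsInducedBy l) {φ : Family k V}
    (hφ : φ ∈ lieCocycles 𝒱 l (p + 1)) : ∃ F : InfDeformation D p, F.cochain = φ := by
  obtain ⟨δ, hδ, rfl⟩ := exists_coderivation hφ.1
  refine ⟨ofIncrement δ hδ ((hD.coboundary_eq_zero_iff hl hδ).mpr hφ), ?_⟩
  exact congrArg (structureMaps 𝒱) (increment_ofIncrement δ hδ _)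

/-- This translates `equivalent_iff` through the bijection with cochains: the `β` there is any
coderivation of parity `p`, hence any cochain of total parity `p`. -/
theorem equivalent_iff_cochain (hl : IsLieSuperalgebra 𝒱 l) (hD : D.IsInducedBy l)
    (F F' : InfDeformation D p) :
    F.Equivalent F' ↔ F'.cochain - F.cochain ∈ lieCoboundaries 𝒱 l (p + 1) := by
  have hsub : F'.cochain - F.cochain = structureMaps 𝒱 (F'.increment - F.increment) :=
    (structureMaps_sub _ _).symm
  rw [equivalent_iff, hsub, lieCoboundaries, zmod_two_add_one_add_one]
  constructor
  · rintro ⟨β, hβ, h⟩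
    exact ⟨structureMaps 𝒱 β, structureMaps_mem_cochains hβ, by
      rw [h, hD.structureMaps_coboundary hl hβ]⟩
  · rintro ⟨φ, hφ, h⟩
    obtain ⟨β, hβ, rfl⟩ := exists_coderivation hφ
    refine ⟨β, hβ, ?_⟩
    apply (F'.isCoderivation_increment.sub F.isCoderivation_increment).eq_of_structureMaps_eq
      (D.isCoderivation_coboundary hβ)
    rw [← h, hD.structureMaps_coboundary hl hβ]

theorem equivalence (hl : IsLieSuperalgebra 𝒱 l) (hD : D.IsInducedBy l) :
    Equivalence (InfDeformation.Equivalent (D := D) (p := p)) where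
  refl F := by rw [equivalent_iff_cochain hl hD, sub_self]; exact zero_mem _
  symm {F F'} h := by
    rw [equivalent_iff_cochain hl hD] at h ⊢
    rw [← neg_sub]; exact neg_mem h
  trans {F F' F''} h h' := by
    rw [equivalent_iff_cochain hl hD] at h h' ⊢
    rw [← sub_add_sub_cancel]; exact add_mem h' h

/-- Infinitesimal deformations correspond to cocycles. -/
noncomputable def equivCocycles (hl : IsLieSuperalgebra 𝒱 l) (hD : D.IsInducedBy l) :
    InfDeformation D p ≃ lieCocycles 𝒱 l (p + 1) :=
  Equiv.ofBijective (fun F => ⟨F.cochain, F.cochain_mem hl hD⟩)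
    ⟨fun _ _ h => cochain_injective (congrArg Subtype.val h), fun φ =>
      (exists_cochain_eq hl hD φ.2).imp fun _ h => Subtype.ext h⟩

/-- Classes of infinitesimal deformations correspond to cohomology classes. -/
noncomputable def equivCohomology (hl : IsLieSuperalgebra 𝒱 l) (hD : D.IsInducedBy l) :
    LieCohomology 𝒱 l (p + 1) ≃ Quot (InfDeformation.Equivalent (D := D) (p := p)) :=
  (Quot.congr (equivCocycles hl hD) fun F F' => by
    -- The quotient relation of a submodule uses the opposite difference.
    rw [equivalent_iff_cochain hl hD, ← neg_mem_iff, neg_sub]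
    rw [Submodule.quotientRel_def]
    rfl).symm

theorem equivCohomology_mk (hl : IsLieSuperalgebra 𝒱 l) (hD : D.IsInducedBy l)
    (F : InfDeformation D p) :
    equivCohomology hl hD (Submodule.Quotient.mk ⟨F.cochain, F.cochain_mem hl hD⟩) = Quot.mk _ F :=
  (Equiv.symm_apply_eq _).mpr rfl

end InfDeformation
end Classification
end SuperLie

theorem mainTheorem5 {k V : Type*} [Field k] [CharZero k] [AddCommGroup V] [Module k V]
    (𝒱 : ZMod 2 → Submodule k V) [DirectSum.Decomposition 𝒱]
    (l : V →ₗ[k] V →ₗ[k] V) (hl : IsLieSuperalgebra 𝒱 l) :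
    (∃! D : LInfinityStructure 𝒱, D.IsInducedBy l) ∧
    ∀ D : LInfinityStructure 𝒱, D.IsInducedBy l →
      (∀ q : ZMod 2,
        Set.BijOn (structureMaps 𝒱) {δ | IsCoderivation (parityRev 𝒱) q δ} (cochains 𝒱 q) ∧
        (∀ δ, IsCoderivation (parityRev 𝒱) q δ →
          IsCoderivation (parityRev 𝒱) (q + 1) (D.coboundary q δ) ∧
          structureMaps 𝒱 (D.coboundary q δ) = lieDiff 𝒱 l (structureMaps 𝒱 δ)) ∧
        lieCoboundaries 𝒱 l q ≤ lieCocycles 𝒱 l q) ∧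
      ∀ p : ZMod 2,
        Equivalence (InfDeformation.Equivalent (D := D) (p := p)) ∧
        (∀ φ ∈ lieCocycles 𝒱 l (p + 1), ∃! F : InfDeformation D p, F.cochain = φ) ∧
        ∃ (hc : ∀ F : InfDeformation D p, F.cochain ∈ lieCocycles 𝒱 l (p + 1))
          (e : LieCohomology 𝒱 l (p + 1) ≃ Quot (InfDeformation.Equivalent (D := D) (p := p))),
          ∀ F : InfDeformation D p,
            e (Submodule.Quotient.mk ⟨F.cochain, hc F⟩) = Quot.mk _ F := by
  refine ⟨?_, fun D hD => ⟨fun q => ⟨bijOn_structureMaps q, fun δ hδ =>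
    ⟨D.isCoderivation_coboundary hδ, hD.structureMaps_coboundary hl hδ⟩,
    hD.lieCoboundaries_le hl q⟩, fun p => ⟨InfDeformation.equivalence hl hD, fun φ hφ => ?_,
    fun F => F.cochain_mem hl hD, InfDeformation.equivCohomology hl hD,
    InfDeformation.equivCohomology_mk hl hD⟩⟩⟩
  · obtain ⟨D, hD⟩ := exists_lInfinityStructure hl
    exact ⟨D, hD, fun D' hD' => hD'.unique hD⟩
  · obtain ⟨F, hF⟩ := InfDeformation.exists_cochain_eq hl hD hφ
    exact ⟨F, hF, fun F' hF' => InfDeformation.cochain_injective (hF'.trans hF.symm)⟩
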